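/- All algorithms are deterministic programs of a unit-cost word RAM: on an input of size $n$ the machine works with words of $O(\log n)$ bits (numbers below $(n+2)^c$ for a constant $c$ of the algorithm), and each arithmetic, bitwise, comparison, memory or input/output instruction costs one step. **OMv conjecture.** For every $\epsilon>0$ there is no $O(N^{3-\epsilon})$-time algorithm that is given a Boolean $N\times N$ matrix $M$ and a stream of Boolean vectors $v_1,\dots,v_N$ and computes the Boolean products $Mv_1,\dots,Mv_N$ online, i.e. outputs $Mv_i$ before receiving $v_{i+1}$. (The time includes the preprocessing of $M$.) **Dynamic oracles.** Let $G$ be a simple undirected planar graph with $n$ vertices and positive integer edge weights. A dynamic shortest paths counting oracle first preprocesses the weighted graph $G$ in polynomial time, and then processes online a sequence of operations of two kinds: a query $(s,t)$, to be answered by the number of shortest $s$-to-$t$ paths under the current weights ($0$ if $t$ is not reachable from $s$), and an update, which changes the weight of one given edge of $G$. It has amortized query time $q(n)$ and update time $u(n)$ if for some constant $c$ preprocessing and operations together always take at most $(n+2)^c+a\,q(n)+b\,u(n)$ steps, where $a$ and $b$ are the numbers of queries and updates. For an integer $d\ge 0$ call it an oracle *for range $n^d$* if it has to work only on those inputs for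 which, at all times, every edge weight and the number of shortest paths between any two vertices is at most $n^d$. **Theorem 6.1.** Assume the OMv conjecture. Then there is an absolute constant $d$ such that for every $\epsilon>0$ there is no dynamic shortest paths counting oracle for range $n^d$ in undirected $n$-vertex planar graphs with amortized query time $q(n)$ and amortized update time $u(n)$ satisfying $q(n)+u(n)=O(n^{1/2-\epsilon})$. This holds even if every update only increases or decreases the weight of one edge by $1$. -/

import Mathlib

open scoped NNReal
open Asymptotics Filter

/-! ### A word RAM with unit cost

A machine has registers, a memory, a read-only input array and a write-only output array, all
indexed by natural numbers.  Programs are finite; every executed instruction or test costs one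
unit.  The execution relation carries a bound `B` on the words: an instruction whose result is not
smaller than `B` cannot be executed.  With `B` polynomial in the input size this is the word RAM
whose words have logarithmically many bits. -/

namespace RAM

/-- The arithmetical, bitwise and comparison operations on words. -/
inductive BinOp
  | add | sub | mul | div | mod | and | or | xor | shl | shr | lt | eq

/-- Subtraction is truncated at `0`, division by `0` gives `0`, comparisons return `0` or `1`. -/
def BinOp.eval : BinOp → ℕ → ℕ → ℕ
  | add, a, b => a + b
  | sub, a, b => a - b
  | mul, a, b => a * b
  | div, a, b => a / b
  | mod, a, b => a % b
  | and, a, b => a &&& b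
  | or, a, b => a ||| b
  | xor, a, b => a ^^^ b
  | shl, a, b => a <<< b
  | shr, a, b => a >>> b
  | lt, a, b => if a < b then 1 else 0
  | eq, a, b => if a = b then 1 else 0

/-- Programs; `r`, `a`, `b` are names of registers. -/
inductive Prog
  /-- do nothing -/
  | skip
  /-- `r := c` for a literal `c` -/
  | const (r c : ℕ)
  /-- `r := o a b` -/
  | op (o : BinOp) (r a b : ℕ)
  /-- `r := mem[a]` (indirect addressing) -/
  | load (r a : ℕ)
  /-- `mem[a] := b` (indirect addressing) -/
  | store (a b : ℕ)
  /-- `r := inp[a]` -/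
  | input (r a : ℕ)
  /-- `out[a] := b` -/
  | output (a b : ℕ)
  /-- first `p`, then `p'` -/
  | seq (p p' : Prog)
  /-- if `r ≠ 0` then `p` else `p'` -/
  | ifnz (r : ℕ) (p p' : Prog)
  /-- while `r ≠ 0` do `p` -/
  | whilenz (r : ℕ) (p : Prog)

/-- The state of a machine. -/
structure State where
  reg : ℕ → ℕ
  mem : ℕ → ℕ
  inp : ℕ → ℕ
  out : ℕ → ℕ

namespace State

def setReg (s : State) (r x : ℕ) : State := { s with reg := Function.update s.reg r x }

def setMem (s : State) (a x : ℕ) : State := { s with mem := Function.update s.mem a x }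

def setOut (s : State) (a x : ℕ) : State := { s with out := Function.update s.out a x }

/-- The environment supplies a new input array and clears the output array; registers and memory
are kept. -/
def feed (s : State) (x : ℕ → ℕ) : State := { s with inp := x, out := fun _ => 0 }

/-- The initial state with input `x`: registers, memory and output are zero. -/
def initial (x : ℕ → ℕ) : State := ⟨fun _ => 0, fun _ => 0, x, fun _ => 0⟩

end State

/-- `Exec B p s t s'`: started in state `s`, the program `p` halts in state `s'` after exactly `t`
steps, and every word it produces on the way is smaller than `B`. -/
inductive Exec (B : ℕ) : Prog → State → ℕ → State → Prop
  | skip (s : State) : Exec B .skip s 1 s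
  | const (s : State) (r c : ℕ) (h : c < B) : Exec B (.const r c) s 1 (s.setReg r c)
  | op (s : State) (o : BinOp) (r a b : ℕ) (h : o.eval (s.reg a) (s.reg b) < B) :
      Exec B (.op o r a b) s 1 (s.setReg r (o.eval (s.reg a) (s.reg b)))
  | load (s : State) (r a : ℕ) (h : s.mem (s.reg a) < B) :
      Exec B (.load r a) s 1 (s.setReg r (s.mem (s.reg a)))
  | store (s : State) (a b : ℕ) :
      Exec B (.store a b) s 1 (s.setMem (s.reg a) (s.reg b))
  | input (s : State) (r a : ℕ) (h : s.inp (s.reg a) < B) :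
      Exec B (.input r a) s 1 (s.setReg r (s.inp (s.reg a)))
  | output (s : State) (a b : ℕ) :
      Exec B (.output a b) s 1 (s.setOut (s.reg a) (s.reg b))
  | seq {p p' : Prog} {s s' s'' : State} {t t' : ℕ} (h : Exec B p s t s')
      (h' : Exec B p' s' t' s'') : Exec B (.seq p p') s (t + t') s''
  | ifTrue {r : ℕ} {p p' : Prog} {s s' : State} {t : ℕ} (hr : s.reg r ≠ 0)
      (h : Exec B p s t s') : Exec B (.ifnz r p p') s (t + 1) s'
  | ifFalse {r : ℕ} {p p' : Prog} {s s' : State} {t : ℕ} (hr : s.reg r = 0)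
      (h : Exec B p' s t s') : Exec B (.ifnz r p p') s (t + 1) s'
  | whileTrue {r : ℕ} {p : Prog} {s s' s'' : State} {t t' : ℕ} (hr : s.reg r ≠ 0)
      (h : Exec B p s t s') (h' : Exec B (.whilenz r p) s' t' s'') :
      Exec B (.whilenz r p) s (t + t' + 1) s''
  | whileFalse {r : ℕ} {p : Prog} {s : State} (hr : s.reg r = 0) :
      Exec B (.whilenz r p) s 1 s

/-- The words available on inputs of size `n`: the numbers below `(n + 2) ^ c`, that is, numbers
with at most `O(c log n)` bits. -/
def wordBound (c n : ℕ) : ℕ := (n + 2) ^ c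

/-- The input array that holds `n` and then, row by row, the entries of an `n × n` table. -/
def tableInput (n : ℕ) (f : Fin n → Fin n → ℕ) : ℕ → ℕ
  | 0 => n
  | a + 1 => if h : a < n * n then f (Fin.divNat ⟨a, h⟩) (Fin.modNat ⟨a, h⟩) else 0

/-- The input array that holds the entries of a list, followed by zeros. -/
def listInput (l : List ℕ) : ℕ → ℕ := fun a => l.getD a 0

end RAM

/-! ### Online Boolean matrix-vector multiplication -/

namespace OMv

open RAM

/-- An online algorithm: `prepare` is run once on the matrix, then `answer` is run once for every
arriving vector.  When a vector is processed, later vectors have not been supplied yet. -/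
structure Algorithm where
  prepare : Prog
  answer : Prog

/-- The `i`-th entry of the Boolean product `M v`, as a number `0` or `1`. -/
noncomputable def product {N : ℕ} (M : Fin N → Fin N → Bool) (v : Fin N → Bool) (i : Fin N) : ℕ :=
  open Classical in if ∃ j, M i j = true ∧ v j = true then 1 else 0

/-- From state `s` the program `p` processes the vectors of the list one after another, and
correctly outputs the product of `M` with each of them before it receives the next one;
`t` is the total number of steps. -/
inductive Answers (B : ℕ) (p : Prog) {N : ℕ} (M : Fin N → Fin N → Bool) :
    State → List (Fin N → Bool) → ℕ → Prop
  | nil (s : State) : Answers B p M s [] 0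
  | cons {s s' : State} {v : Fin N → Bool} {l : List (Fin N → Bool)} {t t' : ℕ}
      (h : Exec B p (s.feed (listInput (List.ofFn fun j => (v j).toNat))) t s')
      (hout : ∀ i : Fin N, s'.out i = product M v i)
      (h' : Answers B p M s' l t') :
      Answers B p M s (v :: l) (t + t')

/-- The algorithm `A` solves the online problem in time `T(N)`, on words of `O(log N)` bits: for
every Boolean `N × N` matrix and every `N` vectors, the preprocessing of the matrix and the
computation of the `N` products together take at most `T N` steps. -/
def Algorithm.SolvesInTime (A : Algorithm) (T : ℕ → ℝ) : Prop :=
  ∃ c : ℕ, ∀ (N : ℕ) (M : Fin N → Fin N → Bool) (v : Fin N → Fin N → Bool),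
    ∃ (t₀ : ℕ) (s₀ : State) (t : ℕ),
      Exec (wordBound c N) A.prepare
        (State.initial (tableInput N fun i j => (M i j).toNat)) t₀ s₀ ∧
      Answers (wordBound c N) A.answer M s₀ (List.ofFn v) t ∧
      ((t₀ + t : ℕ) : ℝ) ≤ T N

/-- The OMv conjecture: for no `ε > 0` is there an `O(N ^ (3 - ε))`-time algorithm for online
Boolean matrix-vector multiplication. -/
def Conjecture : Prop :=
  ∀ ε : ℝ, 0 < ε → ¬ ∃ (A : Algorithm) (T : ℕ → ℝ),
    A.SolvesInTime T ∧ T =O[atTop] fun N : ℕ => (N : ℝ) ^ (3 - ε)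

end OMv

/-! ### Counting shortest paths in planar graphs -/

namespace PathCount

/-- A graph is planar if it can be drawn in the plane: vertices are distinct points, an edge is a
simple arc between its two end points, and the interior of an arc meets neither a vertex nor
another arc. -/
def IsPlanar {V : Type*} (G : SimpleGraph V) : Prop :=
  ∃ (pos : V → ℝ × ℝ) (arc : G.edgeSet → unitInterval → ℝ × ℝ),
    Function.Injective pos ∧
    (∀ e, Continuous (arc e) ∧ Function.Injective (arc e)) ∧
    (∀ e, s(arc e 0, arc e 1) = Sym2.map pos e) ∧
    (∀ e, ∀ x ∈ Set.Ioo (0 : unitInterval) 1, arc e x ∉ Set.range pos) ∧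
    (∀ e f, e ≠ f → ∀ x ∈ Set.Ioo (0 : unitInterval) 1, arc e x ∉ Set.range (arc f))

variable {n : ℕ}

/-- The length of a walk with respect to the edge weights `w`. -/
def length {G : SimpleGraph (Fin n)} (w : Sym2 (Fin n) → ℕ) {a b : Fin n} (p : G.Walk a b) : ℕ :=
  (p.edges.map w).sum

/-- The number of shortest paths from `a` to `b`; it is `0` if `b` cannot be reached. -/
noncomputable def count (G : SimpleGraph (Fin n)) (w : Sym2 (Fin n) → ℕ) (a b : Fin n) : ℕ :=
  Set.ncard {p : G.Walk a b | p.IsPath ∧ ∀ q : G.Walk a b, q.IsPath → length w p ≤ length w q}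

/-- The operations of a dynamic oracle: ask for the number of shortest paths from `a` to `b`, and
change the weight of the edge `ab` to `x`. -/
inductive Operation (n : ℕ)
  | query (a b : Fin n)
  | update (a b : Fin n) (x : ℕ)

def numQueries : List (Operation n) → ℕ
  | [] => 0
  | .query _ _ :: l => numQueries l + 1
  | .update _ _ _ :: l => numQueries l

def numUpdates : List (Operation n) → ℕ
  | [] => 0
  | .query _ _ :: l => numUpdates l
  | .update _ _ _ :: l => numUpdates l + 1

/-- All edge weights are positive integers at most `U`, and between any two vertices there are at
most `U` shortest paths. -/
def Bounded (U : ℕ) (G : SimpleGraph (Fin n)) (w : Sym2 (Fin n) → ℕ) : Prop :=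
  (∀ e ∈ G.edgeSet, 1 ≤ w e ∧ w e ≤ U) ∧ ∀ a b, count G w a b ≤ U

/-- Which updates are allowed: arbitrary new weights, or only increments and decrements by `1`. -/
inductive UpdateKind
  | arbitrary
  | unit

def UpdateKind.Allows : UpdateKind → ℕ → ℕ → Prop
  | arbitrary, _, _ => True
  | unit, old, new => new = old + 1 ∨ old = new + 1

/-- The list of operations is legal when started with the weights `w`: updates concern edges of
the graph and are of the given kind, and the weights stay bounded at all times. -/
def Legal (k : UpdateKind) (U : ℕ) (G : SimpleGraph (Fin n)) :
    (Sym2 (Fin n) → ℕ) → List (Operation n) → Prop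
  | w, [] => Bounded U G w
  | w, .query _ _ :: l => Legal k U G w l
  | w, .update a b x :: l =>
      Bounded U G w ∧ G.Adj a b ∧ k.Allows (w s(a, b)) x ∧
        Legal k U G (Function.update w s(a, b) x) l

open RAM

/-- A dynamic oracle: `prepare` is run once on the weighted graph, `answer` on every query, and
`change` on every update. -/
structure Oracle where
  prepare : Prog
  answer : Prog
  change : Prog

/-- From state `s`, where the current weights are `w`, the oracle executes the operations of the
list one after another and answers all queries correctly; `t` is the total number of steps. -/
inductive Serves (B : ℕ) (A : Oracle) (G : SimpleGraph (Fin n)) :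
    (Sym2 (Fin n) → ℕ) → State → List (Operation n) → ℕ → Prop
  | nil (w : Sym2 (Fin n) → ℕ) (s : State) : Serves B A G w s [] 0
  | query {w : Sym2 (Fin n) → ℕ} {s s' : State} {a b : Fin n} {l : List (Operation n)} {t t' : ℕ}
      (h : Exec B A.answer (s.feed (listInput [a, b])) t s')
      (hout : s'.out 0 = count G w a b)
      (h' : Serves B A G w s' l t') :
      Serves B A G w s (.query a b :: l) (t + t')
  | update {w : Sym2 (Fin n) → ℕ} {s s' : State} {a b : Fin n} {x : ℕ} {l : List (Operation n)}
      {t t' : ℕ}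
      (h : Exec B A.change (s.feed (listInput [a, b, x])) t s')
      (h' : Serves B A G (Function.update w s(a, b) x) s' l t') :
      Serves B A G w s (.update a b x :: l) (t + t')

/-- The input array that holds the weighted adjacency matrix, with `0` for non-adjacent pairs. -/
noncomputable def graphInput (G : SimpleGraph (Fin n)) (w : Sym2 (Fin n) → ℕ) : ℕ → ℕ :=
  open Classical in tableInput n fun a b => if G.Adj a b then w s(a, b) else 0

/-- `A` is a dynamic oracle for counting shortest paths in undirected planar graphs with amortized
query time `q` and amortized update time `u`, for updates of kind `k`.  It has to work on planar
graphs with `n` vertices whose edge weights and numbers of shortest paths are at most `n ^ d` at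
all times, on words of `O(log n)` bits.  It may spend polynomial time on preprocessing; over every
legal sequence of operations, each query is charged `q n` and each update `u n`. -/
def Oracle.Counts (A : Oracle) (k : UpdateKind) (d : ℕ) (q u : ℕ → ℝ≥0) : Prop :=
  ∃ c : ℕ, ∀ (n : ℕ) (G : SimpleGraph (Fin n)), IsPlanar G →
    ∀ (w : Sym2 (Fin n) → ℕ) (l : List (Operation n)), Legal k (n ^ d) G w l →
      ∃ (t₀ : ℕ) (s₀ : State) (t : ℕ),
        Exec (wordBound c n) A.prepare (State.initial (graphInput G w)) t₀ s₀ ∧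
        Serves (wordBound c n) A G w s₀ l t ∧
        ((t₀ + t : ℕ) : ℝ) ≤ ((n : ℝ) + 2) ^ c + numQueries l * q n + numUpdates l * u n

end PathCount

/-! ### Grid graphs -/

/-! The reduction stores a Boolean matrix `M` of size m in the weights of a grid with 2(m+1) rows
and m+1 columns. Horizontal edges become dearer towards the middle rows, and a single vertical edge
costs more than any horizontal trip. Hence a shortest path between the mirror vertices (i, 0) and
(2m+1-i, m) follows row i to some column x, descends in that column and finishes in the mirror row.
The main parts of the lengths of these m+1 paths agree; they differ only in small numbers added to
the vertical edges of column x. These numbers telescope: for every i at once, their sum is a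
constant, plus a bit that for x > 0 vanishes exactly when M i (x-1) is true, plus the number on the
edge joining the two middle rows, which m unit updates set to 0 or 2 according to a vector v. Column
0 always attains the minimum, so there is a second shortest path exactly when row i of M and v share
a 1 (`count_mirror`, `sum_extra`, `Stage.one_lt_count`). For arbitrary end points a shortest path is
still determined by its turning column, so all counts are at most m+1 (`count_le`).

One product of size m thus costs m queries and 2m updates on n = 2(m+1)^2 vertices, about m *
n^(1/2-ε), that is m^(2-2ε) steps. The preprocessing may take n^c steps, which is too much for a
graph made from the whole N × N matrix. So the matrix is cut into about (N/m)^2 blocks of size m,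
roughly N^(1/(2c+1)), with an oracle for each. Preprocessing all of them is affordable, and N
products cost about (N/m)^2 * N * m^(2-2ε) = N^3 * m^(-2ε) steps, a polynomial saving that
contradicts the conjecture (`exists_solvesInTime`, `time_le`).

It remains to run many oracles on one word RAM. Each lives in its own memory segment and is
simulated with constant slow-down (`simulate_run`); its input is never written down but computed on
demand from the matrix or the vector. The operations do not depend on the answers, so the amortized
bound can be applied to the whole stream of operations of each block. -/

namespace Grid

variable {R W : ℕ}

/-- The row of a vertex of the grid with `R` rows and `W` columns. -/
def row (u : Fin (R * W)) : ℕ := u / W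

/-- The column of a vertex of the grid. -/
def col (u : Fin (R * W)) : ℕ := u % W

theorem ext_row_col {u v : Fin (R * W)} (hr : row u = row v) (hc : col u = col v) : u = v := by
  apply Fin.ext
  rw [← Nat.div_add_mod (u : ℕ) W, ← Nat.div_add_mod (v : ℕ) W]
  unfold row at hr; unfold col at hc
  rw [hr, hc]

theorem row_lt (u : Fin (R * W)) : row u < R :=
  Nat.div_lt_of_lt_mul (u.2.trans_eq (Nat.mul_comm R W))

theorem col_lt (u : Fin (R * W)) : col u < W :=
  Nat.mod_lt _ (Nat.pos_of_ne_zero fun h => by have := u.2; simp [h] at this)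

/-- The grid graph with `R` rows and `W` columns; vertices are numbered row by row. -/
def graph (R W : ℕ) : SimpleGraph (Fin (R * W)) where
  Adj u v := (row u = row v ∧ (col u + 1 = col v ∨ col v + 1 = col u)) ∨
    (col u = col v ∧ (row u + 1 = row v ∨ row v + 1 = row u))
  symm := ⟨fun u v h => by omega⟩
  loopless := ⟨fun u h => by omega⟩

theorem adj_iff {u v : Fin (R * W)} : (graph R W).Adj u v ↔
    (row u = row v ∧ (col u + 1 = col v ∨ col v + 1 = col u)) ∨
    (col u = col v ∧ (row u + 1 = row v ∨ row v + 1 = row u)) := Iff.rfl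

/-- `v` is the right or the lower neighbour of `u`. -/
def Succ (u v : Fin (R * W)) : Prop :=
  (row u = row v ∧ col u + 1 = col v) ∨ (col u = col v ∧ row u + 1 = row v)

theorem exists_succ (e : (graph R W).edgeSet) : ∃ p : Fin (R * W) × Fin (R * W),
    (e : Sym2 (Fin (R * W))) = s(p.1, p.2) ∧ Succ p.1 p.2 := by
  obtain ⟨e, he⟩ := e
  induction e using Sym2.ind with
  | _ u v =>
    rw [SimpleGraph.mem_edgeSet, adj_iff] at he
    rcases he with ⟨h, h' | h'⟩ | ⟨h, h' | h'⟩
    · exact ⟨(u, v), rfl, Or.inl ⟨h, h'⟩⟩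
    · exact ⟨(v, u), Sym2.eq_swap, Or.inl ⟨h.symm, h'⟩⟩
    · exact ⟨(u, v), rfl, Or.inr ⟨h, h'⟩⟩
    · exact ⟨(v, u), Sym2.eq_swap, Or.inr ⟨h.symm, h'⟩⟩

/-- The drawing is by straight segments, with every edge oriented to the right or downwards. An
interior point of an edge has one integral coordinate and one strictly between consecutive integers,
so it lies on no vertex and on no perpendicular edge; a parallel edge through it has the same end
points. -/
theorem isPlanar (R W : ℕ) : PathCount.IsPlanar (graph R W) := by
  choose p hp hs using exists_succ (R := R) (W := W)
  have key : ∀ e f : (graph R W).edgeSet, row (p e).1 = row (p f).1 → col (p e).1 = col (p f).1 →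
      row (p e).2 = row (p f).2 → col (p e).2 = col (p f).2 → e = f := by
    intro e f h1 h2 h3 h4
    apply Subtype.ext
    rw [hp e, hp f, ext_row_col h1 h2, ext_row_col h3 h4]
  refine ⟨fun u => ((col u : ℝ), (row u : ℝ)), fun e t =>
    ((col (p e).1 : ℝ) + t * ((col (p e).2 : ℝ) - col (p e).1),
      (row (p e).1 : ℝ) + t * ((row (p e).2 : ℝ) - row (p e).1)), ?_, ?_, ?_, ?_, ?_⟩
  · intro u v h
    simp only [Prod.mk.injEq, Nat.cast_inj] at h
    exact ext_row_col h.2 h.1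
  · intro e
    refine ⟨by fun_prop, fun s t h => ?_⟩
    simp only [Prod.mk.injEq] at h
    apply Subtype.ext
    rcases hs e with ⟨h1, h2⟩ | ⟨h1, h2⟩
    · rw [← h2] at h; push_cast at h; linarith [h.1]
    · rw [← h2] at h; push_cast at h; linarith [h.2]
  · intro e
    rw [hp e, Sym2.map_mk]
    simp
  · rintro e ⟨t, ht0, ht1⟩ ⟨h0, h1⟩ ⟨u, hu⟩
    have h0 : (0 : ℝ) < t := h0
    have h1 : t < (1 : ℝ) := h1
    simp only [Prod.mk.injEq] at hu
    rcases hs e with ⟨-, h2⟩ | ⟨-, h2⟩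
    · have := hu.1
      rw [← h2] at this; push_cast at this
      have a1 : (col (p e).1 : ℝ) < col u := by linarith
      have a2 : (col u : ℝ) < (col (p e).1 + 1 : ℕ) := by push_cast; linarith
      rw [Nat.cast_lt] at a1 a2; omega
    · have := hu.2
      rw [← h2] at this; push_cast at this
      have a1 : (row (p e).1 : ℝ) < row u := by linarith
      have a2 : (row u : ℝ) < (row (p e).1 + 1 : ℕ) := by push_cast; linarith
      rw [Nat.cast_lt] at a1 a2; omega
  · rintro e f hef ⟨t, ht0, ht1⟩ ⟨h0, h1⟩ ⟨⟨s, hs0, hs1⟩, hu⟩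
    have h0 : (0 : ℝ) < t := h0
    have h1 : t < (1 : ℝ) := h1
    simp only [Prod.mk.injEq] at hu
    obtain ⟨hx, hy⟩ := hu
    rcases hs e with ⟨e1, e2⟩ | ⟨e1, e2⟩ <;> rcases hs f with ⟨f1, f2⟩ | ⟨f1, f2⟩ <;>
      simp only [← e1, ← e2, ← f1, ← f2] at hx hy <;> push_cast at hx hy
    · have a1 : (col (p e).1 : ℝ) < (col (p f).1 + 1 : ℕ) := by push_cast; linarith
      have a2 : (col (p f).1 : ℝ) < (col (p e).1 + 1 : ℕ) := by push_cast; linarith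
      have a3 : (row (p f).1 : ℝ) = row (p e).1 := by linarith
      rw [Nat.cast_lt] at a1 a2; rw [Nat.cast_inj] at a3
      exact hef (key e f (by omega) (by omega) (by omega) (by omega))
    · have a1 : (col (p e).1 : ℝ) < col (p f).1 := by linarith
      have a2 : (col (p f).1 : ℝ) < (col (p e).1 + 1 : ℕ) := by push_cast; linarith
      rw [Nat.cast_lt] at a1 a2; omega
    · have a1 : (row (p e).1 : ℝ) < row (p f).1 := by linarith
      have a2 : (row (p f).1 : ℝ) < (row (p e).1 + 1 : ℕ) := by push_cast; linarith
      rw [Nat.cast_lt] at a1 a2; omega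
    · have a1 : (row (p e).1 : ℝ) < (row (p f).1 + 1 : ℕ) := by push_cast; linarith
      have a2 : (row (p f).1 : ℝ) < (row (p e).1 + 1 : ℕ) := by push_cast; linarith
      have a3 : (col (p f).1 : ℝ) = col (p e).1 := by linarith
      rw [Nat.cast_lt] at a1 a2; rw [Nat.cast_inj] at a3
      exact hef (key e f (by omega) (by omega) (by omega) (by omega))

end Grid

/-! ### Shortest paths in the weighted grid -/

namespace Grid

open PathCount SimpleGraph

/-- The vertex in row `y` and column `x`. -/
def mk {R W : ℕ} (y x : ℕ) (hy : y < R) (hx : x < W) : Fin (R * W) :=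
  ⟨y * W + x, by
    calc y * W + x < y * W + W := by omega
      _ = (y + 1) * W := by ring
      _ ≤ R * W := Nat.mul_le_mul_right _ hy⟩

@[simp] theorem row_mk {R W : ℕ} (y x : ℕ) (hy : y < R) (hx : x < W) :
    row (mk y x hy hx) = y := by
  change (y * W + x) / W = y
  rw [Nat.add_comm, Nat.add_mul_div_right _ _ (Nat.zero_lt_of_lt hx), Nat.div_eq_of_lt hx,
    Nat.zero_add]

@[simp] theorem col_mk {R W : ℕ} (y x : ℕ) (hy : y < R) (hx : x < W) :
    col (mk y x hy hx) = x := by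
  change (y * W + x) % W = x
  rw [Nat.mul_comm, Nat.mul_add_mod, Nat.mod_eq_of_lt hx]

variable {a : ℕ}

/-- The distance of a row of the grid with `2 * a` rows from the boundary. -/
def depth (a y : ℕ) : ℕ := min y (2 * a - 1 - y)

/-- The weights of the grid with `2 * a` rows and `a` columns: horizontal edges are more expensive
towards the middle row, vertical edges are more expensive than any horizontal way, and the small
numbers `c y x` are added to the vertical edges. -/
structure HasWeights (w : Sym2 (Fin (2 * a * a)) → ℕ) (c : ℕ → ℕ → ℕ) : Prop where
  hor : ∀ u v, row u = row v → col u + 1 = col v → w s(u, v) = 4 * a * (depth a (row u) + 1)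
  ver : ∀ u v, col u = col v → row u + 1 = row v → w s(u, v) = 8 * a ^ 3 + c (row u) (col u)
  le_two : ∀ y x, c y x ≤ 2

/-- Horizontal distance. -/
def hdist (u b : Fin (2 * a * a)) : ℕ := (col u - col b) + (col b - col u)

/-- Vertical distance. -/
def vdist (u b : Fin (2 * a * a)) : ℕ := (row u - row b) + (row b - row u)

/-- The main part of the weight of an edge, in units of `4 * a`. -/
def baseWeight (u v : Fin (2 * a * a)) : ℕ :=
  if row u = row v then depth a (row u) + 1 else 2 * a ^ 2

/-- The distance with respect to `baseWeight`. -/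
def baseDist (u b : Fin (2 * a * a)) : ℕ :=
  2 * a ^ 2 * vdist u b + hdist u b * min (depth a (row u) + 1) (depth a (row b) + 1)

/-- The length of a walk with respect to `baseWeight`. -/
def baseLength {u b : Fin (2 * a * a)} : (graph (2 * a) a).Walk u b → ℕ
  | .nil => 0
  | .cons (u := u) (v := v) _ p => baseWeight u v + baseLength p

/-- This is why vertical edges have base weight `2 * a ^ 2`: a detour by one vertical edge can never
be repaid by cheaper horizontal edges. -/
theorem hdist_mul_le (u b : Fin (2 * a * a)) (k : ℕ) :
    hdist u b * min (depth a (row u) + 1) k < 2 * a ^ 2 := by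
  have h1 := col_lt u
  have h2 := col_lt b
  have h3 := row_lt u
  have h4 : hdist u b < a := by unfold hdist; omega
  have h5 : min (depth a (row u) + 1) k ≤ a := by unfold depth; omega
  nlinarith [Nat.mul_le_mul h4.le h5]

theorem baseDist_self (b : Fin (2 * a * a)) : baseDist b b = 0 := by
  simp [baseDist, vdist, hdist]

theorem baseWeight_pos (u v : Fin (2 * a * a)) : 0 < baseWeight u v := by
  have := col_lt u
  unfold baseWeight
  have : 0 < a := by omega
  split <;> positivity

/-- `baseDist` serves as a potential: no edge lowers it by more than its base weight. The tight
edges are the only ones on shortest walks, so the second half restricts their shape: in a row deeper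
than that of `b` it is cheaper to postpone horizontal moves. -/
theorem baseDist_le_of_hor {u v b : Fin (2 * a * a)} (hr : row u = row v)
    (hc : col u + 1 = col v ∨ col v + 1 = col u) :
    baseDist u b ≤ baseWeight u v + baseDist v b ∧
    (baseDist u b = baseWeight u v + baseDist v b →
      hdist v b + 1 = hdist u b ∧ depth a (row u) ≤ depth a (row b)) := by
  have hv : vdist u b = vdist v b := by unfold vdist; rw [hr]
  unfold baseDist baseWeight
  rw [if_pos hr, hv, ← hr]
  generalize hk : min (depth a (row u) + 1) (depth a (row b) + 1) = k
  have hk0 : k ≤ depth a (row u) + 1 := by omega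
  have : hdist u b = hdist v b + 1 ∨ hdist v b = hdist u b + 1 := by unfold hdist; omega
  rcases this with h | h <;> rw [h, Nat.add_mul, Nat.one_mul]
  · exact ⟨by omega, fun h => ⟨rfl, by omega⟩⟩
  · exact ⟨by omega, fun h => by omega⟩

/-- A tight vertical edge leads towards `b`. Every row strictly between those of `u` and `b` is
deeper than the shallower of the two, so leaving the row of `u` with horizontal distance still to go
is optimal only if the row of `b` is the cheap one, that is, if `v` is in that row or deeper than
it. -/
theorem baseDist_le_of_ver {u v b : Fin (2 * a * a)} (hc : col u = col v)
    (hr : row u + 1 = row v ∨ row v + 1 = row u) :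
    baseDist u b ≤ baseWeight u v + baseDist v b ∧
    (baseDist u b = baseWeight u v + baseDist v b →
      vdist v b + 1 = vdist u b ∧
      (col u = col b ∨ row v = row b ∨ depth a (row b) < depth a (row v))) := by
  have hh : hdist u b = hdist v b := by unfold hdist; rw [hc]
  have hu := hdist_mul_le u b (depth a (row b) + 1)
  have ru := row_lt u
  have rv := row_lt v
  have rb := row_lt b
  unfold baseDist baseWeight
  rw [if_neg (by omega)]
  have : vdist u b = vdist v b + 1 ∨ vdist v b = vdist u b + 1 := by unfold vdist; omega
  rcases this with h | h <;> rw [h, Nat.mul_add, Nat.mul_one]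
  · have hm : min (depth a (row u) + 1) (depth a (row b) + 1) ≤
        min (depth a (row v) + 1) (depth a (row b) + 1) := by
      unfold vdist at h; unfold depth; omega
    have hm' := Nat.mul_le_mul_left (hdist u b) hm
    rw [← hh]
    refine ⟨by omega, fun h' => ⟨rfl, ?_⟩⟩
    have h0 : hdist u b * min (depth a (row u) + 1) (depth a (row b) + 1) =
        hdist u b * min (depth a (row v) + 1) (depth a (row b) + 1) := by omega
    rcases Nat.eq_zero_or_pos (hdist u b) with h1 | h1
    · left; unfold hdist at h1; omega
    · have := Nat.eq_of_mul_eq_mul_left h1 h0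
      unfold depth at this ⊢; unfold vdist at h; omega
  · exact ⟨by omega, fun h => by omega⟩

theorem baseDist_le {u v b : Fin (2 * a * a)} (h : (graph (2 * a) a).Adj u v) :
    baseDist u b ≤ baseWeight u v + baseDist v b := by
  rcases adj_iff.1 h with ⟨h1, h2⟩ | ⟨h1, h2⟩
  · exact (baseDist_le_of_hor h1 h2).1
  · exact (baseDist_le_of_ver h1 h2).1

theorem baseDist_le_baseLength {u b : Fin (2 * a * a)} (p : (graph (2 * a) a).Walk u b) :
    baseDist u b ≤ baseLength p := by
  induction p with
  | nil => simp [baseDist_self]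
  | cons h p ih => exact (baseDist_le h).trans (Nat.add_le_add_left ih _)

@[simp] theorem length_cons (w : Sym2 (Fin (2 * a * a)) → ℕ) {u v b : Fin (2 * a * a)}
    (h : (graph (2 * a) a).Adj u v) (p : (graph (2 * a) a).Walk v b) :
    PathCount.length w (.cons h p) = w s(u, v) + PathCount.length w p := by
  simp [PathCount.length]

theorem HasWeights.of_hor {w : Sym2 (Fin (2 * a * a)) → ℕ} {c : ℕ → ℕ → ℕ} (hw : HasWeights w c)
    {u v : Fin (2 * a * a)} (hr : row u = row v) (hc : col u + 1 = col v ∨ col v + 1 = col u) :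
    w s(u, v) = 4 * a * baseWeight u v := by
  unfold baseWeight
  rw [if_pos hr]
  rcases hc with h | h
  · exact hw.hor u v hr h
  · rw [Sym2.eq_swap, hr]; exact hw.hor v u hr.symm h

theorem HasWeights.of_ver {w : Sym2 (Fin (2 * a * a)) → ℕ} {c : ℕ → ℕ → ℕ} (hw : HasWeights w c)
    {u v : Fin (2 * a * a)} (hc : col u = col v) (hr : row u + 1 = row v ∨ row v + 1 = row u) :
    4 * a * baseWeight u v ≤ w s(u, v) ∧ w s(u, v) ≤ 4 * a * baseWeight u v + 2 := by
  unfold baseWeight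
  rw [if_neg (by omega)]
  have e : 4 * a * (2 * a ^ 2) = 8 * a ^ 3 := by ring
  rw [e]
  rcases hr with h | h
  · rw [hw.ver u v hc h]; have := hw.le_two (row u) (col u); omega
  · rw [Sym2.eq_swap, hw.ver v u hc.symm h]; have := hw.le_two (row v) (col v); omega

theorem HasWeights.le_length {w : Sym2 (Fin (2 * a * a)) → ℕ} {c : ℕ → ℕ → ℕ}
    (hw : HasWeights w c) {u b : Fin (2 * a * a)} (p : (graph (2 * a) a).Walk u b) :
    4 * a * baseLength p ≤ PathCount.length w p := by
  induction p with
  | nil => simp [baseLength]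
  | cons h p ih =>
    rw [length_cons, baseLength, Nat.mul_add]
    refine Nat.add_le_add ?_ ih
    rcases adj_iff.1 h with ⟨h1, h2⟩ | ⟨h1, h2⟩
    · exact (hw.of_hor h1 h2).ge
    · exact (hw.of_ver h1 h2).1

/-- A neighbour of `u` closer to `b`, in the row of `u`. -/
theorem exists_hor_closer {u b : Fin (2 * a * a)} (h : col u ≠ col b) :
    ∃ v, (graph (2 * a) a).Adj u v ∧ row u = row v ∧ hdist v b + 1 = hdist u b := by
  have h1 := row_lt u
  have h2 := col_lt u
  have h3 := col_lt b
  rcases Nat.lt_or_gt_of_ne h with h | h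
  · refine ⟨mk (row u) (col u + 1) h1 (by omega), ?_, ?_, ?_⟩ <;> simp [adj_iff, hdist]
    omega
  · refine ⟨mk (row u) (col u - 1) h1 (by omega), ?_, ?_, ?_⟩ <;> simp [adj_iff, hdist] <;> omega

/-- A neighbour of `u` closer to `b`, in the column of `u`. -/
theorem exists_ver_closer {u b : Fin (2 * a * a)} (h : row u ≠ row b) :
    ∃ v, (graph (2 * a) a).Adj u v ∧ col u = col v ∧ vdist v b + 1 = vdist u b := by
  have h1 := row_lt u
  have h2 := col_lt u
  have h3 := row_lt b
  rcases Nat.lt_or_gt_of_ne h with h | h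
  · refine ⟨mk (row u + 1) (col u) (by omega) h2, ?_, ?_, ?_⟩ <;> simp [adj_iff, vdist]
    omega
  · refine ⟨mk (row u - 1) (col u) (by omega) h2, ?_, ?_, ?_⟩ <;> simp [adj_iff, vdist] <;> omega

/-- The greedy walk moves horizontally while the current row is no deeper than the target row, and
vertically otherwise. Only its vertical edges exceed the base weight, each by at most 2. -/
theorem exists_short_walk {w : Sym2 (Fin (2 * a * a)) → ℕ} {c : ℕ → ℕ → ℕ}
    (hw : HasWeights w c) (b : Fin (2 * a * a)) : ∀ (k : ℕ) (u : Fin (2 * a * a)),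
    hdist u b + vdist u b = k → ∃ p : (graph (2 * a) a).Walk u b,
      PathCount.length w p ≤ 4 * a * baseDist u b + 2 * vdist u b ∧ baseLength p = baseDist u b := by
  intro k
  induction k with
  | zero =>
    intro u h
    have : u = b := by
      unfold hdist vdist at h
      exact ext_row_col (by omega) (by omega)
    subst this
    exact ⟨.nil, by simp [PathCount.length], by simp [baseLength, baseDist_self]⟩
  | succ k ih =>
    intro u h
    by_cases hu : col u ≠ col b ∧ depth a (row u) ≤ depth a (row b)
    · obtain ⟨v, hv, hr, hd⟩ := exists_hor_closer hu.1
      have hvd : vdist u b = vdist v b := by unfold vdist; rw [hr]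
      obtain ⟨p, hp, hp'⟩ := ih v (by omega)
      have key : baseDist u b = baseWeight u v + baseDist v b := by
        unfold baseDist baseWeight
        rw [if_pos hr, ← hvd, ← hd, ← hr, Nat.min_eq_left (by omega)]
        ring
      refine ⟨.cons hv p, ?_, by rw [baseLength, hp', key]⟩
      have hc : col u + 1 = col v ∨ col v + 1 = col u := by
        rcases adj_iff.1 hv with h' | h'
        · exact h'.2
        · omega
      rw [length_cons, hw.of_hor hr hc, key, Nat.mul_add]
      omega
    · have ru := row_lt u
      have rb := row_lt b
      have hne : row u ≠ row b := by
        intro h'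
        rw [h'] at hu
        simp only [le_refl, and_true, not_not] at hu
        unfold hdist vdist at h
        omega
      obtain ⟨v, hv, hc, hd⟩ := exists_ver_closer hne
      have rv := row_lt v
      have hhd : hdist u b = hdist v b := by unfold hdist; rw [hc]
      obtain ⟨p, hp, hp'⟩ := ih v (by omega)
      have hr : row u + 1 = row v ∨ row v + 1 = row u := by
        rcases adj_iff.1 hv with h' | h'
        · omega
        · exact h'.2
      have key : baseDist u b = baseWeight u v + baseDist v b := by
        unfold baseDist baseWeight
        rw [if_neg (by omega), ← hhd, ← hd]
        by_cases h0 : col u = col b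
        · have : hdist u b = 0 := by unfold hdist; omega
          rw [this]; ring
        · have : min (depth a (row u) + 1) (depth a (row b) + 1) =
              min (depth a (row v) + 1) (depth a (row b) + 1) := by
            unfold depth at hu ⊢; unfold vdist at hd; omega
          rw [this]; ring
      refine ⟨.cons hv p, ?_, by rw [baseLength, hp', key]⟩
      have := (hw.of_ver hc hr).2
      rw [length_cons, key, Nat.mul_add]
      omega

/-- The walk first goes to column `j`, then to the row of `b`, and then to `b`; this is what the
step from `u` to `v` has to satisfy. -/
def Step (j : ℕ) (b u v : Fin (2 * a * a)) : Prop :=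
  if row u = row b ∨ col u ≠ j then row u = row v ∧ hdist v b + 1 = hdist u b
  else col u = col v ∧ vdist v b + 1 = vdist u b

/-- Every step of the walk satisfies `Step`. -/
def Follows (j : ℕ) {u b : Fin (2 * a * a)} : (graph (2 * a) a).Walk u b → Prop
  | .nil => True
  | .cons (u := u) (v := v) _ p => Step j b u v ∧ Follows j p

/-- `Step j` determines the next vertex, and it allows no step out of `b`; so for each turning
column there is at most one walk. -/
theorem Follows.eq {j : ℕ} {u b : Fin (2 * a * a)} {p q : (graph (2 * a) a).Walk u b}
    (hp : Follows j p) (hq : Follows j q) : p = q := by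
  have hno : ∀ {b v : Fin (2 * a * a)}, ¬ Step j b b v := by
    intro b v h
    simp [Step, hdist] at h
  induction p with
  | nil =>
    cases q with
    | nil => rfl
    | cons h q => exact absurd hq.1 hno
  | cons h p ih =>
    rename_i u v b
    cases q with
    | nil => exact absurd hp.1 hno
    | cons h' q =>
      rename_i v'
      have : v = v' := by
        have h1 := hp.1
        have h2 := hq.1
        have h3 := adj_iff.1 h
        have h4 := adj_iff.1 h'
        unfold Step hdist vdist at h1 h2
        apply ext_row_col <;> split_ifs at h1 h2 <;> omega
      subst this
      rw [ih hp.2 hq.2]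

/-- Each step lowers the Manhattan distance to `b` by one; therefore such walks never return to a
vertex. -/
theorem Follows.dist_le {j : ℕ} {u b : Fin (2 * a * a)} {p : (graph (2 * a) a).Walk u b}
    (hp : Follows j p) : ∀ z ∈ p.support, hdist z b + vdist z b ≤ hdist u b + vdist u b := by
  induction p with
  | nil => simp
  | cons h p ih =>
    intro z hz
    rw [Walk.support_cons, List.mem_cons] at hz
    rcases hz with rfl | hz
    · exact le_rfl
    · refine (ih hp.2 z hz).trans ?_
      have h1 := hp.1
      unfold Step hdist vdist at h1
      unfold hdist vdist
      split_ifs at h1 <;> omega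

theorem Follows.isPath {j : ℕ} {u b : Fin (2 * a * a)} {p : (graph (2 * a) a).Walk u b}
    (hp : Follows j p) : p.IsPath := by
  induction p with
  | nil => exact Walk.IsPath.nil
  | cons h p ih =>
    rw [Walk.cons_isPath_iff]
    refine ⟨ih hp.2, fun hz => ?_⟩
    have h2 := hp.2.dist_le _ hz
    have h1 := hp.1
    unfold Step hdist vdist at h1
    unfold hdist vdist at h2
    split_ifs at h1 <;> omega

/-- Equality in the sum of the edge inequalities forces equality in each of them. -/
theorem baseLength_tight {u v b : Fin (2 * a * a)} {h : (graph (2 * a) a).Adj u v}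
    {p : (graph (2 * a) a).Walk v b} (hp : baseLength (.cons h p) = baseDist u b) :
    baseDist u b = baseWeight u v + baseDist v b ∧ baseLength p = baseDist v b := by
  have h1 := baseDist_le (b := b) h
  have h2 := baseDist_le_baseLength p
  rw [baseLength] at hp
  omega

/-- A tight walk never leaves the row of `b`, and in rows deeper than it no horizontal edge is
tight, so there the walk falls straight down its column. -/
theorem follows_of_deep {u b : Fin (2 * a * a)} (p : (graph (2 * a) a).Walk u b)
    (hp : baseLength p = baseDist u b) :
    (row u = row b → ∀ j, Follows j p) ∧
    (depth a (row b) < depth a (row u) → Follows (col u) p) := by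
  induction p with
  | nil => exact ⟨fun _ _ => trivial, fun _ => trivial⟩
  | cons h p ih =>
    rename_i u v b
    obtain ⟨h1, h2⟩ := baseLength_tight hp
    rcases adj_iff.1 h with ⟨h3, h4⟩ | ⟨h3, h4⟩
    · have h5 := (baseDist_le_of_hor h3 h4).2 h1
      refine ⟨fun h6 j => ⟨?_, (ih h2).1 (by omega) j⟩, fun h6 => by omega⟩
      unfold Step
      rw [if_pos (Or.inl h6)]
      exact ⟨h3, h5.1⟩
    · have h5 := (baseDist_le_of_ver h3 h4).2 h1
      refine ⟨fun h6 => ?_, fun h6 => ?_⟩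
      · unfold vdist at h5; omega
      · have h7 : row u ≠ row b := fun h => by rw [h] at h6; omega
        refine ⟨?_, ?_⟩
        · unfold Step
          rw [if_neg (by simpa using h7)]
          exact ⟨h3, h5.1⟩
        · rcases h5.2 with h8 | h8 | h8
          · by_cases h9 : row v = row b
            · exact (ih h2).1 h9 _
            · rw [h3]
              refine (ih h2).2 ?_
              have := row_lt u
              have := row_lt v
              have := row_lt b
              unfold depth at h6 ⊢; unfold vdist at h5; omega
          · exact (ih h2).1 h8 _
          · rw [h3]; exact (ih h2).2 h8

/-- The turning column is the column of the first vertical step. After that step the walk is in the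
column of `b`, in its row, or in a deeper row, so it cannot turn sideways before the row of `b`. -/
theorem exists_follows {u b : Fin (2 * a * a)} (p : (graph (2 * a) a).Walk u b)
    (hp : baseLength p = baseDist u b) :
    ∃ j, min (col u) (col b) ≤ j ∧ j ≤ max (col u) (col b) ∧ Follows j p := by
  induction p with
  | nil => exact ⟨_, min_le_left _ _, le_max_left _ _, trivial⟩
  | cons h p ih =>
    rename_i u v b
    obtain ⟨h1, h2⟩ := baseLength_tight hp
    rcases adj_iff.1 h with ⟨h3, h4⟩ | ⟨h3, h4⟩
    · have h5 := (baseDist_le_of_hor h3 h4).2 h1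
      obtain ⟨j, hj, hj', hf⟩ := ih h2
      unfold hdist at h5
      refine ⟨j, by omega, by omega, ?_, hf⟩
      unfold Step
      -- The bounds on `j` exclude `col u`: the step leads towards `b`, so `j` lies between the
      -- columns of `v` and `b`.
      rw [if_pos (by omega)]
      unfold hdist
      omega
    · have h5 := (baseDist_le_of_ver h3 h4).2 h1
      have h7 : row u ≠ row b := by unfold vdist at h5; omega
      refine ⟨col u, by omega, by omega, ?_, ?_⟩
      · unfold Step
        rw [if_neg (by simpa using h7)]
        exact ⟨h3, h5.1⟩
      · rcases h5.2 with h8 | h8 | h8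
        · obtain ⟨j, hj, hj', hf⟩ := ih h2
          have : j = col u := by omega
          rwa [← this]
        · exact (follows_of_deep p h2).1 h8 _
        · rw [h3]; exact (follows_of_deep p h2).2 h8

/-- The set of shortest paths. -/
def shortest (w : Sym2 (Fin (2 * a * a)) → ℕ) (u b : Fin (2 * a * a)) :
    Set ((graph (2 * a) a).Walk u b) :=
  {p | p.IsPath ∧ ∀ q : (graph (2 * a) a).Walk u b, q.IsPath →
    PathCount.length w p ≤ PathCount.length w q}

/-- The small numbers on a monotone path add up to at most twice its vertical distance, hence to
less than the unit `4 * a` of the base weights. So a shortest path is shortest for the base weights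
too. -/
theorem follows_of_shortest {w : Sym2 (Fin (2 * a * a)) → ℕ} {c : ℕ → ℕ → ℕ}
    (hw : HasWeights w c) {u b : Fin (2 * a * a)} {p : (graph (2 * a) a).Walk u b}
    (hp : p ∈ shortest w u b) : ∃ j < a, Follows j p := by
  obtain ⟨q, hq, hq'⟩ := exists_short_walk hw b _ u rfl
  obtain ⟨j, -, -, hj⟩ := exists_follows q hq'
  have h1 := (hp.2 q hj.isPath).trans hq
  have h2 := hw.le_length p
  have h3 := baseDist_le_baseLength p
  have h4 : 2 * vdist u b < 4 * a := by
    have := row_lt u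
    have := row_lt b
    unfold vdist; omega
  have h5 : baseLength p = baseDist u b := by
    refine le_antisymm (Nat.lt_succ_iff.1 ?_) h3
    refine Nat.lt_of_mul_lt_mul_left (a := 4 * a) ?_
    rw [Nat.mul_succ]
    omega
  obtain ⟨j, hj1, hj2, hj3⟩ := exists_follows p h5
  have := col_lt u
  have := col_lt b
  exact ⟨j, by omega, hj3⟩

/-- A shortest path is determined by its turning column, and there are `a` columns. -/
theorem count_le {w : Sym2 (Fin (2 * a * a)) → ℕ} {c : ℕ → ℕ → ℕ}
    (hw : HasWeights w c) (u b : Fin (2 * a * a)) : count (graph (2 * a) a) w u b ≤ a := by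
  have h : ∀ p : (graph (2 * a) a).Walk u b, ∃ j, p ∈ shortest w u b → j < a ∧ Follows j p := by
    intro p
    by_cases hp : p ∈ shortest w u b
    · obtain ⟨j, h1, h2⟩ := follows_of_shortest hw hp
      exact ⟨j, fun _ => ⟨h1, h2⟩⟩
    · exact ⟨0, fun h => absurd h hp⟩
  choose f hf using h
  have := Set.ncard_le_ncard_of_injOn (s := shortest w u b) (t := (Finset.range a : Set ℕ)) f
    (fun p hp => by simpa using (hf p hp).1)
    (fun p hp q hq hpq => by
      have h1 := (hf p hp).2
      rw [hpq] at h1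
      exact h1.eq (hf q hq).2) (Finset.finite_toSet _)
  rw [Set.ncard_coe_finset, Finset.card_range] at this
  exact this

end Grid

/-! ### Counting shortest paths between mirror vertices -/

namespace Grid

open PathCount SimpleGraph

variable {a : ℕ}

theorem exists_shortest {w : Sym2 (Fin (2 * a * a)) → ℕ} {c : ℕ → ℕ → ℕ}
    (hw : HasWeights w c) (u b : Fin (2 * a * a)) : (shortest w u b).Nonempty := by
  obtain ⟨q, hq, hq'⟩ := exists_short_walk hw b _ u rfl
  obtain ⟨j, -, -, hj⟩ := exists_follows q hq'
  have hne : {p : (graph (2 * a) a).Walk u b | p.IsPath}.Nonempty := ⟨q, hj.isPath⟩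
  refine ⟨Function.argminOn (PathCount.length w) _ hne, Function.argminOn_mem _ _ hne, ?_⟩
  intro q hq
  exact Function.argminOn_le _ _ hq

/-- This lemma and the next two build the Z-shaped path with turning column `j` backwards, from its
last row to its first, together with its exact length. -/
theorem exists_last_row {w : Sym2 (Fin (2 * a * a)) → ℕ} {c : ℕ → ℕ → ℕ} (hw : HasWeights w c)
    {b : Fin (2 * a * a)} (hb : col b + 1 = a) (k : ℕ) : ∀ u, row u = row b → col u + k = col b →
    ∃ p : (graph (2 * a) a).Walk u b, (∀ j, Follows j p) ∧
      PathCount.length w p = k * (4 * a * (depth a (row b) + 1)) := by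
  induction k with
  | zero =>
    intro u hr hc
    have : u = b := ext_row_col hr hc
    subst this
    exact ⟨.nil, fun _ => trivial, by simp [PathCount.length]⟩
  | succ k ih =>
    intro u hr hc
    let v : Fin (2 * a * a) := mk (row u) (col u + 1) (row_lt u) (by omega)
    have hv : row u = row v := (row_mk _ _ _ _).symm
    have hv' : col u + 1 = col v := (col_mk _ _ _ _).symm
    obtain ⟨p, hp, hl⟩ := ih v (hv ▸ hr) (by omega)
    refine ⟨.cons (adj_iff.2 (Or.inl ⟨hv, Or.inl hv'⟩)) p, fun j => ⟨?_, hp j⟩, ?_⟩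
    · unfold Step
      rw [if_pos (Or.inl hr)]
      unfold hdist
      omega
    · rw [length_cons, hw.hor u v hv hv', hl, hr]; ring

theorem exists_column {w : Sym2 (Fin (2 * a * a)) → ℕ} {c : ℕ → ℕ → ℕ} (hw : HasWeights w c)
    {b : Fin (2 * a * a)} (hb : col b + 1 = a) (k : ℕ) : ∀ u, row u + k = row b →
    ∃ p : (graph (2 * a) a).Walk u b, Follows (col u) p ∧
      PathCount.length w p = (∑ y ∈ Finset.Ico (row u) (row b), (8 * a ^ 3 + c y (col u))) +
        (col b - col u) * (4 * a * (depth a (row b) + 1)) := by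
  induction k with
  | zero =>
    intro u hr
    have := col_lt u
    obtain ⟨p, hp, hl⟩ := exists_last_row hw hb (col b - col u) u hr (by omega)
    have hr : row u = row b := hr
    exact ⟨p, hp _, by rw [hl, hr]; simp⟩
  | succ k ih =>
    intro u hr
    have hb' := row_lt b
    let v : Fin (2 * a * a) := mk (row u + 1) (col u) (by omega) (col_lt u)
    have hv : row u + 1 = row v := (row_mk _ _ _ _).symm
    have hv' : col u = col v := (col_mk _ _ _ _).symm
    obtain ⟨p, hp, hl⟩ := ih v (by omega)
    refine ⟨.cons (adj_iff.2 (Or.inr ⟨hv', Or.inl hv⟩)) p, ⟨?_, hv' ▸ hp⟩, ?_⟩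
    · unfold Step
      rw [if_neg (by omega)]
      unfold vdist
      omega
    · rw [length_cons, hw.ver u v hv' hv, hl, ← hv', ← hv,
        Finset.sum_eq_sum_Ico_succ_bot (by omega : row u < row b)]
      ring

theorem exists_first_row {w : Sym2 (Fin (2 * a * a)) → ℕ} {c : ℕ → ℕ → ℕ} (hw : HasWeights w c)
    {b : Fin (2 * a * a)} (hb : col b + 1 = a) {j : ℕ} (hj : j < a) (k : ℕ) :
    ∀ u, row u < row b → col u + k = j →
    ∃ p : (graph (2 * a) a).Walk u b, Follows j p ∧
      PathCount.length w p = k * (4 * a * (depth a (row u) + 1)) +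
        ((∑ y ∈ Finset.Ico (row u) (row b), (8 * a ^ 3 + c y j)) +
        (col b - j) * (4 * a * (depth a (row b) + 1))) := by
  induction k with
  | zero =>
    intro u hr hc
    obtain ⟨p, hp, hl⟩ := exists_column hw hb (row b - row u) u (by omega)
    have hc : col u = j := hc
    subst hc
    exact ⟨p, hp, by rw [hl]; ring⟩
  | succ k ih =>
    intro u hr hc
    let v : Fin (2 * a * a) := mk (row u) (col u + 1) (row_lt u) (by omega)
    have hv : row u = row v := (row_mk _ _ _ _).symm
    have hv' : col u + 1 = col v := (col_mk _ _ _ _).symm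
    obtain ⟨p, hp, hl⟩ := ih v (by omega) (by omega)
    refine ⟨.cons (adj_iff.2 (Or.inl ⟨hv, Or.inl hv'⟩)) p, ⟨?_, hp⟩, ?_⟩
    · unfold Step
      rw [if_pos (by omega)]
      unfold hdist
      omega
    · rw [length_cons, hw.hor u v hv hv', hl, ← hv]; ring

/-- Different turning columns between `u` and `b` give different paths: in column `j` one walk must
descend while the other must continue horizontally. -/
theorem Follows.not_lt {j j' : ℕ} {u b : Fin (2 * a * a)} {p : (graph (2 * a) a).Walk u b}
    (hp : Follows j p) (hp' : Follows j' p) (hr : row u ≠ row b) (hu : col u ≤ j) (hj : j < j')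
    (hb : j' ≤ col b) : False := by
  induction p with
  | nil => exact hr rfl
  | cons h p ih =>
    rename_i u v b
    have h1 := hp.1
    have h2 := hp'.1
    have h3 := adj_iff.1 h
    unfold Step at h1 h2
    rw [if_pos (by omega)] at h2
    unfold hdist at h2
    by_cases hc : col u = j
    · rw [if_neg (by omega)] at h1
      unfold vdist at h1
      omega
    · exact ih hp.2 hp'.2 (by omega) (by omega) hb

/-- Between mirror vertices on the left and right boundary of the grid, the shortest paths
correspond to the columns of minimal additional weight. -/
theorem count_mirror {w : Sym2 (Fin (2 * a * a)) → ℕ} {c : ℕ → ℕ → ℕ}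
    (hw : HasWeights w c) {u b : Fin (2 * a * a)} (hu : col u = 0) (hua : row u < a)
    (hb : col b + 1 = a) (hr : row b + row u + 1 = 2 * a) :
    count (graph (2 * a) a) w u b = ((Finset.range a).filter fun j => ∀ j' < a,
      ∑ y ∈ Finset.Ico (row u) (row b), c y j ≤ ∑ y ∈ Finset.Ico (row u) (row b), c y j').card := by
  -- Mirror rows are equally deep, so the `a - 1` horizontal edges of the path cost the same amount
  -- for every turning column.
  have hd : depth a (row b) = depth a (row u) := by unfold depth; omega
  have hZ : ∀ j, ∃ p : (graph (2 * a) a).Walk u b, j < a → Follows j p ∧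
      PathCount.length w p = (a - 1) * (4 * a * (depth a (row u) + 1)) +
        (row b - row u) * (8 * a ^ 3) + ∑ y ∈ Finset.Ico (row u) (row b), c y j := by
    intro j
    by_cases hj : j < a
    · obtain ⟨p, hp, hl⟩ := exists_first_row hw hb hj j u (by omega) (by omega)
      refine ⟨p, fun _ => ⟨hp, ?_⟩⟩
      have : a - 1 = j + (col b - j) := by omega
      rw [hl, hd, this, Finset.sum_add_distrib, Finset.sum_const, Nat.card_Ico, smul_eq_mul]
      ring
    · obtain ⟨q, -, -⟩ := exists_short_walk hw b _ u rfl
      exact ⟨q, fun h => absurd h hj⟩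
  choose Z hZ using hZ
  have himg : shortest w u b = Z '' (((Finset.range a).filter fun j => ∀ j' < a,
      ∑ y ∈ Finset.Ico (row u) (row b), c y j ≤
        ∑ y ∈ Finset.Ico (row u) (row b), c y j' : Finset ℕ) : Set ℕ) := by
    ext p
    constructor
    · intro hp
      obtain ⟨j, hj, hf⟩ := follows_of_shortest hw hp
      have e : Z j = p := (hZ j hj).1.eq hf
      refine ⟨j, ?_, e⟩
      simp only [Finset.coe_filter, Finset.mem_range, Set.mem_ofPred_eq]
      refine ⟨hj, fun j' hj' => ?_⟩
      have := hp.2 _ (hZ j' hj').1.isPath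
      rw [← e, (hZ j hj).2, (hZ j' hj').2] at this
      omega
    · rintro ⟨j, hj, rfl⟩
      simp only [Finset.coe_filter, Finset.mem_range, Set.mem_ofPred_eq] at hj
      refine ⟨(hZ j hj.1).1.isPath, fun q hq => ?_⟩
      -- An arbitrary competitor `q` need not be analysed: some shortest path exists, it is one of
      -- the paths `Z j'`, and these can be compared.
      obtain ⟨q', hq'⟩ := exists_shortest hw u b
      obtain ⟨j', hj', hf⟩ := follows_of_shortest hw hq'
      have e : Z j' = q' := (hZ j' hj').1.eq hf
      refine le_trans ?_ (hq'.2 q hq)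
      rw [← e, (hZ j hj.1).2, (hZ j' hj').2]
      have := hj.2 j' hj'
      omega
  change (shortest w u b).ncard = _
  rw [himg, Set.InjOn.ncard_image, Set.ncard_coe_finset]
  intro j hj j' hj' e
  simp only [Finset.coe_filter, Finset.mem_range, Set.mem_ofPred_eq] at hj hj'
  have h1 := (hZ j hj.1).1
  have h2 := (hZ j' hj'.1).1
  have e : Z j = Z j' := e
  rw [← e] at h2
  rcases Nat.lt_trichotomy j j' with h | h | h
  · exact (h1.not_lt h2 (by omega) (by omega) h (by omega)).elim
  · exact h
  · exact (h2.not_lt h1 (by omega) (by omega) h (by omega)).elim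

end Grid

/-! ### Encoding a matrix and a vector in the weights -/

namespace Grid

open PathCount SimpleGraph

theorem HasWeights.congr {a : ℕ} {w : Sym2 (Fin (2 * a * a)) → ℕ} {c c' : ℕ → ℕ → ℕ}
    (hw : HasWeights w c) (hc : ∀ y, ∀ x < a, c y x = c' y x) (hc' : ∀ y x, c' y x ≤ 2) :
    HasWeights w c' :=
  ⟨hw.hor, fun u v h h' => by rw [hw.ver u v h h', hc _ _ (col_lt u)], hc'⟩

theorem HasWeights.update {a : ℕ} {w : Sym2 (Fin (2 * a * a)) → ℕ} {c : ℕ → ℕ → ℕ}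
    (hw : HasWeights w c) {u v : Fin (2 * a * a)} (hc : col u = col v) (hr : row u + 1 = row v)
    {z : ℕ} (hz : z ≤ 2) :
    HasWeights (Function.update w s(u, v) (8 * a ^ 3 + z))
      (fun y x => if y = row u ∧ x = col u then z else c y x) := by
  refine ⟨fun u' v' h h' => ?_, fun u' v' h h' => ?_, fun y x => ?_⟩
  · rw [Function.update_of_ne, hw.hor u' v' h h']
    rw [Ne, Sym2.eq_iff]
    rintro (⟨rfl, rfl⟩ | ⟨rfl, rfl⟩) <;> omega
  · split_ifs with h1
    · have e1 : u' = u := ext_row_col h1.1 h1.2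
      subst e1
      have e2 : v' = v := ext_row_col (by omega) (by omega)
      subst e2
      rw [Function.update_self]
    · rw [Function.update_of_ne, hw.ver u' v' h h']
      rw [Ne, Sym2.eq_iff]
      rintro (⟨rfl, rfl⟩ | ⟨rfl, rfl⟩)
      · exact h1 ⟨rfl, rfl⟩
      · omega
  · split_ifs
    · exact hz
    · exact hw.le_two y x

/-- The constant 4 of the theorem comes from here. Weights are of order `a ^ 3` and counts at most
`a`, with `2 * a * a` vertices; at `a = 1` the bound `8 * a ^ 3 + 2 = 10` already exceeds the third
power of 2. -/
theorem HasWeights.bounded {a : ℕ} {w : Sym2 (Fin (2 * a * a)) → ℕ} {c : ℕ → ℕ → ℕ}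
    (hw : HasWeights w c) : Bounded ((2 * a * a) ^ 4) (graph (2 * a) a) w := by
  constructor
  · intro e he
    induction e using Sym2.ind with
    | _ u v =>
      rw [SimpleGraph.mem_edgeSet] at he
      have ha : 1 ≤ a := by have := col_lt u; omega
      have hd : depth a (row u) + 1 ≤ a := by have := row_lt u; unfold depth; omega
      have hp := baseWeight_pos u v
      have h2 : 4 * a * baseWeight u v ≤ 8 * a ^ 3 := by
        have : baseWeight u v ≤ 2 * a ^ 2 := by
          unfold baseWeight
          split_ifs
          · nlinarith
          · exact le_rfl
        calc 4 * a * baseWeight u v ≤ 4 * a * (2 * a ^ 2) := Nat.mul_le_mul_left _ this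
          _ = 8 * a ^ 3 := by ring
      have h3 : 8 * a ^ 3 + 2 ≤ (2 * a * a) ^ 4 := by
        have e1 : (2 * a * a) ^ 4 = 16 * (a ^ 3 * a ^ 5) := by ring
        have e2 : 1 ≤ a ^ 5 := Nat.one_le_pow _ _ ha
        have e3 : 1 ≤ a ^ 3 := Nat.one_le_pow _ _ ha
        rw [e1]
        nlinarith [Nat.mul_le_mul_left (a ^ 3) e2]
      have h4 : 1 ≤ 4 * a * baseWeight u v := by
        have : 0 < 4 * a * baseWeight u v := by positivity
        omega
      rcases adj_iff.1 he with ⟨h1, h1'⟩ | ⟨h1, h1'⟩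
      · rw [hw.of_hor h1 h1']; omega
      · have := hw.of_ver h1 h1'; omega
  · intro u b
    refine (count_le hw u b).trans ?_
    have ha : 1 ≤ a := by have := col_lt u; omega
    have e1 : (2 * a * a) ^ 4 = a * (16 * a ^ 7) := by ring
    have e2 : 1 ≤ a ^ 7 := Nat.one_le_pow _ _ ha
    rw [e1]
    exact Nat.le_mul_of_pos_right _ (by omega)

variable (m : ℕ)

/-- The vertex in row `y` and column `x`, for `y < 2 * (m + 1)` and `x < m + 1`. -/
def vert (y x : ℕ) : Fin (2 * (m + 1) * (m + 1)) :=
  mk (y % (2 * (m + 1))) (x % (m + 1)) (Nat.mod_lt _ (by omega)) (Nat.mod_lt _ (by omega))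

variable {m}

theorem row_vert {y : ℕ} (hy : y < 2 * (m + 1)) (x : ℕ) : row (vert m y x) = y := by
  rw [vert, row_mk, Nat.mod_eq_of_lt hy]

theorem col_vert (y : ℕ) {x : ℕ} (hx : x < m + 1) : col (vert m y x) = x := by
  rw [vert, col_mk, Nat.mod_eq_of_lt hx]

theorem val_vert {y x : ℕ} (hy : y < 2 * (m + 1)) (hx : x < m + 1) :
    (vert m y x : ℕ) = y * (m + 1) + x := by
  change y % (2 * (m + 1)) * (m + 1) + x % (m + 1) = _
  rw [Nat.mod_eq_of_lt hy, Nat.mod_eq_of_lt hx]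

/-- The contribution of a matrix entry to the weight of the way down from row `y` in column `x`:
column `0` is not used by the matrix and contributes nothing. -/
def gap (m : ℕ) (M : ℕ → ℕ → Bool) (y x : ℕ) : ℕ :=
  if y < m ∧ 0 < x ∧ M y (x - 1) = false then 1 else 0

theorem gap_le_one (M : ℕ → ℕ → Bool) (y x : ℕ) : gap m M y x ≤ 1 := by
  unfold gap; split_ifs <;> omega

/-- The additional weights of the vertical edges that encode the matrix `M`; the weights of the
edges between the two middle rows are given by `mid`. -/
def extra (m : ℕ) (M : ℕ → ℕ → Bool) (mid : ℕ → ℕ) (y x : ℕ) : ℕ :=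
  if y < m then 1 + gap m M y x - gap m M (y + 1) x else if y = m then mid x else 1

theorem extra_le_two {M : ℕ → ℕ → Bool} {mid : ℕ → ℕ} (hmid : ∀ x, mid x ≤ 2) (y x : ℕ) :
    extra m M mid y x ≤ 2 := by
  have := gap_le_one (m := m) M y x
  have := hmid x
  unfold extra
  split_ifs <;> omega

/-- The differences of `gap` telescope, and `gap` vanishes in row `m`. In this way one set of
weights serves all rows of the matrix; the summand 1 in `extra` keeps the differences from being
truncated. -/
theorem sum_extra_top (M : ℕ → ℕ → Bool) (mid : ℕ → ℕ) (x k : ℕ) : ∀ y, y + k = m →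
    ∑ z ∈ Finset.Ico y m, extra m M mid z x = k + gap m M y x := by
  induction k with
  | zero =>
    intro y h
    have h : y = m := h
    subst h
    simp [gap]
  | succ k ih =>
    intro y h
    rw [Finset.sum_eq_sum_Ico_succ_bot (by omega), ih (y + 1) (by omega), extra, if_pos (by omega)]
    have := gap_le_one (m := m) M (y + 1) x
    omega

/-- The upper half contributes `m - i` and the gap, the middle edge `mid x`, and the `m - i` edges
of the lower half 1 each. -/
theorem sum_extra (M : ℕ → ℕ → Bool) (mid : ℕ → ℕ) (x : ℕ) {i : ℕ} (hi : i < m) :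
    ∑ z ∈ Finset.Ico i (2 * m + 1 - i), extra m M mid z x =
      2 * (m - i) + (gap m M i x + mid x) := by
  rw [← Finset.sum_Ico_consecutive _ (by omega : i ≤ m) (by omega),
    Finset.sum_eq_sum_Ico_succ_bot (by omega : m < 2 * m + 1 - i),
    sum_extra_top M mid x (m - i) i (by omega),
    Finset.sum_congr rfl (g := fun _ => 1) (fun z hz => by
      rw [Finset.mem_Ico] at hz
      rw [extra, if_neg (by omega), if_neg (by omega)])]
  have : extra m M mid m x = mid x := by simp [extra]
  rw [this]
  simp
  omega

/-- The additional weights between the middle rows after `o` of the `3 * m` operations that process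
the vector `v`: column `j + 1` is switched to `v j` by operation `j` and reset by operation
`2 * m + j`. -/
def midAt (m : ℕ) (v : ℕ → Bool) (o x : ℕ) : ℕ :=
  if x = 0 then 0 else if x ≤ o ∧ o < 2 * m + x then 2 - 2 * (v (x - 1)).toNat else 1

theorem midAt_le_two (v : ℕ → Bool) (o x : ℕ) : midAt m v o x ≤ 2 := by
  unfold midAt; split_ifs <;> omega

/-- The `o`-th operation for the vector `v`. -/
def opAt (m : ℕ) (v : ℕ → Bool) (o : ℕ) : Operation (2 * (m + 1) * (m + 1)) :=
  if o < m then .update (vert m m (o + 1)) (vert m (m + 1) (o + 1))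
    (8 * (m + 1) ^ 3 + (2 - 2 * (v o).toNat))
  else if o < 2 * m then .query (vert m (o - m) 0) (vert m (2 * m + 1 - (o - m)) m)
  else .update (vert m m (o - 2 * m + 1)) (vert m (m + 1) (o - 2 * m + 1)) (8 * (m + 1) ^ 3 + 1)

/-- The weights after an operation. -/
def applyOp {n : ℕ} (w : Sym2 (Fin n) → ℕ) : Operation n → Sym2 (Fin n) → ℕ
  | .query _ _ => w
  | .update u v x => Function.update w s(u, v) x

/-- The weights while the vector `v` is processed, after `o` operations. -/
def Stage (m : ℕ) (M : ℕ → ℕ → Bool) (v : ℕ → Bool) (o : ℕ)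
    (w : Sym2 (Fin (2 * (m + 1) * (m + 1))) → ℕ) : Prop :=
  HasWeights w (extra m M (midAt m v o))

theorem Stage.mid_update {M : ℕ → ℕ → Bool} {v : ℕ → Bool} {o j z : ℕ}
    {w : Sym2 (Fin (2 * (m + 1) * (m + 1))) → ℕ} (h : Stage m M v o w) (hj : j < m) (hz : z ≤ 2)
    (he : ∀ x < m + 1, midAt m v (o + 1) x = if x = j + 1 then z else midAt m v o x) :
    Stage m M v (o + 1) (Function.update w s(vert m m (j + 1), vert m (m + 1) (j + 1))
      (8 * (m + 1) ^ 3 + z)) := by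
  have h1 : row (vert m m (j + 1)) = m := row_vert (by omega) _
  have h2 : col (vert m m (j + 1)) = j + 1 := col_vert _ (by omega)
  refine (HasWeights.update h (u := vert m m (j + 1)) (v := vert m (m + 1) (j + 1)) ?_ ?_ hz).congr
    ?_ (extra_le_two (midAt_le_two v _))
  · rw [h2, col_vert _ (by omega)]
  · rw [h1, row_vert (by omega)]
  · intro y x hx
    rw [h1, h2]
    unfold extra
    rw [he x hx]
    split_ifs <;> omega

theorem Stage.applyOp {M : ℕ → ℕ → Bool} {v : ℕ → Bool} {o : ℕ}
    {w : Sym2 (Fin (2 * (m + 1) * (m + 1))) → ℕ} (h : Stage m M v o w) (ho : o < 3 * m) :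
    Stage m M v (o + 1) (applyOp w (opAt m v o)) := by
  unfold opAt
  split_ifs with h1 h2
  · refine h.mid_update h1 (by omega) fun x hx => ?_
    by_cases hx' : x = o + 1
    · subst hx'
      simp only [midAt, if_true]
      rw [if_neg (by omega), if_pos (by omega), Nat.add_sub_cancel]
    · rw [if_neg hx']
      unfold midAt
      split_ifs <;> omega
  -- During the queries, that is for `m ≤ o < 2 * m`, every column from 1 to `m` is switched and
  -- none is reset yet, even at `o + 1 = 2 * m`.
  · refine HasWeights.congr h (fun y x hx => ?_) (extra_le_two (midAt_le_two v _))
    unfold extra midAt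
    split_ifs <;> omega
  · refine h.mid_update (by omega) (by omega) fun x hx => ?_
    unfold midAt
    split_ifs <;> omega

/-- The operations for the vector `v`. -/
def ops (m : ℕ) (v : ℕ → Bool) : List (Operation (2 * (m + 1) * (m + 1))) :=
  (List.range (3 * m)).map (opAt m v)

theorem ops_drop (v : ℕ → Bool) {o : ℕ} (ho : o < 3 * m) :
    (ops m v).drop o = opAt m v o :: (ops m v).drop (o + 1) := by
  rw [List.drop_eq_getElem_cons (by simpa [ops] using ho)]
  simp [ops]

/-- Before the first and after the last operation all middle edges are at rest, so the weights do
not remember any vector and the next one can be processed. -/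
theorem Stage.restart {M : ℕ → ℕ → Bool} {v : ℕ → Bool} {o o' : ℕ}
    {w : Sym2 (Fin (2 * (m + 1) * (m + 1))) → ℕ} (h : Stage m M v o w)
    (ho : o = 0 ∨ 3 * m ≤ o) (ho' : o' = 0 ∨ 3 * m ≤ o') (v' : ℕ → Bool) : Stage m M v' o' w := by
  refine HasWeights.congr h (fun y x hx => ?_) (extra_le_two (midAt_le_two v' _))
  unfold extra midAt
  split_ifs <;> omega

theorem Stage.legal_drop {M : ℕ → ℕ → Bool} {v : ℕ → Bool}
    {l : List (Operation (2 * (m + 1) * (m + 1)))}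
    (hl : ∀ w, Stage m M v (3 * m) w →
      Legal .unit ((2 * (m + 1) * (m + 1)) ^ 4) (graph (2 * (m + 1)) (m + 1)) w l)
    (k : ℕ) : ∀ o w, o + k = 3 * m → Stage m M v o w →
      Legal .unit ((2 * (m + 1) * (m + 1)) ^ 4) (graph (2 * (m + 1)) (m + 1)) w
        ((ops m v).drop o ++ l) := by
  induction k with
  | zero =>
    intro o w ho h
    rw [List.drop_of_length_le (by simp [ops]; omega), List.nil_append]
    have ho : o = 3 * m := ho
    exact hl w (ho ▸ h)
  | succ k ih =>
    intro o w ho h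
    have h' := ih (o + 1) _ (by omega) (h.applyOp (by omega))
    rw [ops_drop v (by omega), List.cons_append]
    have hmid : ∀ j, j < m → w s(vert m m (j + 1), vert m (m + 1) (j + 1)) =
        8 * (m + 1) ^ 3 + midAt m v o (j + 1) ∧
        (graph (2 * (m + 1)) (m + 1)).Adj (vert m m (j + 1)) (vert m (m + 1) (j + 1)) := by
      intro j hj
      have h1 : row (vert m m (j + 1)) = m := row_vert (by omega) _
      have h2 : col (vert m m (j + 1)) = j + 1 := col_vert _ (by omega)
      have h3 : row (vert m (m + 1) (j + 1)) = m + 1 := row_vert (by omega) _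
      have h4 : col (vert m (m + 1) (j + 1)) = j + 1 := col_vert _ (by omega)
      refine ⟨?_, adj_iff.2 (Or.inr ⟨h2.trans h4.symm, Or.inl (by rw [h1, h3])⟩)⟩
      rw [h.ver _ _ (h2.trans h4.symm) (by rw [h1, h3]), h1, h2]
      simp [extra]
    unfold opAt at h' ⊢
    split_ifs at h' ⊢ with h1 h2
    · obtain ⟨h3, h4⟩ := hmid o h1
      refine ⟨HasWeights.bounded h, h4, ?_, h'⟩
      rw [h3]
      unfold midAt UpdateKind.Allows
      rw [if_neg (by omega), if_neg (by omega)]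
      -- At rest the number is 1 and moves to 0 or 2. The value 2 for a zero entry makes every
      -- update a genuine change by one.
      cases v o <;> simp
    · exact h'
    · obtain ⟨h3, h4⟩ := hmid (o - 2 * m) (by omega)
      refine ⟨HasWeights.bounded h, h4, ?_, h'⟩
      rw [h3]
      unfold midAt UpdateKind.Allows
      rw [if_neg (by omega), if_pos (by omega), Nat.add_sub_cancel]
      cases v (o - 2 * m) <;> simp

theorem Stage.legal {M : ℕ → ℕ → Bool} (l : List (ℕ → Bool)) : ∀ {v : ℕ → Bool}
    {w : Sym2 (Fin (2 * (m + 1) * (m + 1))) → ℕ}, Stage m M v 0 w →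
    Legal .unit ((2 * (m + 1) * (m + 1)) ^ 4) (graph (2 * (m + 1)) (m + 1)) w
      (l.flatMap (ops m)) := by
  induction l with
  | nil => intro v w h; exact HasWeights.bounded h
  | cons v' l ih =>
    intro v w h
    rw [List.flatMap_cons]
    exact Stage.legal_drop (M := M) (v := v')
      (fun w hw => ih (hw.restart (Or.inr le_rfl) (Or.inl rfl) v)) (3 * m) 0 w (by omega)
      (h.restart (Or.inl rfl) (Or.inl rfl) v')

/-- The answer to a query tells whether a row of the matrix and the vector have a common `1`. -/
theorem Stage.one_lt_count {M : ℕ → ℕ → Bool} {v : ℕ → Bool} {o : ℕ}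
    {w : Sym2 (Fin (2 * (m + 1) * (m + 1))) → ℕ} (h : Stage m M v o w) (ho : m ≤ o)
    (ho' : o < 2 * m) {i : ℕ} (hi : i < m) :
    1 < count (graph (2 * (m + 1)) (m + 1)) w (vert m i 0) (vert m (2 * m + 1 - i) m) ↔
      ∃ j < m, M i j = true ∧ v j = true := by
  have h1 : row (vert m i 0) = i := row_vert (by omega) _
  have h2 : col (vert m i 0) = 0 := col_vert _ (by omega)
  have h3 : row (vert m (2 * m + 1 - i) m) = 2 * m + 1 - i := row_vert (by omega) _
  have h4 : col (vert m (2 * m + 1 - i) m) = m := col_vert _ (by omega)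
  rw [count_mirror h h2 (by omega) (by omega) (by omega), h1, h3]
  simp only [sum_extra M _ _ hi]
  -- Column 0 always has sum 0, so the minimum is 0 and the minimal columns are column 0 and the
  -- columns `j + 1` with sum 0.
  have h0 : gap m M i 0 + midAt m v o 0 = 0 := by simp [gap, midAt]
  have hs : ∀ j < m, gap m M i (j + 1) + midAt m v o (j + 1) = 0 ↔ M i j = true ∧ v j = true := by
    intro j hj
    unfold gap midAt
    rw [if_neg (by omega : ¬ j + 1 = 0), if_pos (by omega : j + 1 ≤ o ∧ o < 2 * m + (j + 1)),
      Nat.add_sub_cancel]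
    cases M i j <;> cases v j <;> simp [hi]
  rw [Finset.one_lt_card]
  simp only [Finset.mem_filter, Finset.mem_range]
  constructor
  · rintro ⟨x, ⟨hx, hx'⟩, y, ⟨hy, hy'⟩, hne⟩
    have hx0 := hx' 0 (by omega)
    have hy0 := hy' 0 (by omega)
    rcases Nat.eq_zero_or_pos x with rfl | hx1
    · refine ⟨y - 1, by omega, (hs (y - 1) (by omega)).1 ?_⟩
      rw [Nat.sub_add_cancel (by omega)]
      omega
    · refine ⟨x - 1, by omega, (hs (x - 1) (by omega)).1 ?_⟩
      rw [Nat.sub_add_cancel (by omega)]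
      omega
  · rintro ⟨j, hj, hj'⟩
    have := (hs j hj).2 hj'
    exact ⟨0, ⟨by omega, fun j' _ => by omega⟩, j + 1, ⟨by omega, fun j' _ => by omega⟩, by omega⟩

/-- The initial weight of the edge between `u` and `v`. -/
def startWeight (m : ℕ) (M : ℕ → ℕ → Bool) (u v : Fin (2 * (m + 1) * (m + 1))) : ℕ :=
  if row u = row v then 4 * (m + 1) * (depth (m + 1) (row u) + 1)
  else if col u = col v then
    8 * (m + 1) ^ 3 + extra m M (midAt m (fun _ => false) 0) (min (row u) (row v)) (col u)
  else 0

/-- The initial weights for the matrix `M`. -/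
def start (m : ℕ) (M : ℕ → ℕ → Bool) : Sym2 (Fin (2 * (m + 1) * (m + 1))) → ℕ :=
  Sym2.lift ⟨startWeight m M, fun u v => by
    unfold startWeight
    by_cases h : row u = row v
    · rw [if_pos h, if_pos h.symm, h]
    · rw [if_neg h, if_neg (Ne.symm h), min_comm]
      by_cases h' : col u = col v
      · rw [if_pos h', if_pos h'.symm, h']
      · rw [if_neg h', if_neg (Ne.symm h')]⟩

theorem stage_start (M : ℕ → ℕ → Bool) (v : ℕ → Bool) : Stage m M v 0 (start m M) := by
  refine Stage.restart (v := fun _ => false) (o := 0) ?_ (Or.inl rfl) (Or.inl rfl) v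
  refine ⟨fun u v h h' => ?_, fun u v h h' => ?_, extra_le_two (midAt_le_two _ _)⟩
  · rw [start, Sym2.lift_mk]
    exact if_pos h
  · rw [start, Sym2.lift_mk]
    change startWeight m M u v = _
    rw [startWeight, if_neg (by omega), if_pos h, Nat.min_eq_left (by omega)]

end Grid

/-! ### Programming the word RAM -/

namespace RAM

/-- Expressions over the registers, the input and the memory. -/
inductive Expr
  | reg (r : ℕ)
  | const (c : ℕ)
  | bin (o : BinOp) (e e' : Expr)
  | inp (e : Expr)
  | mem (e : Expr)
  | ite (e e' e'' : Expr)

namespace Expr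

def eval (s : State) : Expr → ℕ
  | reg r => s.reg r
  | const c => c
  | bin o e e' => o.eval (e.eval s) (e'.eval s)
  | inp e => s.inp (e.eval s)
  | mem e => s.mem (e.eval s)
  | ite e e' e'' => if e.eval s ≠ 0 then e'.eval s else e''.eval s

/-- The program that stores the value of an expression in register `k`, using registers from `k`
on. -/
def code : Expr → ℕ → Prog
  | reg r, k => .op .or k r r
  | const c, k => .const k c
  | bin o e e', k => .seq (e.code k) (.seq (e'.code (k + 1)) (.op o k k (k + 1)))
  | inp e, k => .seq (e.code k) (.input k k)
  | mem e, k => .seq (e.code k) (.load k k)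
  | ite e e' e'', k => .seq (e.code k) (.ifnz k (e'.code k) (e''.code k))

/-- An upper bound for the running time of `code`. -/
def cost : Expr → ℕ
  | reg _ => 1
  | const _ => 1
  | bin _ e e' => e.cost + e'.cost + 1
  | inp e => e.cost + 1
  | mem e => e.cost + 1
  | ite e e' e'' => e.cost + e'.cost + e''.cost + 1

/-- All values that occur in the evaluation are smaller than `B`. -/
def Ok (B : ℕ) (s : State) : Expr → Prop
  | reg r => s.reg r < B
  | const c => c < B
  | bin o e e' => e.Ok B s ∧ e'.Ok B s ∧ o.eval (e.eval s) (e'.eval s) < B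
  | inp e => e.Ok B s ∧ s.inp (e.eval s) < B
  | mem e => e.Ok B s ∧ s.mem (e.eval s) < B
  | ite e e' e'' => e.Ok B s ∧ (e.eval s ≠ 0 → e'.Ok B s) ∧ (e.eval s = 0 → e''.Ok B s)

/-- Only registers below `k` occur in the expression. -/
def Below (k : ℕ) : Expr → Prop
  | reg r => r < k
  | const _ => True
  | bin _ e e' => e.Below k ∧ e'.Below k
  | inp e => e.Below k
  | mem e => e.Below k
  | ite e e' e'' => e.Below k ∧ e'.Below k ∧ e''.Below k

theorem Below.mono {k k' : ℕ} (h : k ≤ k') : ∀ {e : Expr}, e.Below k → e.Below k'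
  | reg _, he => Nat.lt_of_lt_of_le he h
  | const _, _ => trivial
  | bin _ _ _, he => ⟨he.1.mono h, he.2.mono h⟩
  | inp e, he => Below.mono (e := e) h he
  | mem e, he => Below.mono (e := e) h he
  | ite _ _ _, he => ⟨he.1.mono h, he.2.1.mono h, he.2.2.mono h⟩

end Expr

/-- The states differ at most in the registers from `k` on. -/
structure State.Agree (k : ℕ) (s s' : State) : Prop where
  reg : ∀ r < k, s'.reg r = s.reg r
  mem : s'.mem = s.mem
  inp : s'.inp = s.inp
  out : s'.out = s.out

theorem State.Agree.refl (k : ℕ) (s : State) : s.Agree k s := ⟨fun _ _ => rfl, rfl, rfl, rfl⟩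

theorem State.Agree.trans {k : ℕ} {s s' s'' : State} (h : s.Agree k s') (h' : s'.Agree k s'') :
    s.Agree k s'' :=
  ⟨fun r hr => (h'.reg r hr).trans (h.reg r hr), h'.mem.trans h.mem, h'.inp.trans h.inp,
    h'.out.trans h.out⟩

theorem State.Agree.mono {k k' : ℕ} {s s' : State} (h : s.Agree k' s') (hk : k ≤ k') :
    s.Agree k s' :=
  ⟨fun r hr => h.reg r (by omega), h.mem, h.inp, h.out⟩

theorem State.Agree.setReg {k : ℕ} {s s' : State} (h : s.Agree k s') (r x : ℕ) :
    (s.setReg r x).Agree k (s'.setReg r x) := by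
  refine ⟨fun r' hr => ?_, h.mem, h.inp, h.out⟩
  change Function.update _ _ _ _ = Function.update _ _ _ _
  by_cases e : r' = r
  · rw [e, Function.update_self, Function.update_self]
  · rw [Function.update_of_ne e, Function.update_of_ne e, h.reg _ hr]

theorem State.agree_setReg {k : ℕ} (s : State) {r : ℕ} (hr : k ≤ r) (x : ℕ) :
    s.Agree k (s.setReg r x) :=
  ⟨fun r' hr' => Function.update_of_ne (by omega) _ _, rfl, rfl, rfl⟩

theorem Expr.eval_congr {k : ℕ} {s s' : State} (h : s.Agree k s') : ∀ {e : Expr}, e.Below k →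
    e.eval s' = e.eval s
  | .reg r, he => h.reg r he
  | .const _, _ => rfl
  | .bin o e e', he => by rw [eval, eval_congr h he.1, eval_congr h he.2, eval]
  | .inp e, he => by rw [eval, eval_congr (e := e) h he, h.inp, eval]
  | .mem e, he => by rw [eval, eval_congr (e := e) h he, h.mem, eval]
  | .ite e e' e'', he => by
    rw [eval, eval_congr h he.1, eval_congr h he.2.1, eval_congr h he.2.2, eval]

theorem Expr.ok_congr {B k : ℕ} {s s' : State} (h : s.Agree k s') : ∀ {e : Expr}, e.Below k →
    e.Ok B s → e.Ok B s'
  | .reg r, he, ho => by change s'.reg r < B; rw [h.reg r he]; exact ho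
  | .const _, _, ho => ho
  | .bin o e e', he, ho => ⟨ok_congr h he.1 ho.1, ok_congr h he.2 ho.2.1, by
      rw [eval_congr h he.1, eval_congr h he.2]; exact ho.2.2⟩
  | .inp e, he, ho => ⟨ok_congr (e := e) h he ho.1, by
      rw [eval_congr (e := e) h he, h.inp]; exact ho.2⟩
  | .mem e, he, ho => ⟨ok_congr (e := e) h he ho.1, by
      rw [eval_congr (e := e) h he, h.mem]; exact ho.2⟩
  | .ite e e' e'', he, ho => ⟨ok_congr h he.1 ho.1, by
      rw [eval_congr h he.1]; exact fun hh => ok_congr h he.2.1 (ho.2.1 hh), by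
      rw [eval_congr h he.1]; exact fun hh => ok_congr h he.2.2 (ho.2.2 hh)⟩

theorem Expr.eval_lt {B : ℕ} {s : State} : ∀ {e : Expr}, e.Ok B s → e.eval s < B
  | .reg _, h => h
  | .const _, h => h
  | .bin _ _ _, h => h.2.2
  | .inp _, h => h.2
  | .mem _, h => h.2
  | .ite e e' e'', h => by
    rw [eval]
    split_ifs with h'
    · exact eval_lt (h.2.1 h')
    · exact eval_lt (h.2.2 (not_not.1 h'))

theorem State.setReg_reg_self (s : State) (r x : ℕ) : (s.setReg r x).reg r = x :=
  Function.update_self _ _ _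

theorem State.setReg_reg (s : State) (r x r' : ℕ) :
    (s.setReg r x).reg r' = if r' = r then x else s.reg r' :=
  Function.update_apply _ _ _ _

theorem State.setMem_mem (s : State) (a x a' : ℕ) :
    (s.setMem a x).mem a' = if a' = a then x else s.mem a' :=
  Function.update_apply _ _ _ _

/-- Evaluation into register `k` touches only registers from `k` on. The second operand goes to `k +
1`, so it cannot destroy the first. -/
theorem Expr.exec_code {B : ℕ} (e : Expr) : ∀ {k : ℕ} {s : State}, e.Below k → e.Ok B s →
    ∃ t s', Exec B (e.code k) s t s' ∧ t ≤ e.cost ∧ s'.reg k = e.eval s ∧ s.Agree k s' := by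
  induction e with
  | reg r =>
    intro k s hb ho
    -- There is no move instruction; the bitwise or of a word with itself copies it without
    -- overflow.
    have h : BinOp.or.eval (s.reg r) (s.reg r) = s.reg r := Nat.or_self _
    refine ⟨_, _, .op s .or k r r (by rw [h]; exact ho), le_rfl, ?_, s.agree_setReg le_rfl _⟩
    rw [State.setReg_reg_self, h, eval]
  | const c =>
    intro k s hb ho
    exact ⟨_, _, .const s k c ho, le_rfl, s.setReg_reg_self _ _, s.agree_setReg le_rfl _⟩
  | bin o e e' ih ih' =>
    intro k s hb ho
    obtain ⟨t, s1, h1, h2, h3, h4⟩ := ih hb.1 ho.1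
    obtain ⟨t', s2, h1', h2', h3', h4'⟩ :=
      ih' (k := k + 1) (s := s1)  (by exact hb.2.mono (Nat.le_succ k)) (ok_congr h4 hb.2 ho.2.1)
    have e1 : s2.reg k = e.eval s := by rw [h4'.reg k (Nat.lt_succ_self k), h3]
    have e2 : s2.reg (k + 1) = e'.eval s := by rw [h3', eval_congr h4 hb.2]
    refine ⟨_, _, .seq h1 (.seq h1' (.op s2 o k k (k + 1) ?_)), ?_, ?_, ?_⟩
    · rw [e1, e2]; exact ho.2.2
    · rw [cost]; omega
    · rw [State.setReg_reg_self, e1, e2, eval]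
    · exact (h4.trans (h4'.mono (Nat.le_succ k))).trans (s2.agree_setReg le_rfl _)
  | inp e ih =>
    intro k s hb ho
    obtain ⟨t, s1, h1, h2, h3, h4⟩ := ih hb ho.1
    refine ⟨_, _, .seq h1 (.input s1 k k ?_), ?_, ?_, ?_⟩
    · rw [h3, h4.inp]; exact ho.2
    · rw [cost]; omega
    · rw [State.setReg_reg_self, h3, h4.inp, eval]
    · exact h4.trans (s1.agree_setReg le_rfl _)
  | mem e ih =>
    intro k s hb ho
    obtain ⟨t, s1, h1, h2, h3, h4⟩ := ih hb ho.1
    refine ⟨_, _, .seq h1 (.load s1 k k ?_), ?_, ?_, ?_⟩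
    · rw [h3, h4.mem]; exact ho.2
    · rw [cost]; omega
    · rw [State.setReg_reg_self, h3, h4.mem, eval]
    · exact h4.trans (s1.agree_setReg le_rfl _)
  | ite e e' e'' ih ih' ih'' =>
    intro k s hb ho
    obtain ⟨t, s1, h1, h2, h3, h4⟩ := ih hb.1 ho.1
    by_cases h : e.eval s = 0
    · obtain ⟨t', s2, h1', h2', h3', h4'⟩ := ih'' hb.2.2 (ok_congr h4 hb.2.2 (ho.2.2 h))
      refine ⟨_, _, .seq h1 (.ifFalse (h3.trans h) h1'), ?_, ?_, h4.trans h4'⟩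
      · rw [cost]; omega
      · rw [h3', eval, if_neg (not_not.2 h), eval_congr h4 hb.2.2]
    · obtain ⟨t', s2, h1', h2', h3', h4'⟩ := ih' hb.2.1 (ok_congr h4 hb.2.1 (ho.2.1 h))
      refine ⟨_, _, .seq h1 (.ifTrue (by rw [h3]; exact h) h1'), ?_, ?_, h4.trans h4'⟩
      · rw [cost]; omega
      · rw [h3', eval, if_pos h, eval_congr h4 hb.2.1]

/-- The registers from `tmp` on are used for the evaluation of expressions. -/
def tmp : ℕ := 16

/-- `p` leads from `s` to `s'` in at most `t` steps, up to the registers from `tmp` on. -/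
def Run (B : ℕ) (p : Prog) (s : State) (t : ℕ) (s' : State) : Prop :=
  ∀ s₁, s.Agree tmp s₁ → ∃ t₁ s₁', Exec B p s₁ t₁ s₁' ∧ t₁ ≤ t ∧ s'.Agree tmp s₁'

def assign (x : ℕ) (e : Expr) : Prog := .seq (e.code tmp) (.op .or x tmp tmp)

def setMem (e e' : Expr) : Prog :=
  .seq (e.code tmp) (.seq (e'.code (tmp + 1)) (.store tmp (tmp + 1)))

def setOut (e e' : Expr) : Prog :=
  .seq (e.code tmp) (.seq (e'.code (tmp + 1)) (.output tmp (tmp + 1)))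

theorem Run.mono {B : ℕ} {p : Prog} {s s' : State} {t t' : ℕ} (h : Run B p s t s') (ht : t ≤ t') :
    Run B p s t' s' := fun s₁ h₁ =>
  let ⟨t₁, s₁', h1, h2, h3⟩ := h s₁ h₁
  ⟨t₁, s₁', h1, h2.trans ht, h3⟩

theorem Run.skip {B : ℕ} (s : State) : Run B .skip s 1 s :=
  fun s₁ h => ⟨_, _, .skip s₁, le_rfl, h⟩

theorem Run.seq {B : ℕ} {p p' : Prog} {s s' s'' : State} {t t' : ℕ} (h : Run B p s t s')
    (h' : Run B p' s' t' s'') : Run B (.seq p p') s (t + t') s'' := by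
  intro s₁ h₁
  obtain ⟨t₁, s₂, h2, h3, h4⟩ := h s₁ h₁
  obtain ⟨t₂, s₃, h5, h6, h7⟩ := h' s₂ h4
  exact ⟨_, _, .seq h2 h5, by omega, h7⟩

theorem Run.assign {B : ℕ} {s : State} (x : ℕ) {e : Expr} (hb : e.Below tmp) (ho : e.Ok B s) :
    Run B (assign x e) s (e.cost + 1) (s.setReg x (e.eval s)) := by
  intro s₁ h₁
  obtain ⟨t, s₂, h2, h3, h4, h5⟩ := e.exec_code hb (Expr.ok_congr h₁ hb ho)
  have h6 : BinOp.or.eval (s₂.reg tmp) (s₂.reg tmp) = e.eval s := by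
    rw [h4, Expr.eval_congr h₁ hb]; exact Nat.or_self _
  have h7 := Exec.op (B := B) s₂ .or x tmp tmp (by rw [h6]; exact Expr.eval_lt ho)
  rw [h6] at h7
  exact ⟨_, _, .seq h2 h7, by omega, (h₁.trans h5).setReg _ _⟩

theorem exec_two {B : ℕ} {s : State} {e e' : Expr} (hb : e.Below tmp)
    (hb' : e'.Below tmp) (ho : e.Ok B s) (ho' : e'.Ok B s) {s₁ : State} (h₁ : s.Agree tmp s₁) :
    ∃ t t' s₂ s₃, Exec B (e.code tmp) s₁ t s₂ ∧ Exec B (e'.code (tmp + 1)) s₂ t' s₃ ∧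
      t + t' ≤ e.cost + e'.cost ∧ s.Agree tmp s₃ ∧ s₃.reg tmp = e.eval s ∧
      s₃.reg (tmp + 1) = e'.eval s := by
  obtain ⟨t, s₂, h2, h3, h4, h5⟩ := e.exec_code hb (Expr.ok_congr h₁ hb ho)
  have h6 := h₁.trans h5
  obtain ⟨t', s₃, h2', h3', h4', h5'⟩ :=
    e'.exec_code (hb'.mono (Nat.le_succ tmp)) (Expr.ok_congr h6 hb' ho')
  refine ⟨t, t', s₂, s₃, h2, h2', by omega, h6.trans (h5'.mono (Nat.le_succ tmp)), ?_, ?_⟩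
  · rw [h5'.reg _ (Nat.lt_succ_self tmp), h4, Expr.eval_congr h₁ hb]
  · rw [h4', Expr.eval_congr h6 hb']

theorem Run.setMem {B : ℕ} {s : State} {e e' : Expr} (hb : e.Below tmp)
    (hb' : e'.Below tmp) (ho : e.Ok B s) (ho' : e'.Ok B s) :
    Run B (setMem e e') s (e.cost + e'.cost + 1) (s.setMem (e.eval s) (e'.eval s)) := by
  intro s₁ h₁
  obtain ⟨t, t', s₂, s₃, h1, h2, h3, h4, h5, h6⟩ := exec_two hb hb' ho ho' h₁
  refine ⟨_, _, .seq h1 (.seq h2 (.store s₃ _ _)), by omega, h4.reg, ?_, h4.inp, h4.out⟩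
  change Function.update s₃.mem _ _ = Function.update s.mem _ _
  rw [h4.mem, h5, h6]

theorem Run.setOut {B : ℕ} {s : State} {e e' : Expr} (hb : e.Below tmp)
    (hb' : e'.Below tmp) (ho : e.Ok B s) (ho' : e'.Ok B s) :
    Run B (setOut e e') s (e.cost + e'.cost + 1) (s.setOut (e.eval s) (e'.eval s)) := by
  intro s₁ h₁
  obtain ⟨t, t', s₂, s₃, h1, h2, h3, h4, h5, h6⟩ := exec_two hb hb' ho ho' h₁
  refine ⟨_, _, .seq h1 (.seq h2 (.output s₃ _ _)), by omega, h4.reg, h4.mem, h4.inp, ?_⟩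
  change Function.update s₃.out _ _ = Function.update s.out _ _
  rw [h4.out, h5, h6]

theorem Run.ifTrue {B r : ℕ} {p p' : Prog} {s s' : State} {t : ℕ} (hr : r < tmp)
    (h : s.reg r ≠ 0) (hp : Run B p s t s') : Run B (.ifnz r p p') s (t + 1) s' := by
  intro s₁ h₁
  obtain ⟨t₁, s₂, h2, h3, h4⟩ := hp s₁ h₁
  exact ⟨_, _, .ifTrue (by rwa [h₁.reg r hr]) h2, by omega, h4⟩

theorem Run.ifFalse {B r : ℕ} {p p' : Prog} {s s' : State} {t : ℕ} (hr : r < tmp)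
    (h : s.reg r = 0) (hp : Run B p' s t s') : Run B (.ifnz r p p') s (t + 1) s' := by
  intro s₁ h₁
  obtain ⟨t₁, s₂, h2, h3, h4⟩ := hp s₁ h₁
  exact ⟨_, _, .ifFalse (by rwa [h₁.reg r hr]) h2, by omega, h4⟩

/-- The program `p` sets register `r`, and `p'` is repeated as long as the register is not `0`. -/
def loop (r : ℕ) (p p' : Prog) : Prog := .seq p (.whilenz r (.seq p' p))

theorem Run.loop_done {B r : ℕ} {p p' : Prog} {s s' : State} {t : ℕ} (hr : r < tmp)
    (hp : Run B p s t s') (h : s'.reg r = 0) : Run B (loop r p p') s (t + 1) s' := by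
  intro s₁ h₁
  obtain ⟨t₁, s₂, h2, h3, h4⟩ := hp s₁ h₁
  exact ⟨_, _, .seq h2 (.whileFalse (by rwa [h4.reg r hr])), by omega, h4⟩

theorem Run.loop_step {B r : ℕ} {p p' : Prog} {s s' s'' s''' : State} {t t' t'' : ℕ} (hr : r < tmp)
    (hp : Run B p s t s') (h : s'.reg r ≠ 0) (hp' : Run B p' s' t' s'')
    (hl : Run B (loop r p p') s'' t'' s''') :
    Run B (loop r p p') s (t + t' + t'' + 1) s''' := by
  intro s₁ h₁
  obtain ⟨t₁, s₂, h2, h3, h4⟩ := hp s₁ h₁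
  obtain ⟨t₂, s₃, h5, h6, h7⟩ := hp' s₂ h4
  obtain ⟨t₃, s₄, h8, h9, h10⟩ := hl s₃ h7
  -- A run of `loop` from `s''` starts with the test; here that test is regrouped as the end of the
  -- body of the current iteration.
  cases h8 with
  | seq h11 h12 =>
    refine ⟨_, _, .seq h2 (.whileTrue (by rwa [h4.reg r hr]) (.seq h5 h11) h12), ?_, h10⟩
    omega

/-! ### Simulation of a machine in a segment of the memory -/

/-- The registers used by the simulation: the beginning of the segment, the first output word, the
input address, and a test register. -/
def rBase : ℕ := 0
def rOut : ℕ := 1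
def rAddr : ℕ := 2
def rTest : ℕ := 3

def segAddr (r : ℕ) : Expr := .bin .add (.reg rBase) (.const r)
def segReg (r : ℕ) : Expr := .mem (segAddr r)
def segMemAddr (R a : ℕ) : Expr := .bin .add (.reg rBase) (.bin .add (.const R) (segReg a))

/-- Simulation of a program: its first `R` registers and its memory are kept in a segment, its
input is given by an expression in the address `rAddr`, and of its output only the first word is
kept. -/
def simulate (R : ℕ) (e : Expr) : Prog → Prog
  | .skip => .skip
  | .const r c => setMem (segAddr r) (.const c)
  | .op o r a b => setMem (segAddr r) (.bin o (segReg a) (segReg b))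
  | .load r a => setMem (segAddr r) (.mem (segMemAddr R a))
  | .store a b => setMem (segMemAddr R a) (segReg b)
  | .input r a => .seq (assign rAddr (segReg a)) (setMem (segAddr r) e)
  | .output a b => .seq (assign rTest (segReg a)) (.ifnz rTest .skip (assign rOut (segReg b)))
  | .seq p p' => .seq (simulate R e p) (simulate R e p')
  | .ifnz r p p' => .seq (assign rTest (segReg r)) (.ifnz rTest (simulate R e p) (simulate R e p'))
  | .whilenz r p => loop rTest (assign rTest (segReg r)) (simulate R e p)

/-- The program uses only registers below `R`. -/
def Prog.UsesBelow (R : ℕ) : Prog → Prop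
  | .skip => True
  | .const r _ => r < R
  | .op _ r a b => r < R ∧ a < R ∧ b < R
  | .load r a => r < R ∧ a < R
  | .store a b => a < R ∧ b < R
  | .input r a => r < R ∧ a < R
  | .output a b => a < R ∧ b < R
  | .seq p p' => p.UsesBelow R ∧ p'.UsesBelow R
  | .ifnz r p p' => r < R ∧ p.UsesBelow R ∧ p'.UsesBelow R
  | .whilenz r p => r < R ∧ p.UsesBelow R

theorem Prog.UsesBelow.mono {R R' : ℕ} (h : R ≤ R') : ∀ {p : Prog}, p.UsesBelow R → p.UsesBelow R'
  | .skip, _ => trivial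
  | .const _ _, hp => Nat.lt_of_lt_of_le hp h
  | .op _ _ _ _, hp => ⟨hp.1.trans_le h, hp.2.1.trans_le h, hp.2.2.trans_le h⟩
  | .load _ _, hp => ⟨hp.1.trans_le h, hp.2.trans_le h⟩
  | .store _ _, hp => ⟨hp.1.trans_le h, hp.2.trans_le h⟩
  | .input _ _, hp => ⟨hp.1.trans_le h, hp.2.trans_le h⟩
  | .output _ _, hp => ⟨hp.1.trans_le h, hp.2.trans_le h⟩
  | .seq _ _, hp => ⟨hp.1.mono h, hp.2.mono h⟩
  | .ifnz _ _ _, hp => ⟨hp.1.trans_le h, hp.2.1.mono h, hp.2.2.mono h⟩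
  | .whilenz _ _, hp => ⟨hp.1.trans_le h, hp.2.mono h⟩

theorem Prog.exists_usesBelow : ∀ p : Prog, ∃ R, p.UsesBelow R
  | .skip => ⟨0, trivial⟩
  | .const r _ => ⟨r + 1, Nat.lt_succ_self r⟩
  | .op _ r a b => ⟨r + a + b + 1, by omega, by omega, by omega⟩
  | .load r a => ⟨r + a + 1, by omega, by omega⟩
  | .store a b => ⟨a + b + 1, by omega, by omega⟩
  | .input r a => ⟨r + a + 1, by omega, by omega⟩
  | .output a b => ⟨a + b + 1, by omega, by omega⟩
  | .seq p p' => by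
    obtain ⟨R, hR⟩ := exists_usesBelow p
    obtain ⟨R', hR'⟩ := exists_usesBelow p'
    exact ⟨R + R', hR.mono (by omega), hR'.mono (by omega)⟩
  | .ifnz r p p' => by
    obtain ⟨R, hR⟩ := exists_usesBelow p
    obtain ⟨R', hR'⟩ := exists_usesBelow p'
    exact ⟨r + 1 + R + R', by omega, hR.mono (by omega), hR'.mono (by omega)⟩
  | .whilenz r p => by
    obtain ⟨R, hR⟩ := exists_usesBelow p
    exact ⟨r + 1 + R, by omega, hR.mono (by omega)⟩

/-- All words are smaller than `X`. -/
structure State.Small (X : ℕ) (s : State) : Prop where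
  reg : ∀ r < tmp, s.reg r < X
  mem : ∀ a, s.mem a < X
  inp : ∀ a, s.inp a < X

theorem State.Small.setReg {X : ℕ} {s : State} (h : s.Small X) (r : ℕ) {x : ℕ} (hx : x < X) :
    (s.setReg r x).Small X := by
  refine ⟨fun r' hr' => ?_, h.mem, h.inp⟩
  rw [State.setReg_reg]
  split_ifs
  · exact hx
  · exact h.reg _ hr'

theorem State.Small.setMem {X : ℕ} {s : State} (h : s.Small X) (a : ℕ) {x : ℕ} (hx : x < X) :
    (s.setMem a x).Small X := by
  refine ⟨h.reg, fun a' => ?_, h.inp⟩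
  rw [State.setMem_mem]
  split_ifs
  · exact hx
  · exact h.mem _

/-- The states differ at most in a segment of the memory and the registers of the simulation. -/
structure State.Frame (base len : ℕ) (s s' : State) : Prop where
  reg : ∀ r, r ≠ rOut → r ≠ rAddr → r ≠ rTest → s'.reg r = s.reg r
  mem : ∀ a, a < base ∨ base + len ≤ a → s'.mem a = s.mem a
  inp : s'.inp = s.inp
  out : s'.out = s.out

theorem State.Frame.refl (base len : ℕ) (s : State) : s.Frame base len s :=
  ⟨fun _ _ _ _ => rfl, fun _ _ => rfl, rfl, rfl⟩

theorem State.Frame.setReg {base len : ℕ} {s s' : State} (h : s.Frame base len s') {r : ℕ}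
    (hr : r = rOut ∨ r = rAddr ∨ r = rTest) (x : ℕ) : s.Frame base len (s'.setReg r x) := by
  refine ⟨fun r' h1 h2 h3 => ?_, h.mem, h.inp, h.out⟩
  rw [State.setReg_reg, if_neg, h.reg r' h1 h2 h3]
  rintro rfl
  rcases hr with hr | hr | hr
  · exact h1 hr
  · exact h2 hr
  · exact h3 hr

theorem State.Frame.setMem {base len : ℕ} {s s' : State} (h : s.Frame base len s') {a : ℕ}
    (ha : base ≤ a) (ha' : a < base + len) (x : ℕ) : s.Frame base len (s'.setMem a x) := by
  refine ⟨h.reg, fun a' h' => ?_, h.inp, h.out⟩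
  rw [State.setMem_mem, if_neg (by omega), h.mem a' h']

/-- The segment of `S` that begins at `base` holds the registers and the memory of the machine in
state `s`, whose words are smaller than `B`. -/
structure Holds (B R base : ℕ) (s S : State) : Prop where
  reg : ∀ r < R, S.mem (base + r) = s.reg r
  mem : ∀ a < B, S.mem (base + (R + a)) = s.mem a
  bound : ∀ r, s.reg r < B

/-- The invariant of the simulation started in `S₀`. -/
structure Simulates (X B R base : ℕ) (S₀ s S : State) : Prop where
  holds : Holds B R base s S
  small : S.Small X
  out : S.reg rOut = s.out 0
  frame : S₀.Frame base (R + B) S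

section

variable {X B R base : ℕ} {S₀ s S : State}

theorem Simulates.base_eq (h : Simulates X B R base S₀ s S) (hb : S₀.reg rBase = base) :
    S.reg rBase = base := by
  rw [h.frame.reg rBase (by decide) (by decide) (by decide), hb]

theorem Simulates.setReg (h : Simulates X B R base S₀ s S) {r x : ℕ} (hr : r = rAddr ∨ r = rTest)
    (hx : x < X) : Simulates X B R base S₀ s (S.setReg r x) := by
  refine ⟨⟨h.holds.reg, h.holds.mem, h.holds.bound⟩, h.small.setReg _ hx, ?_,
    h.frame.setReg (by tauto) _⟩
  rw [← h.out, State.setReg_reg, if_neg]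
  rcases hr with rfl | rfl <;> decide

theorem Simulates.write_reg (h : Simulates X B R base S₀ s S) {r x : ℕ} (hr : r < R)
    (hx : x < B) (hX : B ≤ X) :
    Simulates X B R base S₀ (s.setReg r x) (S.setMem (base + r) x) := by
  refine ⟨⟨fun r' hr' => ?_, fun a ha => ?_, fun r' => ?_⟩, h.small.setMem _ (by omega), h.out,
    h.frame.setMem (by omega) (by omega) _⟩
  · rw [State.setMem_mem, State.setReg_reg, ← h.holds.reg r' hr']
    split_ifs <;> first | rfl | omega
  · rw [State.setMem_mem, if_neg (by omega), h.holds.mem a ha]; rfl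
  · rw [State.setReg_reg]
    split_ifs
    · exact hx
    · exact h.holds.bound r'

theorem Simulates.write_mem (h : Simulates X B R base S₀ s S) {a x : ℕ} (ha : a < B)
    (hx : x < X) :
    Simulates X B R base S₀ (s.setMem a x) (S.setMem (base + (R + a)) x) := by
  refine ⟨⟨fun r hr => ?_, fun a' ha' => ?_, h.holds.bound⟩, h.small.setMem _ hx, h.out,
    h.frame.setMem (by omega) (by omega) _⟩
  · rw [State.setMem_mem, if_neg (by omega), h.holds.reg r hr]; rfl
  · rw [State.setMem_mem, State.setMem_mem, ← h.holds.mem a' ha']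
    split_ifs <;> first | rfl | omega

theorem Simulates.segAddr (h : Simulates X B R base S₀ s S) (hb : S₀.reg rBase = base) {C r : ℕ}
    (hr : r < R) (hX : base + R + B ≤ X) (hC : X ≤ C) :
    (segAddr r).eval S = base + r ∧ (segAddr r).Ok C S := by
  have e : S.reg rBase = base := h.base_eq hb
  refine ⟨by simp [RAM.segAddr, Expr.eval, e, BinOp.eval], ?_⟩
  simp only [RAM.segAddr, Expr.Ok, Expr.eval, e, BinOp.eval]
  omega

theorem Simulates.segReg (h : Simulates X B R base S₀ s S) (hb : S₀.reg rBase = base) {C r : ℕ}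
    (hr : r < R) (hX : base + R + B ≤ X) (hC : X ≤ C) :
    (segReg r).eval S = s.reg r ∧ (segReg r).Ok C S := by
  obtain ⟨e, ho⟩ := h.segAddr hb hr hX hC
  exact ⟨by rw [RAM.segReg, Expr.eval, e, h.holds.reg r hr], ho,
    (h.small.mem _).trans_le hC⟩

/-- The registers of the simulated machine hold words below `B`, so every address it can use lies in
its segment; this is why a segment of length `R + B` suffices. -/
theorem Simulates.segMemAddr (h : Simulates X B R base S₀ s S) (hb : S₀.reg rBase = base) {C a : ℕ}
    (hr : a < R) (hX : base + R + B ≤ X) (hC : X ≤ C) :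
    (segMemAddr R a).eval S = base + (R + s.reg a) ∧ (segMemAddr R a).Ok C S := by
  obtain ⟨e, ho⟩ := h.segReg hb hr hX hC
  have e' : S.reg rBase = base := h.base_eq hb
  have := h.holds.bound a
  refine ⟨by simp [RAM.segMemAddr, Expr.eval, e, e', BinOp.eval], ?_⟩
  simp only [RAM.segMemAddr, Expr.Ok, Expr.eval, e, e', BinOp.eval]
  refine ⟨by omega, ⟨by omega, ho, by omega⟩, by omega⟩

theorem below_segAddr (r : ℕ) : (segAddr r).Below tmp :=
  ⟨show rBase < tmp by decide, trivial⟩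

theorem below_segReg (r : ℕ) : (segReg r).Below tmp := below_segAddr r

theorem below_segMemAddr (R r : ℕ) : (segMemAddr R r).Below tmp :=
  ⟨show rBase < tmp by decide, trivial, below_segReg r⟩

/-- The simulation is correct and slows down the machine by a constant factor. -/
theorem simulate_run {C : ℕ} {e : Expr} (hX : base + R + B ≤ X) (hC : X ≤ C)
    (hb : S₀.reg rBase = base) (he : e.Below tmp) {x : ℕ → ℕ}
    (hinp : ∀ S, S.Small X → S₀.Frame base (R + B) S → S.reg rAddr < B →
      e.Ok C S ∧ e.eval S = x (S.reg rAddr))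
    {p : Prog} {s s' : State} {t : ℕ} (h : Exec B p s t s') :
    p.UsesBelow R → s.inp = x → ∀ S, Simulates X B R base S₀ s S →
      ∃ S', Run C (simulate R e p) S ((20 + e.cost) * t) S' ∧ Simulates X B R base S₀ s' S' ∧
        s'.inp = x := by
  induction h with
  | skip s =>
    intro hp hx S hS
    exact ⟨S, (Run.skip S).mono (by omega), hS, hx⟩
  | const s r c h =>
    intro hp hx S hS
    obtain ⟨e1, o1⟩ := hS.segAddr hb hp hX hC
    have := Run.setMem (e' := .const c) (below_segAddr r) trivial o1 (by change c < C; omega)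
    rw [e1] at this
    exact ⟨_, this.mono (by simp [segAddr, Expr.cost]; omega), hS.write_reg hp h (by omega), hx⟩
  | op s o r a b h =>
    intro hp hx S hS
    obtain ⟨e1, o1⟩ := hS.segAddr hb hp.1 hX hC
    obtain ⟨e2, o2⟩ := hS.segReg hb hp.2.1 hX hC
    obtain ⟨e3, o3⟩ := hS.segReg hb hp.2.2 hX hC
    have := Run.setMem (e' := .bin o (segReg a) (segReg b)) (below_segAddr r)
      ⟨below_segReg a, below_segReg b⟩ o1 ⟨o2, o3, by rw [e2, e3]; omega⟩
    rw [Expr.eval, e1, e2, e3] at this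
    exact ⟨_, this.mono (by simp [segAddr, segReg, Expr.cost]; omega),
      hS.write_reg hp.1 h (by omega), hx⟩
  | load s r a h =>
    intro hp hx S hS
    obtain ⟨e1, o1⟩ := hS.segAddr hb hp.1 hX hC
    obtain ⟨e2, o2⟩ := hS.segMemAddr hb hp.2 hX hC
    have := Run.setMem (e' := .mem (segMemAddr R a)) (below_segAddr r)
      (below_segMemAddr R a) o1 ⟨o2, (hS.small.mem _).trans_le hC⟩
    rw [Expr.eval, e1, e2, hS.holds.mem _ (hS.holds.bound a)] at this
    exact ⟨_, this.mono (by simp [segAddr, segMemAddr, segReg, Expr.cost]; omega),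
      hS.write_reg hp.1 h (by omega), hx⟩
  | store s a b =>
    intro hp hx S hS
    obtain ⟨e1, o1⟩ := hS.segMemAddr hb hp.1 hX hC
    obtain ⟨e2, o2⟩ := hS.segReg hb hp.2 hX hC
    have := Run.setMem (below_segMemAddr R a) (below_segReg b) o1 o2
    rw [e1, e2] at this
    have hB := hS.holds.bound b
    exact ⟨_, this.mono (by simp [segAddr, segMemAddr, segReg, Expr.cost]; omega),
      hS.write_mem (hS.holds.bound a) (by omega), hx⟩
  | input s r a h =>
    intro hp hx S hS
    obtain ⟨e2, o2⟩ := hS.segReg hb hp.2 hX hC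
    -- The input array of the simulated machine is virtual: `e` computes a word of it from the
    -- address in `rAddr`.
    have h1 := Run.assign rAddr (below_segReg a) o2
    rw [e2] at h1
    have hB := hS.holds.bound a
    have hS' := hS.setReg (r := rAddr) (x := s.reg a) (Or.inl rfl) (by omega)
    obtain ⟨e1, o1⟩ := hS'.segAddr hb hp.1 hX hC
    have hr : (S.setReg rAddr (s.reg a)).reg rAddr = s.reg a := S.setReg_reg_self _ _
    obtain ⟨o3, e3⟩ := hinp _ hS'.small hS'.frame (by rw [hr]; exact hB)
    have h2 := Run.setMem (below_segAddr r) he o1 o3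
    rw [e1, e3, hr, ← hx] at h2
    exact ⟨_, (h1.seq h2).mono (by simp [segAddr, segReg, Expr.cost]; omega),
      hS'.write_reg hp.1 h (by omega), hx⟩
  | output s a b =>
    intro hp hx S hS
    obtain ⟨e1, o1⟩ := hS.segReg hb hp.1 hX hC
    have h1 := Run.assign rTest (below_segReg a) o1
    rw [e1] at h1
    have hB := hS.holds.bound a
    have hB' := hS.holds.bound b
    have hS' := hS.setReg (r := rTest) (x := s.reg a) (Or.inr rfl) (by omega)
    have hr : (S.setReg rTest (s.reg a)).reg rTest = s.reg a := S.setReg_reg_self _ _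
    -- Only output word 0 of an oracle is ever read, so writing to any other output address is
    -- simulated by doing nothing.
    by_cases h0 : s.reg a = 0
    · obtain ⟨e2, o2⟩ := hS'.segReg hb hp.2 hX hC
      have h2 := (Run.assign rOut (below_segReg b) o2).ifFalse (p := .skip) (r := rTest) (by decide)
        (hr.trans h0)
      rw [e2] at h2
      refine ⟨_, (h1.seq h2).mono (by simp [segAddr, segReg, Expr.cost]; omega),
        ⟨⟨hS'.holds.reg, hS'.holds.mem, hS'.holds.bound⟩, hS'.small.setReg _ (by omega), ?_,
        hS'.frame.setReg (Or.inl rfl) _⟩, hx⟩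
      rw [State.setReg_reg_self, h0]
      exact (Function.update_self 0 (s.reg b) s.out).symm
    · have h2 := (Run.skip (B := C) (S.setReg rTest (s.reg a))).ifTrue
        (p' := RAM.assign rOut (RAM.segReg b)) (r := rTest) (by decide) (by rwa [hr])
      refine ⟨_, (h1.seq h2).mono (by simp [segAddr, segReg, Expr.cost]; omega),
        ⟨⟨hS'.holds.reg, hS'.holds.mem, hS'.holds.bound⟩, hS'.small, ?_, hS'.frame⟩, hx⟩
      rw [hS'.out]
      exact (Function.update_of_ne (Ne.symm h0) (s.reg b) s.out).symm
  | seq h h' ih ih' =>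
    intro hp hx S hS
    obtain ⟨S1, h1, h2, h3⟩ := ih hp.1 hx S hS
    obtain ⟨S2, h4, h5, h6⟩ := ih' hp.2 h3 S1 h2
    exact ⟨S2, (h1.seq h4).mono (by rw [Nat.mul_add]), h5, h6⟩
  | ifTrue hr h ih =>
    rename_i r p p' s s' t
    intro hp hx S hS
    obtain ⟨e1, o1⟩ := hS.segReg hb hp.1 hX hC
    have h1 := Run.assign rTest (below_segReg r) o1
    rw [e1] at h1
    have hB := hS.holds.bound r
    obtain ⟨S1, h2, h3, h4⟩ := ih hp.2.1 hx _
      (hS.setReg (r := rTest) (x := s.reg r) (Or.inr rfl) (by omega))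
    refine ⟨S1, (h1.seq (h2.ifTrue (r := rTest) (by decide) ?_)).mono ?_, h3, h4⟩
    · rw [State.setReg_reg_self]; exact hr
    · simp [segAddr, segReg, Expr.cost, Nat.mul_add]; omega
  | ifFalse hr h ih =>
    rename_i r p p' s s' t
    intro hp hx S hS
    obtain ⟨e1, o1⟩ := hS.segReg hb hp.1 hX hC
    have h1 := Run.assign rTest (below_segReg r) o1
    rw [e1] at h1
    have hB := hS.holds.bound r
    obtain ⟨S1, h2, h3, h4⟩ := ih hp.2.2 hx _
      (hS.setReg (r := rTest) (x := s.reg r) (Or.inr rfl) (by omega))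
    refine ⟨S1, (h1.seq (h2.ifFalse (r := rTest) (by decide) ?_)).mono ?_, h3, h4⟩
    · rw [State.setReg_reg_self]; exact hr
    · simp [segAddr, segReg, Expr.cost, Nat.mul_add]; omega
  | whileTrue hr h h' ih ih' =>
    rename_i r p s s' s'' t t'
    intro hp hx S hS
    obtain ⟨e1, o1⟩ := hS.segReg hb hp.1 hX hC
    have h1 := Run.assign rTest (below_segReg r) o1
    rw [e1] at h1
    have hB := hS.holds.bound r
    obtain ⟨S1, h2, h3, h4⟩ := ih hp.2 hx _
      (hS.setReg (r := rTest) (x := s.reg r) (Or.inr rfl) (by omega))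
    obtain ⟨S2, h5, h6, h7⟩ := ih' hp h4 S1 h3
    refine ⟨S2, (h1.loop_step (r := rTest) (by decide) ?_ h2 h5).mono ?_, h6, h7⟩
    · rw [State.setReg_reg_self]; exact hr
    · simp [segAddr, segReg, Expr.cost, Nat.mul_add]; omega
  | whileFalse hr =>
    rename_i r p s
    intro hp hx S hS
    obtain ⟨e1, o1⟩ := hS.segReg hb hp.1 hX hC
    have h1 := Run.assign rTest (below_segReg r) o1
    rw [e1] at h1
    have hB := hS.holds.bound r
    refine ⟨_, (h1.loop_done (r := rTest) (by decide) ?_).mono ?_,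
      hS.setReg (r := rTest) (x := s.reg r) (Or.inr rfl) (by omega), hx⟩
    · rw [State.setReg_reg_self]; exact hr
    · simp [segAddr, segReg, Expr.cost]; omega

end

end RAM

/-! ### Expressions with polynomially bounded values -/

namespace RAM

/-- Operations whose result is not much larger than the operands. -/
def BinOp.arith : BinOp → Bool
  | .add | .sub | .mul | .div | .mod | .lt | .eq => true
  | _ => false

namespace Expr

instance : Add Expr := ⟨bin .add⟩
instance : Sub Expr := ⟨bin .sub⟩
instance : Mul Expr := ⟨bin .mul⟩
instance : Div Expr := ⟨bin .div⟩
instance : Mod Expr := ⟨bin .mod⟩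
instance (n : ℕ) : OfNat Expr n := ⟨const n⟩

def pow (e : Expr) : ℕ → Expr
  | 0 => 1
  | k + 1 => e.pow k * e

def lt (e e' : Expr) : Expr := bin .lt e e'
def eq (e e' : Expr) : Expr := bin .eq e e'
def min (e e' : Expr) : Expr := ite (lt e e') e e'

section
variable (s : State) (e e' e'' : Expr)

@[simp] theorem eval_reg (r : ℕ) : (reg r).eval s = s.reg r := rfl
@[simp] theorem eval_const (c : ℕ) : (const c).eval s = c := rfl
@[simp] theorem eval_ofNat (n : ℕ) : (no_index (OfNat.ofNat n : Expr)).eval s = OfNat.ofNat n :=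
  rfl
@[simp] theorem eval_add : (e + e').eval s = e.eval s + e'.eval s := rfl
@[simp] theorem eval_sub : (e - e').eval s = e.eval s - e'.eval s := rfl
@[simp] theorem eval_mul : (e * e').eval s = e.eval s * e'.eval s := rfl
@[simp] theorem eval_div : (e / e').eval s = e.eval s / e'.eval s := rfl
@[simp] theorem eval_mod : (e % e').eval s = e.eval s % e'.eval s := rfl
@[simp] theorem eval_lt_expr : (lt e e').eval s = if e.eval s < e'.eval s then 1 else 0 := rfl
@[simp] theorem eval_eq_expr : (eq e e').eval s = if e.eval s = e'.eval s then 1 else 0 := rfl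
@[simp] theorem eval_inp : (inp e).eval s = s.inp (e.eval s) := rfl
@[simp] theorem eval_ite :
    (ite e e' e'').eval s = if e.eval s ≠ 0 then e'.eval s else e''.eval s := rfl

@[simp] theorem eval_pow (k : ℕ) : (e.pow k).eval s = e.eval s ^ k := by
  induction k with
  | zero => rfl
  | succ k ih => rw [pow, eval_mul, ih, pow_succ]

@[simp] theorem eval_min : (min e e').eval s = Min.min (e.eval s) (e'.eval s) := by
  simp only [min, eval_ite, eval_lt_expr]
  split_ifs <;> omega

end

/-- The expression uses only harmless operations and registers below `tmp`. -/
def good : Expr → Bool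
  | reg r => decide (r < tmp)
  | const _ => true
  | bin o e e' => o.arith && e.good && e'.good
  | inp e => e.good
  | mem e => e.good
  | ite e e' e'' => e.good && e'.good && e''.good

theorem good_pow {e : Expr} (h : e.good = true) : ∀ k, (e.pow k).good = true
  | 0 => rfl
  | k + 1 => by
    change (BinOp.mul.arith && (e.pow k).good && e.good) = true
    rw [good_pow h k, h]; rfl

theorem below_of_good : ∀ {e : Expr}, e.good = true → e.Below tmp
  | reg r, h => of_decide_eq_true (p := r < tmp) h
  | const _, _ => trivial
  | bin o e e', h => by
    simp only [good, Bool.and_eq_true] at h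
    exact ⟨below_of_good h.1.2, below_of_good h.2⟩
  | inp e, h => below_of_good (e := e) h
  | mem e, h => below_of_good (e := e) h
  | ite e e' e'', h => by
    simp only [good, Bool.and_eq_true] at h
    exact ⟨below_of_good h.1.1, below_of_good h.1.2, below_of_good h.2⟩

/-- An exponent such that all values are at most this power of the size of the words. -/
def deg : Expr → ℕ
  | reg _ => 1
  | const c => c + 1
  | bin _ e e' => e.deg + e'.deg
  | inp e => e.deg
  | mem e => e.deg
  | ite e e' e'' => e.deg + e'.deg + e''.deg

theorem deg_pos : ∀ e : Expr, 0 < e.deg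
  | reg _ => Nat.one_pos
  | const c => Nat.succ_pos c
  | bin _ e _ => Nat.add_pos_left e.deg_pos _
  | inp e => e.deg_pos
  | mem e => e.deg_pos
  | ite e _ _ => Nat.add_pos_left (Nat.add_pos_left e.deg_pos _) _

theorem arith_eval_lt {o : BinOp} (ho : o.arith = true) {x y p q : ℕ} (hx : x < p) (hy : y < q)
    (hp : 2 ≤ p) (hq : 2 ≤ q) : o.eval x y < p * q := by
  have h1 : p ≤ p * q := Nat.le_mul_of_pos_right _ (by omega)
  cases o <;> simp only [BinOp.arith, Bool.false_eq_true] at ho <;> simp only [BinOp.eval]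
  · nlinarith
  · omega
  · exact Nat.mul_lt_mul'' hx hy
  · have := Nat.div_le_self x y; omega
  · have := Nat.mod_le x y; omega
  · split_ifs <;> omega
  · split_ifs <;> omega

/-- The programs use finitely many expressions of fixed degree. So all intermediate results are
polynomial in the bound on the stored words, and words of logarithmic length suffice. -/
theorem eval_lt_pow {X : ℕ} {s : State} (hX : 2 ≤ X) (hs : s.Small X) : ∀ {e : Expr},
    e.good = true → e.eval s < X ^ e.deg
  | reg r, h => by rw [deg, pow_one]; exact hs.reg r (of_decide_eq_true h)
  | const c, _ => by
    calc c < c + 1 := Nat.lt_succ_self c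
      _ < 2 ^ (c + 1) := Nat.lt_two_pow_self
      _ ≤ X ^ (c + 1) := Nat.pow_le_pow_left hX _
  | bin o e e', h => by
    simp only [good, Bool.and_eq_true] at h
    rw [deg, pow_add]
    exact arith_eval_lt h.1.1 (eval_lt_pow hX hs h.1.2) (eval_lt_pow hX hs h.2)
      (hX.trans (Nat.le_self_pow e.deg_pos.ne' X)) (hX.trans (Nat.le_self_pow e'.deg_pos.ne' X))
  | inp e, _ => (hs.inp _).trans_le (Nat.le_self_pow e.deg_pos.ne' X)
  | mem e, _ => (hs.mem _).trans_le (Nat.le_self_pow e.deg_pos.ne' X)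
  | ite e e' e'', h => by
    simp only [good, Bool.and_eq_true] at h
    rw [eval, deg]
    split_ifs
    · exact (eval_lt_pow hX hs h.1.2).trans_le (Nat.pow_le_pow_right (by omega) (by omega))
    · exact (eval_lt_pow hX hs h.2).trans_le (Nat.pow_le_pow_right (by omega) (by omega))

theorem ok_of_good {X C : ℕ} {s : State} (hX : 2 ≤ X) (hs : s.Small X) : ∀ {e : Expr},
    e.good = true → X ^ e.deg ≤ C → e.Ok C s
  | reg r, h, hC => (eval_lt_pow (e := reg r) hX hs h).trans_le hC
  | const c, h, hC => (eval_lt_pow (e := const c) hX hs h).trans_le hC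
  | bin o e e', h, hC => by
    have h0 := (eval_lt_pow hX hs h).trans_le hC
    simp only [good, Bool.and_eq_true] at h
    rw [deg] at hC
    exact ⟨ok_of_good hX hs h.1.2 ((Nat.pow_le_pow_right (by omega) (by omega)).trans hC),
      ok_of_good hX hs h.2 ((Nat.pow_le_pow_right (by omega) (by omega)).trans hC), h0⟩
  | inp e, h, hC => ⟨ok_of_good (e := e) hX hs h hC,
      (eval_lt_pow (e := inp e) hX hs h).trans_le hC⟩
  | mem e, h, hC => ⟨ok_of_good (e := e) hX hs h hC,
      (eval_lt_pow (e := mem e) hX hs h).trans_le hC⟩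
  | ite e e' e'', h, hC => by
    simp only [good, Bool.and_eq_true] at h
    rw [deg] at hC
    have hp : ∀ k, k ≤ e.deg + e'.deg + e''.deg → X ^ k ≤ C := fun k hk =>
      (Nat.pow_le_pow_right (by omega) hk).trans hC
    exact ⟨ok_of_good hX hs h.1.1 (hp _ (by omega)),
      fun _ => ok_of_good hX hs h.1.2 (hp _ (by omega)),
      fun _ => ok_of_good hX hs h.2 (hp _ (by omega))⟩

end Expr

end RAM

/-! ### The online algorithm -/

namespace OMv

open RAM RAM.Expr PathCount

/-- Registers of the online algorithm: size of the blocks, length of the memory segments, number of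
blocks in a row, loop counter, size of the matrix. -/
def rM : ℕ := 4
def rStride : ℕ := 5
def rSide : ℕ := 6
def rId : ℕ := 7
def rN : ℕ := 8

def blockRow : Expr := reg rId / reg rSide
def blockCol : Expr := reg rId % reg rSide

/-- The entry `(y, x)` of the current block of the matrix in the input. -/
def entryExpr (y x : Expr) : Expr :=
  ite (lt (blockRow * reg rM + y) (reg rN)) (ite (lt (blockCol * reg rM + x) (reg rN))
    (inp ((blockRow * reg rM + y) * reg rN + (blockCol * reg rM + x) + 1)) 0) 0

def gapExpr (y x : Expr) : Expr :=
  ite (lt y (reg rM)) (ite x (ite (entryExpr y (x - 1)) 0 1) 0) 0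

def extraExpr (y x : Expr) : Expr :=
  ite (lt y (reg rM)) (1 + gapExpr y x - gapExpr (y + 1) x)
    (ite (eq y (reg rM)) (ite x 1 0) 1)

def sizeExpr : Expr := 2 * (reg rM + 1) * (reg rM + 1)

def depthExpr (y : Expr) : Expr := Expr.min y (2 * (reg rM + 1) - 1 - y)

/-- The weight of the edge between two vertices, or `0`. -/
def weightExpr (y x y' x' : Expr) : Expr :=
  ite (eq y y') (ite (eq (x + 1) x' + eq (x' + 1) x)
      (4 * (reg rM + 1) * (depthExpr y + 1)) 0)
    (ite (eq x x') (ite (eq (y + 1) y' + eq (y' + 1) y)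
      (8 * (reg rM + 1).pow 3 + extraExpr (Expr.min y y') x) 0) 0)

def posExpr : Expr := reg rAddr - 1

/-- The input of the oracle for the current block. -/
def graphExpr : Expr :=
  ite (reg rAddr) (ite (lt posExpr (sizeExpr * sizeExpr))
    (weightExpr (posExpr / sizeExpr / (reg rM + 1)) (posExpr / sizeExpr % (reg rM + 1))
      (posExpr % sizeExpr / (reg rM + 1)) (posExpr % sizeExpr % (reg rM + 1))) 0) sizeExpr

/-- The matrix, extended by `false`. -/
def pad {N : ℕ} (M : Fin N → Fin N → Bool) (y x : ℕ) : Bool :=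
  if h : y < N ∧ x < N then M ⟨y, h.1⟩ ⟨x, h.2⟩ else false

/-- The vector, extended by `false`. -/
def padVec {N : ℕ} (v : Fin N → Bool) (x : ℕ) : Bool :=
  if h : x < N then v ⟨x, h⟩ else false

/-- Block number `i` of the matrix, for blocks of size `m` and `b` blocks in a row. -/
def block {N : ℕ} (M : Fin N → Fin N → Bool) (m b i : ℕ) (y x : ℕ) : Bool :=
  pad M (i / b * m + y) (i % b * m + x)

/-- The part of the vector that meets block number `i` of the matrix. -/
def blockVec {N : ℕ} (v : Fin N → Bool) (m b i : ℕ) (x : ℕ) : Bool :=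
  padVec v (i % b * m + x)

theorem indicator_ne_zero (p : Prop) [Decidable p] : (if p then 1 else 0 : ℕ) ≠ 0 ↔ p := by
  split_ifs <;> simp_all

theorem indicator_add_ne_zero (p q : Prop) [Decidable p] [Decidable q] :
    (if p then 1 else 0 : ℕ) + (if q then 1 else 0) ≠ 0 ↔ p ∨ q := by
  split_ifs <;> simp_all

theorem tableInput_entry {N : ℕ} (M : Fin N → Fin N → Bool) {y x : ℕ} (hy : y < N) (hx : x < N) :
    tableInput N (fun i j => (M i j).toNat) (y * N + x + 1) = (pad M y x).toNat := by
  have h : y * N + x < N * N := by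
    calc y * N + x < y * N + N := by omega
      _ = (y + 1) * N := by ring
      _ ≤ N * N := Nat.mul_le_mul_right _ hy
  have h1 : (y * N + x) / N = y := by
    rw [Nat.add_comm, Nat.add_mul_div_right _ _ (by omega), Nat.div_eq_of_lt hx, Nat.zero_add]
  have h2 : (y * N + x) % N = x := by
    rw [Nat.mul_comm, Nat.mul_add_mod, Nat.mod_eq_of_lt hx]
  rw [tableInput, dif_pos h, pad, dif_pos ⟨hy, hx⟩]
  congr 2 <;> exact Fin.ext (by assumption)

/-- The registers that stay the same after the first phase of the algorithm. -/
structure Setup (N m b stride : ℕ) (S : State) : Prop where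
  size : S.reg rN = N
  m : S.reg rM = m
  side : S.reg rSide = b
  stride : S.reg rStride = stride

section

variable {N m b stride : ℕ} {S : State} {M : Fin N → Fin N → Bool}

theorem eval_entryExpr (hS : Setup N m b stride S)
    (hi : S.inp = tableInput N fun i j => (M i j).toNat) (y x : Expr) :
    (entryExpr y x).eval S = (block M m b (S.reg rId) (y.eval S) (x.eval S)).toNat := by
  simp only [entryExpr, blockRow, blockCol, eval_ite, eval_lt_expr, eval_add, eval_mul, eval_div,
    eval_mod, eval_reg, eval_ofNat, eval_inp, hS.size, hS.m, hS.side, hi, block, indicator_ne_zero]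
  split_ifs with h1 h2
  · exact tableInput_entry M h1 h2
  all_goals (rw [pad, dif_neg (by omega)]; rfl)

theorem eval_gapExpr (hS : Setup N m b stride S)
    (hi : S.inp = tableInput N fun i j => (M i j).toNat) (y x : Expr) :
    (gapExpr y x).eval S = Grid.gap m (block M m b (S.reg rId)) (y.eval S) (x.eval S) := by
  simp only [gapExpr, eval_ite, eval_lt_expr, eval_reg, eval_ofNat, eval_entryExpr hS hi,
    eval_sub, hS.m, Grid.gap]
  cases h : block M m b (S.reg rId) (y.eval S) (x.eval S - 1) <;> simp [Nat.pos_iff_ne_zero]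
  split_ifs <;> simp_all

theorem eval_extraExpr (hS : Setup N m b stride S)
    (hi : S.inp = tableInput N fun i j => (M i j).toNat) (y x : Expr) :
    (extraExpr y x).eval S = Grid.extra m (block M m b (S.reg rId))
      (Grid.midAt m (fun _ => false) 0) (y.eval S) (x.eval S) := by
  simp only [extraExpr, eval_ite, eval_lt_expr, eval_eq_expr, eval_reg, eval_ofNat,
    eval_gapExpr hS hi, eval_sub, eval_add, hS.m, Grid.extra, Grid.midAt]
  split_ifs <;> first | rfl | omega

/-- The adjacency matrix of a block has constant-time computable entries. Vertices are numbered row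
by row, so rows and columns of both end points are quotients and remainders of the input address. -/
theorem eval_graphExpr (hS : Setup N m b stride S)
    (hi : S.inp = tableInput N fun i j => (M i j).toNat) :
    graphExpr.eval S = graphInput (Grid.graph (2 * (m + 1)) (m + 1))
      (Grid.start m (block M m b (S.reg rId))) (S.reg rAddr) := by
  classical
  have hn : sizeExpr.eval S = 2 * (m + 1) * (m + 1) := by simp [sizeExpr, hS.m]
  have hp : posExpr.eval S = S.reg rAddr - 1 := rfl
  simp only [graphExpr, eval_ite, eval_lt_expr, hn, hp, eval_reg, eval_mul, weightExpr,
    eval_eq_expr, eval_add, eval_ofNat, eval_pow, hS.m, depthExpr, eval_min, eval_sub, eval_div,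
    eval_mod, eval_extraExpr hS hi, indicator_ne_zero, indicator_add_ne_zero]
  unfold graphInput
  rcases hA : S.reg rAddr with _ | q
  · simp [tableInput]
  · simp only [Nat.add_sub_cancel, tableInput]
    rw [if_pos (Nat.succ_ne_zero q)]
    by_cases hq : q < 2 * (m + 1) * (m + 1) * (2 * (m + 1) * (m + 1))
    · rw [if_pos hq, dif_pos hq]
      have h1 : Grid.row (Fin.divNat ⟨q, hq⟩) = q / (2 * (m + 1) * (m + 1)) / (m + 1) := rfl
      have h2 : Grid.col (Fin.divNat ⟨q, hq⟩) = q / (2 * (m + 1) * (m + 1)) % (m + 1) := rfl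
      have h3 : Grid.row (Fin.modNat ⟨q, hq⟩) = q % (2 * (m + 1) * (m + 1)) / (m + 1) := rfl
      have h4 : Grid.col (Fin.modNat ⟨q, hq⟩) = q % (2 * (m + 1) * (m + 1)) % (m + 1) := rfl
      have hw : Grid.start m (block M m b (S.reg rId)) s(Fin.divNat ⟨q, hq⟩, Fin.modNat ⟨q, hq⟩) =
        Grid.startWeight m (block M m b (S.reg rId)) (Fin.divNat ⟨q, hq⟩) (Fin.modNat ⟨q, hq⟩) := rfl
      simp only [hw, Grid.adj_iff, Grid.startWeight, Grid.depth, h1, h2, h3, h4]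
      split_ifs <;> first | rfl | omega
    · rw [if_neg hq, dif_neg hq]

end

end OMv

/-! ### The programs of the online algorithm -/

namespace OMv

open RAM RAM.Expr PathCount

/-- Registers: the counter of the operations for a vector, and the number of the current operation
for the current block. -/
def rZ : ℕ := 9
def rOp : ℕ := 10

/-- The input array that consists of three words. -/
def pickExpr (e e' e'' : Expr) : Expr :=
  ite (reg rAddr) (ite (eq (reg rAddr) 1) e' (ite (eq (reg rAddr) 2) e'' 0)) e

/-- The input of the oracle for the current operation. -/
def opExpr : Expr :=
  ite (lt (reg rOp) (reg rM))
    (pickExpr (reg rM * (reg rM + 1) + (reg rOp + 1)) ((reg rM + 1) * (reg rM + 1) + (reg rOp + 1))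
      (8 * (reg rM + 1).pow 3 + (2 - 2 * inp (blockCol * reg rM + reg rOp))))
    (ite (lt (reg rOp) (2 * reg rM))
      (pickExpr ((reg rOp - reg rM) * (reg rM + 1))
        ((2 * reg rM + 1 - (reg rOp - reg rM)) * (reg rM + 1) + reg rM) 0)
      (pickExpr (reg rM * (reg rM + 1) + (reg rOp - 2 * reg rM + 1))
        ((reg rM + 1) * (reg rM + 1) + (reg rOp - 2 * reg rM + 1))
        (8 * (reg rM + 1).pow 3 + 1)))

/-- The words that an oracle receives for an operation. -/
def opInput {n : ℕ} : Operation n → List ℕ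
  | .query a b => [a, b]
  | .update a b x => [a, b, x]

/-- Reading beyond the end gives 0, so queries and updates can share the three-word `pickExpr`. -/
theorem listInput_two (x y : ℕ) : listInput [x, y] = listInput [x, y, 0] := by
  funext a
  rcases a with _ | _ | _ | a <;> simp [listInput]

theorem eval_pickExpr (S : State) (e e' e'' : Expr) : (pickExpr e e' e'').eval S =
    listInput [e.eval S, e'.eval S, e''.eval S] (S.reg rAddr) := by
  rcases h : S.reg rAddr with _ | _ | _ | a <;> simp [pickExpr, listInput, h]

theorem listInput_ofFn {N : ℕ} (v : Fin N → Bool) (a : ℕ) :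
    listInput (List.ofFn fun j => (v j).toNat) a = (padVec v a).toNat := by
  unfold listInput padVec
  split_ifs with h
  · simp [List.getD, h]
  · rw [List.getD_eq_default _ _ (by simpa using h)]; rfl

theorem eval_opExpr {N m b stride o : ℕ} {S : State} (hS : Setup N m b stride S) {v : Fin N → Bool}
    (hi : S.inp = listInput (List.ofFn fun j => (v j).toNat)) (ho : S.reg rOp = o)
    (hlt : o < 3 * m) : opExpr.eval S =
      listInput (opInput (Grid.opAt m (blockVec v m b (S.reg rId)) o)) (S.reg rAddr) := by
  simp only [opExpr, eval_ite, eval_lt_expr, eval_pickExpr, eval_reg, eval_add, eval_mul, eval_sub,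
    eval_ofNat, eval_inp, eval_pow, ho, hS.m, indicator_ne_zero, Grid.opAt]
  split_ifs with h1 h2
  · simp only [opInput]
    rw [Grid.val_vert (by omega) (by omega), Grid.val_vert (by omega) (by omega), hi,
      listInput_ofFn]
    simp only [blockCol, eval_mod, eval_reg, hS.side]
    rfl
  · simp only [opInput]
    rw [Grid.val_vert (by omega) (by omega), Grid.val_vert (by omega) (by omega), listInput_two]
    rfl
  · simp only [opInput]
    rw [Grid.val_vert (by omega) (by omega), Grid.val_vert (by omega) (by omega)]

/-- This test drives the search for the largest `m` with `m ^ K ≤ N`. The stride defined next leaves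
room in a segment for `R` registers and for a memory of as many cells as the oracle has words. -/
def growExpr (K : ℕ) : Expr := lt ((reg rM + 1).pow K) (reg rN + 1)
def strideExpr (R c : ℕ) : Expr := const R + (sizeExpr + 2).pow c
def sideExpr : Expr := reg rN / reg rM + 1
def moreBlocksExpr : Expr := lt (reg rId) (reg rSide * reg rSide)
def baseExpr : Expr := reg rId * reg rStride
def moreOpsExpr : Expr := lt (reg rZ) (reg rSide * reg rSide * (3 * reg rM))
def idExpr : Expr := reg rZ / (3 * reg rM)
def opNumberExpr : Expr := reg rZ % (3 * reg rM)
def isQueryExpr : Expr := ite (lt (reg rOp) (reg rM)) 0 (lt (reg rOp) (2 * reg rM))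
def rowExpr : Expr := blockRow * reg rM + (reg rOp - reg rM)

/-- The expressions that occur in the programs. -/
def exprs (R c K : ℕ) : List Expr :=
  [inp 0, growExpr K, reg rM + 1, strideExpr R c, sideExpr, moreBlocksExpr, baseExpr, 0, graphExpr,
    reg rId + 1, moreOpsExpr, idExpr, opNumberExpr, opExpr, isQueryExpr, lt 1 (reg rOut), rowExpr,
    1, reg rZ + 1]

/-- Preparation of the oracle for one block. -/
def blockProg (R : ℕ) (A : Oracle) : Prog :=
  .seq (assign rBase baseExpr) (.seq (assign rOut 0) (.seq (simulate R graphExpr A.prepare)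
    (assign rId (reg rId + 1))))

/-- Determine the size and the number of the blocks. -/
def sizesProg (R c K : ℕ) : Prog :=
  .seq (assign rN (inp 0)) (.seq (loop rTest (assign rTest (growExpr K)) (assign rM (reg rM + 1)))
    (.seq (assign rStride (strideExpr R c)) (assign rSide sideExpr)))

/-- Answer one query or perform one update for one of the blocks. -/
def oracleProg (R : ℕ) (A : Oracle) : Prog :=
  .ifnz rTest (.seq (simulate R opExpr A.answer) (.seq (assign rTest (lt 1 (reg rOut)))
    (.ifnz rTest (setOut rowExpr 1) .skip))) (simulate R opExpr A.change)

/-- A single counter `rZ` runs through all operations for a vector; its quotient by `3 * m` is the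
block and its remainder the operation within that block. -/
def opProg (R : ℕ) (A : Oracle) : Prog :=
  .seq (assign rId idExpr) (.seq (assign rOp opNumberExpr) (.seq (assign rBase baseExpr)
    (.seq (assign rOut 0) (.seq (assign rTest isQueryExpr) (.seq (oracleProg R A)
      (assign rZ (reg rZ + 1)))))))

/-- The online algorithm that cuts the matrix into blocks, with an oracle for each of them. -/
def algorithm (R c K : ℕ) (A : Oracle) : Algorithm where
  prepare := .seq (sizesProg R c K) (loop rTest (assign rTest moreBlocksExpr) (blockProg R A))
  answer := .seq (assign rZ 0) (loop rTest (assign rTest moreOpsExpr) (opProg R A))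

theorem good_of_mem {R c K : ℕ} : ∀ e ∈ exprs R c K, e.good = true := by
  have h1 : (growExpr K).good = true := by
    change (BinOp.lt.arith && ((reg rM + 1).pow K).good && (reg rN + 1).good) = true
    rw [good_pow rfl]; rfl
  have h2 : (strideExpr R c).good = true := by
    change (BinOp.add.arith && (const R).good && ((sizeExpr + 2).pow c).good) = true
    rw [good_pow rfl]; rfl
  have h3 : graphExpr.good = true := by decide +kernel
  have h4 : opExpr.good = true := by decide +kernel
  simp only [exprs, List.forall_mem_cons, List.not_mem_nil, IsEmpty.forall_iff, implies_true,
    and_true, h1, h2, h3, h4, true_and]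
  decide

/-- An upper bound for the slow-down. -/
def slow (R c K : ℕ) : ℕ := ((exprs R c K).map cost).sum + 20

theorem cost_le {R c K : ℕ} {e : Expr} (he : e ∈ exprs R c K) : 20 + e.cost ≤ slow R c K := by
  have := List.single_le_sum (l := (exprs R c K).map cost) (by simp) _ (List.mem_map_of_mem he)
  unfold slow; omega

/-- Registers 4, 5, 6 and 8 hold the parameters; all others may be overwritten. -/
theorem Setup.setReg {N m b stride : ℕ} {S : State} (h : Setup N m b stride S) {r : ℕ}
    (hr : r < 4 ∨ r = 7 ∨ 9 ≤ r) (x : ℕ) : Setup N m b stride (S.setReg r x) := by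
  constructor
  · rw [State.setReg_reg, if_neg, h.size]; unfold rN; omega
  · rw [State.setReg_reg, if_neg, h.m]; unfold rM; omega
  · rw [State.setReg_reg, if_neg, h.side]; unfold rSide; omega
  · rw [State.setReg_reg, if_neg, h.stride]; unfold rStride; omega

theorem Setup.frame {N m b stride base len : ℕ} {S S' : State} (h : Setup N m b stride S)
    (hf : S.Frame base len S') : Setup N m b stride S' := by
  constructor
  · rw [hf.reg _ (by decide) (by decide) (by decide), h.size]
  · rw [hf.reg _ (by decide) (by decide) (by decide), h.m]
  · rw [hf.reg _ (by decide) (by decide) (by decide), h.side]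
  · rw [hf.reg _ (by decide) (by decide) (by decide), h.stride]

/-- Constants of the algorithm and parameters of the input: `X` bounds the words between the
steps, `C` the intermediate results. -/
structure Params (R c K N m b X C : ℕ) : Prop where
  pow_le : m ^ K ≤ N
  lt_pow : N < (m + 1) ^ K
  K_pos : 0 < K
  side : b = N / m + 1
  two_le : 2 ≤ X
  size_lt : N < X
  stride_lt : R + wordBound c (2 * (m + 1) * (m + 1)) < X
  segments_lt : b * b * (R + wordBound c (2 * (m + 1) * (m + 1))) < X
  ops_lt : b * b * (3 * m) < X
  pow_deg_le : ∀ e ∈ exprs R c K, X ^ e.deg ≤ C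

section

variable {R c K N m b X C : ℕ}

theorem Params.m_le (hP : Params R c K N m b X C) : m ≤ N :=
  (Nat.le_self_pow hP.K_pos.ne' m).trans hP.pow_le

theorem Params.X_le (hP : Params R c K N m b X C) : X ≤ C := by
  have : X ^ (0 : Expr).deg ≤ C := hP.pow_deg_le 0 (by simp [exprs])
  simpa [deg] using this

theorem Params.ok (hP : Params R c K N m b X C) {S : State} (hS : S.Small X) {e : Expr}
    (he : e ∈ exprs R c K) : e.Ok C S :=
  ok_of_good hP.two_le hS (good_of_mem e he) (hP.pow_deg_le e he)

theorem Params.assign (hP : Params R c K N m b X C) {S : State} (hS : S.Small X) (x : ℕ) {e : Expr}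
    (he : e ∈ exprs R c K) : Run C (assign x e) S (slow R c K) (S.setReg x (e.eval S)) :=
  (Run.assign x (below_of_good (good_of_mem e he)) (hP.ok hS he)).mono
    (by have := cost_le he; omega)

/-- The number `τ` in the invariant is the remaining time budget. Single iterations have no useful
uniform bound, because the oracle's costs are only controlled in total; each iteration pays from the
budget. -/
theorem run_loop_count {r : ℕ} {p p' : Prog} (hr : r < tmp) (L : ℕ) (Inv : ℕ → State → ℕ → Prop)
    (Post : State → ℕ → Prop)
    (step : ∀ z S τ, z < L → Inv z S τ → ∃ S₁ t₁ S₂ t₂ τ', Run C p S t₁ S₁ ∧ S₁.reg r ≠ 0 ∧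
      Run C p' S₁ t₂ S₂ ∧ Inv (z + 1) S₂ τ' ∧ t₁ + t₂ + 1 + τ' ≤ τ)
    (fin : ∀ S τ, Inv L S τ → ∃ S₁ t₁ τ', Run C p S t₁ S₁ ∧ S₁.reg r = 0 ∧ Post S₁ τ' ∧
      t₁ + 1 + τ' ≤ τ) (k : ℕ) :
    ∀ z S τ, z + k = L → Inv z S τ →
      ∃ S' t τ', Run C (loop r p p') S t S' ∧ Post S' τ' ∧ t + τ' ≤ τ := by
  induction k with
  | zero =>
    intro z S τ hz hI
    have hz : z = L := hz
    obtain ⟨S₁, t₁, τ', h1, h2, h3, h4⟩ := fin S τ (hz ▸ hI)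
    exact ⟨S₁, _, τ', h1.loop_done hr h2, h3, h4⟩
  | succ k ih =>
    intro z S τ hz hI
    obtain ⟨S₁, t₁, S₂, t₂, τ', h1, h2, h3, h4, h5⟩ := step z S τ (by omega) hI
    obtain ⟨S', t, τ'', h6, h7, h8⟩ := ih (z + 1) S₂ τ' (by omega) h4
    exact ⟨S', _, τ'', h1.loop_step hr h2 h3 h6, h7, by omega⟩

theorem Params.sizes_run (hP : Params R c K N m b X C) {S : State} (hS : S.Small X)
    (hr : ∀ r, S.reg r = 0) (hN : S.inp 0 = N) :
    ∃ S', Run C (sizesProg R c K) S ((2 * m + 5) * slow R c K + m + 1) S' ∧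
      Setup N m b (R + wordBound c (2 * (m + 1) * (m + 1))) S' ∧ S'.Small X ∧
      S'.reg rId = 0 ∧ S'.inp = S.inp ∧ S'.mem = S.mem := by
  have h1 := hP.assign hS rN (e := inp 0) (by simp [exprs])
  have hv : (inp 0 : Expr).eval S = N := by simpa using hN
  rw [hv] at h1
  have hS1 := hS.setReg rN hP.size_lt
  obtain ⟨S2, t, τ', h2, ⟨h3, h4, h5, h6, h7, h8⟩, h9⟩ := run_loop_count (C := C) (r := rTest)
    (p := RAM.assign rTest (growExpr K)) (p' := RAM.assign rM (reg rM + 1)) (by decide) m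
    (fun z S' τ => S'.Small X ∧ S'.reg rN = N ∧ S'.reg rM = z ∧ S'.reg rId = 0 ∧ S'.inp = S.inp ∧
      S'.mem = S.mem ∧ (m - z) * (2 * slow R c K + 1) + slow R c K + 1 ≤ τ)
    (fun S' τ => S'.Small X ∧ S'.reg rN = N ∧ S'.reg rM = m ∧ S'.reg rId = 0 ∧ S'.inp = S.inp ∧
      S'.mem = S.mem)
    (by
      rintro z S' τ hz ⟨i1, i2, i3, i4, i5, i6, i7⟩
      have e1 : (growExpr K).eval S' = 1 := by
        have : (z + 1) ^ K ≤ N := (Nat.pow_le_pow_left hz K).trans hP.pow_le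
        simp only [growExpr, eval_lt_expr, eval_pow, eval_add, eval_reg, eval_ofNat, i2, i3]
        rw [if_pos (by omega)]
      have r1 := hP.assign i1 rTest (e := growExpr K) (by simp [exprs])
      rw [e1] at r1
      have i1' := i1.setReg rTest (x := 1) hP.two_le
      have r2 := hP.assign i1' rM (e := reg rM + 1) (by simp [exprs])
      have e2 : (reg rM + 1 : Expr).eval (S'.setReg rTest 1) = z + 1 := by
        simp [State.setReg_reg, rM, rTest] at i3 ⊢; exact i3
      rw [e2] at r2
      have := hP.m_le
      have := hP.size_lt
      refine ⟨_, _, _, _, (m - (z + 1)) * (2 * slow R c K + 1) + slow R c K + 1, r1,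
        by simp [State.setReg_reg], r2, ⟨i1'.setReg rM (by omega), ?_, ?_, ?_, i5, i6, le_rfl⟩, ?_⟩
      · simpa [State.setReg_reg, rM, rTest, rN] using i2
      · simp [State.setReg_reg]
      · simpa [State.setReg_reg, rM, rTest, rId] using i4
      · have : m - z = (m - (z + 1)) + 1 := by omega
        rw [this, Nat.add_mul] at i7
        omega)
    (by
      rintro S' τ ⟨i1, i2, i3, i4, i5, i6, i7⟩
      have e1 : (growExpr K).eval S' = 0 := by
        have := hP.lt_pow
        simp only [growExpr, eval_lt_expr, eval_pow, eval_add, eval_reg, eval_ofNat, i2, i3]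
        rw [if_neg (by omega)]
      have r1 := hP.assign i1 rTest (e := growExpr K) (by simp [exprs])
      rw [e1] at r1
      refine ⟨_, _, 0, r1, by simp [State.setReg_reg],
        ⟨i1.setReg rTest (by have := hP.two_le; omega), ?_, ?_, ?_, i5, i6⟩, by omega⟩
      · simpa [State.setReg_reg, rTest, rN] using i2
      · simpa [State.setReg_reg, rTest, rM] using i3
      · simpa [State.setReg_reg, rTest, rId] using i4)
    m 0 (S.setReg rN N) ((2 * m + 1) * slow R c K + m + 1) (Nat.zero_add m)
    ⟨hS1, by simp [State.setReg_reg], by simp [State.setReg_reg, hr, rM, rN],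
      by simp [State.setReg_reg, hr, rId, rN], rfl, rfl, by
        rw [Nat.sub_zero]; apply le_of_eq; ring⟩
  have e3 : (strideExpr R c).eval S2 = R + wordBound c (2 * (m + 1) * (m + 1)) := by
    simp only [strideExpr, sizeExpr, eval_add, eval_pow, eval_mul, eval_const, eval_ofNat, eval_reg,
      h5, wordBound]
  have r3 := hP.assign h3 rStride (e := strideExpr R c) (by simp [exprs])
  rw [e3] at r3
  have h3' := h3.setReg rStride hP.stride_lt
  have e4 : sideExpr.eval (S2.setReg rStride (R + wordBound c (2 * (m + 1) * (m + 1)))) = b := by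
    rw [hP.side]
    simp only [sideExpr, eval_add, eval_div, eval_ofNat, eval_reg]
    simp [State.setReg_reg, rN, rM, rStride] at h4 h5 ⊢
    rw [h4, h5]
  have r4 := hP.assign h3' rSide (e := sideExpr) (by simp [exprs])
  rw [e4] at r4
  have hb : b < X := by
    have h10 := hP.segments_lt
    have h11 := hP.side
    have : 1 ≤ R + wordBound c (2 * (m + 1) * (m + 1)) := by
      have : 0 < wordBound c (2 * (m + 1) * (m + 1)) := Nat.pow_pos (by omega)
      omega
    calc b ≤ b * b := Nat.le_mul_of_pos_left _ (h11 ▸ Nat.succ_pos _)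
      _ ≤ _ := Nat.le_mul_of_pos_right _ this
      _ < X := h10
  refine ⟨_, (h1.seq (h2.seq (r3.seq r4))).mono ?_, ⟨?_, ?_, ?_, ?_⟩, h3'.setReg rSide hb, ?_,
    h7, h8⟩
  · have : (2 * m + 5) * slow R c K = (2 * m + 1) * slow R c K + 4 * slow R c K := by ring
    omega
  · simpa [State.setReg_reg, rSide, rStride, rN] using h4
  · simpa [State.setReg_reg, rSide, rStride, rM] using h5
  · simp [State.setReg_reg]
  · simp [State.setReg_reg, rSide, rStride]
  · simpa [State.setReg_reg, rSide, rStride, rId] using h6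

end

end OMv

/-! ### Preparing an oracle for every block -/

namespace OMv

open RAM RAM.Expr PathCount

section

variable {R c K N m b X C : ℕ}

theorem Holds.congr {B base : ℕ} {s S S' : State} (h : Holds B R base s S)
    (hm : ∀ a, base ≤ a → a < base + (R + B) → S'.mem a = S.mem a) : Holds B R base s S' :=
  ⟨fun r hr => by rw [hm _ (by omega) (by omega), h.reg r hr],
    fun a ha => by rw [hm _ (by omega) (by omega), h.mem a ha], h.bound⟩

/-- Segments of different blocks are disjoint, so simulating one oracle leaves the others intact. -/
theorem Holds.of_frame {B i i' : ℕ} {s S S' : State} (h : Holds B R (i * (R + B)) s S)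
    (hf : S.Frame (i' * (R + B)) (R + B) S') (hi : i ≠ i') : Holds B R (i * (R + B)) s S' := by
  refine Holds.congr h fun a h1 h2 => hf.mem a ?_
  rcases Nat.lt_or_gt_of_ne hi with h3 | h3
  · have := Nat.mul_le_mul_right (R + B) (Nat.succ_le_of_lt h3)
    rw [Nat.succ_mul] at this
    omega
  · have := Nat.mul_le_mul_right (R + B) (Nat.succ_le_of_lt h3)
    rw [Nat.succ_mul] at this
    omega

/-- Untouched memory is zero, so a fresh segment already holds an initial state and needs no
initialization. -/
theorem holds_initial {B base : ℕ} (hB : 0 < B) {S : State} (x : ℕ → ℕ)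
    (hm : ∀ a, base ≤ a → S.mem a = 0) : Holds B R base (State.initial x) S :=
  ⟨fun r _ => hm _ (by omega), fun a _ => hm _ (by omega), fun _ => hB⟩

theorem Params.base_lt (hP : Params R c K N m b X C) {i : ℕ} (hi : i < b * b) :
    i * (R + wordBound c (2 * (m + 1) * (m + 1))) + R + wordBound c (2 * (m + 1) * (m + 1)) ≤ X := by
  have h1 := Nat.mul_le_mul_right (R + wordBound c (2 * (m + 1) * (m + 1))) (Nat.succ_le_of_lt hi)
  rw [Nat.succ_mul] at h1
  have := hP.segments_lt
  omega

theorem Params.blocks_run (hP : Params R c K N m b X C) {A : Oracle} (hA : A.prepare.UsesBelow R)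
    {M : Fin N → Fin N → Bool} {t₀ : ℕ → ℕ} {s₀ : ℕ → State}
    (hE : ∀ i < b * b, Exec (wordBound c (2 * (m + 1) * (m + 1))) A.prepare
      (State.initial (graphInput (Grid.graph (2 * (m + 1)) (m + 1)) (Grid.start m (block M m b i))))
      (t₀ i) (s₀ i)) {S : State}
    (h1 : Setup N m b (R + wordBound c (2 * (m + 1) * (m + 1))) S) (h2 : S.Small X)
    (h3 : S.reg rId = 0) (h4 : S.inp = tableInput N fun i j => (M i j).toNat)
    (h5 : ∀ a, S.mem a = 0) :
    ∃ S' t, Run C (loop rTest (RAM.assign rTest moreBlocksExpr) (blockProg R A)) S t S' ∧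
      t ≤ slow R c K * (∑ i ∈ Finset.range (b * b), t₀ i) + b * b * (5 * slow R c K) +
        2 * slow R c K ∧
      Setup N m b (R + wordBound c (2 * (m + 1) * (m + 1))) S' ∧ S'.Small X ∧
      ∀ i < b * b, Holds (wordBound c (2 * (m + 1) * (m + 1))) R
        (i * (R + wordBound c (2 * (m + 1) * (m + 1)))) (s₀ i) S' := by
  have hslow : 20 ≤ slow R c K := Nat.le_add_left _ _
  have hB : 0 < wordBound c (2 * (m + 1) * (m + 1)) := Nat.pow_pos (by omega)
  have hbase := fun i hi => hP.base_lt (i := i) hi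
  have hseg := hP.segments_lt
  generalize wordBound c (2 * (m + 1) * (m + 1)) = B at *
  have hX2 := hP.two_le
  obtain ⟨S', t, τ', g1, ⟨g2, g3, g4⟩, g5⟩ := run_loop_count (C := C) (r := rTest)
    -- Invariant: the segments of the blocks before `z` hold prepared oracles, and the memory from
    -- segment `z` on is still zero.
    (p := RAM.assign rTest moreBlocksExpr) (p' := blockProg R A) (by decide) (b * b)
    (fun z S' τ => Setup N m b (R + B) S' ∧ S'.Small X ∧ S'.reg rId = z ∧ S'.inp = S.inp ∧
      (∀ i < z, Holds B R (i * (R + B)) (s₀ i) S') ∧ (∀ a, z * (R + B) ≤ a → S'.mem a = 0) ∧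
      slow R c K * (∑ i ∈ Finset.Ico z (b * b), t₀ i) + (b * b - z) * (5 * slow R c K) +
        2 * slow R c K ≤ τ)
    (fun S' _ => Setup N m b (R + B) S' ∧ S'.Small X ∧
      ∀ i < b * b, Holds B R (i * (R + B)) (s₀ i) S')
    (by
      rintro z S1 τ hz ⟨i1, i2, i3, i4, i5, i6, i7⟩
      have e1 : moreBlocksExpr.eval S1 = 1 := by
        simp only [moreBlocksExpr, eval_lt_expr, eval_mul, eval_reg, i3, i1.side]
        rw [if_pos hz]
      have r1 := hP.assign i2 rTest (e := moreBlocksExpr) (by simp [exprs])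
      rw [e1] at r1
      have j1 := i1.setReg (r := rTest) (by decide) 1
      have j2 := i2.setReg rTest (x := 1) (by omega)
      have e2 : baseExpr.eval (S1.setReg rTest 1) = z * (R + B) := by
        simp only [baseExpr, eval_mul, eval_reg, j1.stride]
        rw [State.setReg_reg, if_neg (by decide), i3]
      have r2 := hP.assign j2 rBase (e := baseExpr) (by simp [exprs])
      rw [e2] at r2
      have hb := hbase z hz
      have k1 := j1.setReg (r := rBase) (by decide) (z * (R + B))
      have k2 := j2.setReg rBase (x := z * (R + B)) (by omega)
      have r3 := hP.assign k2 rOut (e := 0) (by simp [exprs])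
      have l1 := k1.setReg (r := rOut) (by decide) 0
      have l2 := k2.setReg rOut (x := 0) (by omega)
      rw [eval_ofNat] at r3
      change Run C _ _ _ (((S1.setReg rTest 1).setReg rBase (z * (R + B))).setReg rOut 0) at r3
      generalize hS2 : ((S1.setReg rTest 1).setReg rBase (z * (R + B))).setReg rOut 0 = S2 at *
      have hmem : S2.mem = S1.mem := by rw [← hS2]; rfl
      have hinp : S2.inp = S1.inp := by rw [← hS2]; rfl
      have hid : S2.reg rId = z := by
        rw [← hS2]
        simpa [State.setReg_reg, rOut, rBase, rTest, rId] using i3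
      have hbs : S2.reg rBase = z * (R + B) := by
        rw [← hS2]
        simp [State.setReg_reg, rOut, rBase]
      have hout : S2.reg rOut = 0 := by
        rw [← hS2]
        simp [State.setReg_reg, rOut]
      obtain ⟨S3, q1, q2, -⟩ := simulate_run (C := C) (e := graphExpr) (S₀ := S2) hb hP.X_le hbs
        (below_of_good (good_of_mem (R := R) (c := c) (K := K) graphExpr (by simp [exprs])))
        (fun S' hs hf _ => ⟨hP.ok hs (by simp [exprs]), by
          rw [eval_graphExpr (l1.frame hf) (M := M) (by rw [hf.inp, hinp, i4, h4]),
            hf.reg rId (by decide) (by decide) (by decide), hid]; rfl⟩)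
        (hE z hz) hA rfl S2
        ⟨holds_initial hB _ (fun a ha => by rw [hmem]; exact i6 a ha), l2, hout, .refl _ _ _⟩
      have n1 := l1.frame q2.frame
      have r4 := hP.assign q2.small rId (e := reg rId + 1) (by simp [exprs])
      have e4 : (reg rId + 1 : Expr).eval S3 = z + 1 := by
        change S3.reg rId + 1 = z + 1
        rw [q2.frame.reg rId (by decide) (by decide) (by decide), hid]
      rw [e4] at r4
      have hz' : z + 1 < X := by
        have h7 : b * b ≤ b * b * (R + B) := Nat.le_mul_of_pos_right _ (by omega)
        omega
      refine ⟨_, _, _, _, slow R c K * (∑ i ∈ Finset.Ico (z + 1) (b * b), t₀ i) +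
        (b * b - (z + 1)) * (5 * slow R c K) + 2 * slow R c K, r1, by simp [State.setReg_reg],
        r2.seq (r3.seq (q1.seq r4)), ⟨n1.setReg (by decide) _, q2.small.setReg _ hz',
        by simp [State.setReg_reg], ?_, ?_, ?_, le_rfl⟩, ?_⟩
      · exact q2.frame.inp.trans (hinp.trans i4)
      · intro i hi
        rcases Nat.lt_succ_iff_lt_or_eq.1 hi with hi | rfl
        · have h8 : Holds B R (i * (R + B)) (s₀ i) S2 :=
            Holds.congr (i5 i hi) fun a _ _ => by rw [hmem]
          exact Holds.congr (Holds.of_frame h8 q2.frame (by omega)) fun _ _ _ => rfl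
        · exact Holds.congr q2.holds fun _ _ _ => rfl
      · intro a ha
        rw [Nat.add_mul, Nat.one_mul] at ha
        change S3.mem a = 0
        rw [q2.frame.mem a (by omega), hmem]
        exact i6 a (by omega)
      · rw [Finset.sum_eq_sum_Ico_succ_bot hz] at i7
        have h8 : b * b - z = b * b - (z + 1) + 1 := by omega
        have h9 : (20 + graphExpr.cost) * t₀ z ≤ slow R c K * t₀ z :=
          Nat.mul_le_mul_right _ (cost_le (by simp [exprs]))
        rw [h8, Nat.mul_add, Nat.add_mul] at i7
        omega)
    (by
      rintro S1 τ ⟨i1, i2, i3, i4, i5, i6, i7⟩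
      have e1 : moreBlocksExpr.eval S1 = 0 := by
        simp only [moreBlocksExpr, eval_lt_expr, eval_mul, eval_reg, i3, i1.side]
        rw [if_neg (by omega)]
      have r1 := hP.assign i2 rTest (e := moreBlocksExpr) (by simp [exprs])
      rw [e1] at r1
      refine ⟨_, _, 0, r1, by simp [State.setReg_reg], ⟨i1.setReg (by decide) 0,
        i2.setReg rTest (x := 0) (by omega), fun i hi => Holds.congr (i5 i hi) fun _ _ _ => rfl⟩, ?_⟩
      omega)
    (b * b) 0 S (slow R c K * (∑ i ∈ Finset.range (b * b), t₀ i) + b * b * (5 * slow R c K) +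
        2 * slow R c K) (Nat.zero_add _)
    ⟨h1, h2, h3, rfl, fun i hi => absurd hi (Nat.not_lt_zero i), fun a _ => h5 a, by
      rw [Nat.sub_zero, Finset.range_eq_Ico]⟩
  exact ⟨S', t, g1, by omega, g2, g3, g4⟩

theorem tableInput_toNat_lt (hP : Params R c K N m b X C) (M : Fin N → Fin N → Bool) (a : ℕ) :
    tableInput N (fun i j => (M i j).toNat) a < X := by
  have := hP.two_le
  have := hP.size_lt
  rcases a with _ | a
  · simpa [tableInput]
  · rw [tableInput]
    split_ifs
    · have := Bool.toNat_le (M (Fin.divNat ⟨a, by assumption⟩) (Fin.modNat ⟨a, by assumption⟩))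
      omega
    · omega

theorem Params.prepare_run (hP : Params R c K N m b X C) {A : Oracle} (hA : A.prepare.UsesBelow R)
    {M : Fin N → Fin N → Bool} {t₀ : ℕ → ℕ} {s₀ : ℕ → State}
    (hE : ∀ i < b * b, Exec (wordBound c (2 * (m + 1) * (m + 1))) A.prepare
      (State.initial (graphInput (Grid.graph (2 * (m + 1)) (m + 1)) (Grid.start m (block M m b i))))
      (t₀ i) (s₀ i)) :
    ∃ S' t, Run C (algorithm R c K A).prepare
        (State.initial (tableInput N fun i j => (M i j).toNat)) t S' ∧
      t ≤ slow R c K * ((∑ i ∈ Finset.range (b * b), t₀ i) + 5 * (b * b) + 3 * m + 8) ∧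
      Setup N m b (R + wordBound c (2 * (m + 1) * (m + 1))) S' ∧ S'.Small X ∧
      ∀ i < b * b, Holds (wordBound c (2 * (m + 1) * (m + 1))) R
        (i * (R + wordBound c (2 * (m + 1) * (m + 1)))) (s₀ i) S' := by
  have hslow : 20 ≤ slow R c K := Nat.le_add_left _ _
  have hX := hP.two_le
  obtain ⟨S1, a1, a2, a3, a4, a5, a6⟩ := hP.sizes_run
    (S := State.initial (tableInput N fun i j => (M i j).toNat))
    ⟨fun r _ => by change 0 < X; omega, fun a => by change 0 < X; omega,
      tableInput_toNat_lt hP M⟩ (fun _ => rfl) rfl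
  obtain ⟨S2, t, b1, b2, b3⟩ := hP.blocks_run hA hE a2 a3 a4 a5 (fun a => by rw [a6]; rfl)
  refine ⟨S2, _, a1.seq b1, ?_, b3⟩
  have e : slow R c K * ((∑ i ∈ Finset.range (b * b), t₀ i) + 5 * (b * b) + 3 * m + 8) =
    slow R c K * (∑ i ∈ Finset.range (b * b), t₀ i) + b * b * (5 * slow R c K) +
    (2 * m + 5) * slow R c K + m * slow R c K + 3 * slow R c K := by ring
  have : m ≤ m * slow R c K := Nat.le_mul_of_pos_right _ (by omega)
  rw [e]
  omega

end

end OMv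

/-! ### One operation of one block -/

namespace OMv

open RAM RAM.Expr PathCount

section

/-- The program of an oracle for an operation. -/
def opProgram {n : ℕ} (A : Oracle) : Operation n → Prog
  | .query _ _ => A.answer
  | .update _ _ _ => A.change

theorem serves_cons {B n : ℕ} {A : Oracle} {G : SimpleGraph (Fin n)} {w : Sym2 (Fin n) → ℕ}
    {s : State} {op : Operation n} {l : List (Operation n)} {t : ℕ}
    (h : Serves B A G w s (op :: l) t) : ∃ t₁ s' t₂, t = t₁ + t₂ ∧
      Exec B (opProgram A op) (s.feed (listInput (opInput op))) t₁ s' ∧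
      (∀ a b, op = .query a b → s'.out 0 = count G w a b) ∧
      Serves B A G (Grid.applyOp w op) s' l t₂ := by
  cases h with
  | query h hout h' =>
    refine ⟨_, _, _, rfl, h, fun a b e => ?_, h'⟩
    cases e
    exact hout
  | update h h' => exact ⟨_, _, _, rfl, h, (fun a b e => by cases e), h'⟩

/-- Operation number `z` for the vector `v` finds out that entry `r` of the product is `1`. -/
def Hit {N : ℕ} (M : Fin N → Fin N → Bool) (v : Fin N → Bool) (m b z r : ℕ) : Prop :=
  m ≤ z % (3 * m) ∧ z % (3 * m) < 2 * m ∧ z / (3 * m) / b * m + (z % (3 * m) - m) = r ∧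
    ∃ j < m, block M m b (z / (3 * m)) (z % (3 * m) - m) j = true ∧
      blockVec v m b (z / (3 * m)) j = true

variable {R c K N m b X C : ℕ}

open Classical in
theorem Params.oracle_run (hP : Params R c K N m b X C) {A : Oracle} (hA : A.answer.UsesBelow R)
    (hA' : A.change.UsesBelow R) {M : Fin N → Fin N → Bool} {v : Fin N → Bool} {z : ℕ}
    {S s : State} {w : Sym2 (Fin (2 * (m + 1) * (m + 1))) → ℕ}
    {l : List (Operation (2 * (m + 1) * (m + 1)))} {t B : ℕ}
    (hB : B = wordBound c (2 * (m + 1) * (m + 1)))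
    (hz : z / (3 * m) < b * b) (ho : z % (3 * m) < 3 * m)
    (h1 : Setup N m b (R + B) S) (h2 : S.Small X) (hid : S.reg rId = z / (3 * m))
    (hop : S.reg rOp = z % (3 * m)) (hbs : S.reg rBase = z / (3 * m) * (R + B))
    (hout : S.reg rOut = 0)
    (htest : S.reg rTest ≠ 0 ↔ m ≤ z % (3 * m) ∧ z % (3 * m) < 2 * m)
    (h4 : S.inp = listInput (List.ofFn fun j => (v j).toNat))
    (h5 : Holds B R (z / (3 * m) * (R + B)) s S)
    (h6 : Grid.Stage m (block M m b (z / (3 * m))) (blockVec v m b (z / (3 * m))) (z % (3 * m)) w)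
    (h7 : Serves B A (Grid.graph (2 * (m + 1)) (m + 1)) w s
      (Grid.opAt m (blockVec v m b (z / (3 * m))) (z % (3 * m)) :: l) t) :
    ∃ S' s' t₁ t₂, t = t₁ + t₂ ∧ Run C (oracleProg R A) S (slow R c K * t₁ + 4 * slow R c K) S' ∧
      Setup N m b (R + B) S' ∧ S'.Small X ∧ S'.reg rZ = S.reg rZ ∧ S'.inp = S.inp ∧
      Holds B R (z / (3 * m) * (R + B)) s' S' ∧
      Serves B A (Grid.graph (2 * (m + 1)) (m + 1))
        (Grid.applyOp w (Grid.opAt m (blockVec v m b (z / (3 * m))) (z % (3 * m)))) s' l t₂ ∧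
      (∀ a, a < z / (3 * m) * (R + B) ∨ z / (3 * m) * (R + B) + (R + B) ≤ a →
        S'.mem a = S.mem a) ∧
      ∀ r, S'.out r = if Hit M v m b z r then 1 else S.out r := by
  have hslow : 20 ≤ slow R c K := Nat.le_add_left _ _
  have hb := hP.base_lt hz
  have hXC := hP.X_le
  have hX2 := hP.two_le
  rw [← hB] at hb
  obtain ⟨t₁, s', t₂, e1, e2, e3, e4⟩ := serves_cons h7
  -- Queries and updates differ only in the oracle's program; in both cases its input is given by
  -- `opExpr`.
  have key : ∀ p : Prog, p.UsesBelow R →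
      Exec B p (s.feed (listInput (opInput (Grid.opAt m (blockVec v m b (z / (3 * m)))
        (z % (3 * m)))))) t₁ s' → ∃ S', Run C (simulate R opExpr p) S (slow R c K * t₁) S' ∧
        Simulates X B R (z / (3 * m) * (R + B)) S s' S' := by
    intro p hp he
    obtain ⟨S', q1, q2, -⟩ := simulate_run (C := C) (e := opExpr) (S₀ := S) hb hXC hbs
      (below_of_good (good_of_mem (R := R) (c := c) (K := K) opExpr (by simp [exprs])))
      (fun S' hs hf _ => ⟨hP.ok hs (by simp [exprs]), by
        have g1 : S'.reg rOp = z % (3 * m) := by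
          rw [hf.reg rOp (by decide) (by decide) (by decide), hop]
        have g2 : S'.reg rId = z / (3 * m) := by
          rw [hf.reg rId (by decide) (by decide) (by decide), hid]
        rw [eval_opExpr (h1.frame hf) (v := v) (hf.inp.trans h4) g1 ho, g2]; rfl⟩)
      he hp rfl S ⟨⟨h5.reg, h5.mem, h5.bound⟩, h2, hout, .refl _ _ _⟩
    exact ⟨S', q1.mono (Nat.mul_le_mul_right _ (cost_le (by simp [exprs]))), q2⟩
  by_cases hq : m ≤ z % (3 * m) ∧ z % (3 * m) < 2 * m
  · have hopAt : Grid.opAt m (blockVec v m b (z / (3 * m))) (z % (3 * m)) =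
        .query (Grid.vert m (z % (3 * m) - m) 0)
          (Grid.vert m (2 * m + 1 - (z % (3 * m) - m)) m) := by
      rw [Grid.opAt, if_neg (by omega), if_pos hq.2]
    rw [hopAt] at e2
    obtain ⟨S6, q1, q2⟩ := key A.answer hA (by rw [hopAt]; exact e2)
    have hcount := e3 _ _ hopAt
    have hiff := h6.one_lt_count hq.1 hq.2 (i := z % (3 * m) - m) (by omega)
    rw [← hcount, ← q2.out] at hiff
    have n1 := h1.frame q2.frame
    have r1 := hP.assign q2.small rTest (e := lt 1 (reg rOut)) (by simp [exprs])
    have k2 := q2.small.setReg rTest (x := (lt 1 (reg rOut)).eval S6) (by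
      simp only [eval_lt_expr]; split_ifs <;> omega)
    have k1 := n1.setReg (r := rTest) (by decide) ((lt 1 (reg rOut)).eval S6)
    have krow : ∀ x, rowExpr.eval (S6.setReg rTest x) =
        z / (3 * m) / b * m + (z % (3 * m) - m) := by
      intro x
      have g1 : (S6.setReg rTest x).reg rOp = z % (3 * m) := by
        rw [State.setReg_reg, if_neg (by decide), q2.frame.reg rOp (by decide) (by decide)
          (by decide), hop]
      have g2 : (S6.setReg rTest x).reg rId = z / (3 * m) := by
        rw [State.setReg_reg, if_neg (by decide), q2.frame.reg rId (by decide) (by decide)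
          (by decide), hid]
      have g3 := n1.setReg (r := rTest) (by decide) x
      simp only [rowExpr, blockRow, eval_add, eval_mul, eval_sub, eval_div, eval_reg, g1, g2, g3.m,
        g3.side]
    by_cases hc : 1 < S6.reg rOut
    · have hv : (lt 1 (reg rOut)).eval S6 = 1 := if_pos hc
      rw [hv] at r1 k1 k2
      have r2 := Run.setOut (below_of_good (good_of_mem (R := R) (c := c) (K := K) rowExpr
        (by simp [exprs]))) (below_of_good (good_of_mem (R := R) (c := c) (K := K) (1 : Expr)
        (by simp [exprs]))) (hP.ok k2 (e := rowExpr) (by simp [exprs]))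
        (hP.ok k2 (e := 1) (by simp [exprs]))
      rw [krow, eval_ofNat] at r2
      have r3 := (r2.ifTrue (r := rTest) (p' := .skip) (by decide)
        (by rw [State.setReg_reg, if_pos rfl]; decide))
      refine ⟨_, s', t₁, t₂, e1, ((q1.seq (r1.seq r3)).ifTrue (by decide) (htest.2 hq)).mono ?_,
        ⟨k1.size, k1.m, k1.side, k1.stride⟩, ⟨k2.reg, k2.mem, k2.inp⟩, ?_, q2.frame.inp,
        ⟨q2.holds.reg, q2.holds.mem, q2.holds.bound⟩, e4, q2.frame.mem, ?_⟩
      · have c1 := cost_le (R := R) (c := c) (K := K) (e := rowExpr) (by simp [exprs])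
        have c2 := cost_le (R := R) (c := c) (K := K) (e := 1) (by simp [exprs])
        omega
      · change (S6.setReg rTest 1).reg rZ = _
        rw [State.setReg_reg, if_neg (by decide), q2.frame.reg rZ (by decide) (by decide)
          (by decide)]
      · intro r
        change Function.update S6.out _ 1 r = _
        rw [Function.update_apply, q2.frame.out]
        -- The count exceeds 1, so a common 1 exists and only the row number in `Hit` remains to be
        -- matched.
        have : Hit M v m b z r ↔ r = z / (3 * m) / b * m + (z % (3 * m) - m) :=
          ⟨fun h => h.2.2.1.symm, fun h => ⟨hq.1, hq.2, h.symm, hiff.1 hc⟩⟩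
        simp only [this]
    · have hv : (lt 1 (reg rOut)).eval S6 = 0 := if_neg hc
      rw [hv] at r1 k1 k2
      have r3 := (Run.skip (B := C) (S6.setReg rTest 0)).ifFalse (r := rTest)
        (p := RAM.setOut rowExpr 1) (by decide) (by rw [State.setReg_reg, if_pos rfl])
      refine ⟨_, s', t₁, t₂, e1, ((q1.seq (r1.seq r3)).ifTrue (by decide) (htest.2 hq)).mono ?_,
        k1, k2, ?_, q2.frame.inp, ⟨q2.holds.reg, q2.holds.mem, q2.holds.bound⟩, e4,
        q2.frame.mem, ?_⟩
      · omega
      · rw [State.setReg_reg, if_neg (by decide), q2.frame.reg rZ (by decide) (by decide)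
          (by decide)]
      · intro r
        change S6.out r = _
        rw [q2.frame.out, if_neg]
        exact fun h => hc (hiff.2 h.2.2.2)
  · have hop' : opProgram A (Grid.opAt m (blockVec v m b (z / (3 * m))) (z % (3 * m))) =
        A.change := by
      unfold Grid.opAt
      split_ifs
      · rfl
      · omega
      · rfl
    rw [hop'] at e2
    obtain ⟨S6, q1, q2⟩ := key A.change hA' e2
    refine ⟨S6, s', t₁, t₂, e1, (q1.ifFalse (by decide) (by_contra fun h => hq (htest.1 h))).mono ?_,
      h1.frame q2.frame, q2.small, q2.frame.reg rZ (by decide) (by decide) (by decide),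
      q2.frame.inp, q2.holds, e4, q2.frame.mem, fun r => ?_⟩
    · omega
    · rw [q2.frame.out, if_neg]
      exact fun h => hq ⟨h.1, h.2.1⟩

open Classical in
theorem Params.op_run (hP : Params R c K N m b X C) {A : Oracle} (hA : A.answer.UsesBelow R)
    (hA' : A.change.UsesBelow R) {M : Fin N → Fin N → Bool} {v : Fin N → Bool} {z : ℕ}
    {S s : State} {w : Sym2 (Fin (2 * (m + 1) * (m + 1))) → ℕ}
    {l : List (Operation (2 * (m + 1) * (m + 1)))} {t B : ℕ}
    (hB : B = wordBound c (2 * (m + 1) * (m + 1)))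
    (hz : z < b * b * (3 * m))
    (h1 : Setup N m b (R + B) S) (h2 : S.Small X) (h3 : S.reg rZ = z)
    (h4 : S.inp = listInput (List.ofFn fun j => (v j).toNat))
    (h5 : Holds B R (z / (3 * m) * (R + B)) s S)
    (h6 : Grid.Stage m (block M m b (z / (3 * m))) (blockVec v m b (z / (3 * m))) (z % (3 * m)) w)
    (h7 : Serves B A (Grid.graph (2 * (m + 1)) (m + 1)) w s
      (Grid.opAt m (blockVec v m b (z / (3 * m))) (z % (3 * m)) :: l) t) :
    ∃ S' s' t₁ t₂, t = t₁ + t₂ ∧ Run C (opProg R A) S (slow R c K * t₁ + 10 * slow R c K) S' ∧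
      Setup N m b (R + B) S' ∧ S'.Small X ∧ S'.reg rZ = z + 1 ∧ S'.inp = S.inp ∧
      Holds B R (z / (3 * m) * (R + B)) s' S' ∧
      Serves B A (Grid.graph (2 * (m + 1)) (m + 1))
        (Grid.applyOp w (Grid.opAt m (blockVec v m b (z / (3 * m))) (z % (3 * m)))) s' l t₂ ∧
      (∀ a, a < z / (3 * m) * (R + B) ∨ z / (3 * m) * (R + B) + (R + B) ≤ a →
        S'.mem a = S.mem a) ∧
      ∀ r, S'.out r = if Hit M v m b z r then 1 else S.out r := by
  have hX2 := hP.two_le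
  have hlt := hP.ops_lt
  have hm : 0 < 3 * m := by
    rcases Nat.eq_zero_or_pos (3 * m) with h | h
    · rw [h, Nat.mul_zero] at hz; omega
    · exact h
  have hid : z / (3 * m) < b * b := Nat.div_lt_of_lt_mul (by rwa [Nat.mul_comm])
  have ho : z % (3 * m) < 3 * m := Nat.mod_lt _ hm
  have hle : z / (3 * m) ≤ z := Nat.div_le_self _ _
  have hle' : z % (3 * m) ≤ z := Nat.mod_le _ _
  have hb := hP.base_lt hid
  rw [← hB] at hb
  have hBpos : 0 < B := hB ▸ Nat.pow_pos (by omega)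
  have e1 : idExpr.eval S = z / (3 * m) := by
    simp only [idExpr, eval_div, eval_mul, eval_ofNat, eval_reg, h3, h1.m]
  have r1 := hP.assign h2 rId (e := idExpr) (by simp [exprs])
  rw [e1] at r1
  have j1 := h1.setReg (r := rId) (by decide) (z / (3 * m))
  have j2 := h2.setReg rId (x := z / (3 * m)) (by omega)
  have e2 : opNumberExpr.eval (S.setReg rId (z / (3 * m))) = z % (3 * m) := by
    simp only [opNumberExpr, eval_mod, eval_mul, eval_ofNat, eval_reg, j1.m]
    rw [State.setReg_reg, if_neg (by decide), h3]
  have r2 := hP.assign j2 rOp (e := opNumberExpr) (by simp [exprs])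
  rw [e2] at r2
  have k1 := j1.setReg (r := rOp) (by decide) (z % (3 * m))
  have k2 := j2.setReg rOp (x := z % (3 * m)) (by omega)
  have e3 : baseExpr.eval ((S.setReg rId (z / (3 * m))).setReg rOp (z % (3 * m))) =
      z / (3 * m) * (R + B) := by
    simp only [baseExpr, eval_mul, eval_reg, k1.stride]
    rw [State.setReg_reg, if_neg (by decide), State.setReg_reg, if_pos rfl]
  have r3 := hP.assign k2 rBase (e := baseExpr) (by simp [exprs])
  rw [e3] at r3
  have l1 := k1.setReg (r := rBase) (by decide) (z / (3 * m) * (R + B))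
  have l2 := k2.setReg rBase (x := z / (3 * m) * (R + B)) (by omega)
  have r4 := hP.assign l2 rOut (e := 0) (by simp [exprs])
  rw [eval_ofNat] at r4
  have m1 := l1.setReg (r := rOut) (by decide) 0
  have m2 := l2.setReg rOut (x := 0) (by omega)
  change Run C _ _ _ ((((S.setReg rId (z / (3 * m))).setReg rOp (z % (3 * m))).setReg rBase
    (z / (3 * m) * (R + B))).setReg rOut 0) at r4
  generalize hS4 : (((S.setReg rId (z / (3 * m))).setReg rOp (z % (3 * m))).setReg rBase
    (z / (3 * m) * (R + B))).setReg rOut 0 = S4 at *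
  have g1 : S4.reg rOp = z % (3 * m) := by
    rw [← hS4]; simp [State.setReg_reg, rOut, rBase, rOp]
  have r5 := hP.assign m2 rTest (e := isQueryExpr) (by simp [exprs])
  have e5 : isQueryExpr.eval S4 ≠ 0 ↔ m ≤ z % (3 * m) ∧ z % (3 * m) < 2 * m := by
    simp only [isQueryExpr, eval_ite, eval_lt_expr, eval_mul, eval_ofNat, eval_reg, g1, m1.m,
      indicator_ne_zero]
    split_ifs <;> omega
  have e5' : isQueryExpr.eval S4 < 2 := by
    simp only [isQueryExpr, eval_ite, eval_lt_expr, eval_mul, eval_ofNat, eval_reg, g1, m1.m,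
      indicator_ne_zero]
    split_ifs <;> omega
  generalize isQueryExpr.eval S4 = x at *
  obtain ⟨S6, s', t₁, t₂, p1, p2, p3, p4, p5, p6, p7, p8, p9, p10⟩ :=
    hP.oracle_run (S := S4.setReg rTest x) hA hA' hB hid ho (m1.setReg (by decide) x)
      (m2.setReg rTest (x := x) (by omega))
      (by rw [← hS4]; simp [State.setReg_reg, rOut, rBase, rOp, rTest, rId])
      (by rw [← hS4]; simp [State.setReg_reg, rOut, rBase, rOp, rTest])
      (by rw [← hS4]; simp [State.setReg_reg, rOut, rBase, rTest])
      (by rw [← hS4]; simp [State.setReg_reg, rOut, rTest])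
      (by rw [State.setReg_reg, if_pos rfl]; exact e5)
      (by rw [← hS4]; exact h4) (Holds.congr h5 (by rw [← hS4]; exact fun _ _ _ => rfl)) h6 h7
  have g3 : S6.reg rZ = z := by
    rw [p5, ← hS4]
    simpa [State.setReg_reg, rOut, rBase, rTest, rOp, rId, rZ] using h3
  have r7 := hP.assign p4 rZ (e := reg rZ + 1) (by simp [exprs])
  have e7 : (reg rZ + 1 : Expr).eval S6 = z + 1 := by
    change S6.reg rZ + 1 = z + 1
    rw [g3]
  rw [e7] at r7
  have hmem : (S4.setReg rTest x).mem = S.mem := by rw [← hS4]; rfl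
  refine ⟨_, s', t₁, t₂, p1, (r1.seq (r2.seq (r3.seq (r4.seq (r5.seq (p2.seq r7)))))).mono
    (by omega), p3.setReg (by decide) _, p4.setReg rZ (by omega), by simp [State.setReg_reg], ?_,
    Holds.congr p7 fun _ _ _ => rfl, p8, ?_, ?_⟩
  · exact p6.trans (by rw [← hS4]; rfl)
  · intro a ha
    exact (p9 a ha).trans (by rw [hmem])
  · intro r
    exact (p10 r).trans (by rw [← hS4]; rfl)

end

end OMv

/-! ### One vector -/

namespace OMv

open RAM RAM.Expr PathCount

section

variable {R c K N m b X C : ℕ}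

/-- The number of operations that block `i` has seen after `z` operations for the same vector. -/
def progress (m z i : ℕ) : ℕ := min (3 * m) (z - 3 * m * i)

theorem progress_self {m z : ℕ} (hm : 0 < 3 * m) : progress m z (z / (3 * m)) = z % (3 * m) := by
  have h1 := Nat.div_add_mod z (3 * m)
  have h2 := Nat.mod_lt z hm
  unfold progress
  omega

theorem progress_succ_self {m z : ℕ} (hm : 0 < 3 * m) :
    progress m (z + 1) (z / (3 * m)) = z % (3 * m) + 1 := by
  have h1 := Nat.div_add_mod z (3 * m)
  have h2 := Nat.mod_lt z hm
  unfold progress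
  omega

theorem progress_succ {m z i : ℕ} (hm : 0 < 3 * m) (hi : i ≠ z / (3 * m)) :
    progress m (z + 1) i = progress m z i := by
  have h1 := Nat.div_add_mod z (3 * m)
  have h2 := Nat.mod_lt z hm
  unfold progress
  rcases Nat.lt_or_gt_of_ne hi with h | h
  · have h3 := Nat.mul_le_mul_left (3 * m) (Nat.succ_le_of_lt h)
    rw [Nat.mul_succ] at h3
    omega
  · have h3 := Nat.mul_le_mul_left (3 * m) (Nat.succ_le_of_lt h)
    rw [Nat.mul_succ] at h3
    omega

theorem progress_total {m L i : ℕ} (hi : i < L) : progress m (L * (3 * m)) i = 3 * m := by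
  unfold progress
  have h3 := Nat.mul_le_mul_left (3 * m) (Nat.succ_le_of_lt hi)
  rw [Nat.mul_succ, Nat.mul_comm (3 * m) L] at h3
  omega

open Classical in
theorem Params.answer_run (hP : Params R c K N m b X C) {A : Oracle} (hA : A.answer.UsesBelow R)
    (hA' : A.change.UsesBelow R) {M : Fin N → Fin N → Bool} {v : Fin N → Bool} {B : ℕ}
    (hB : B = wordBound c (2 * (m + 1) * (m + 1))) {S : State} {s : ℕ → State}
    {w : ℕ → Sym2 (Fin (2 * (m + 1) * (m + 1))) → ℕ}
    {l : ℕ → List (Operation (2 * (m + 1) * (m + 1)))} {t : ℕ → ℕ}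
    (h1 : Setup N m b (R + B) S) (h2 : S.Small X)
    (h3 : S.inp = listInput (List.ofFn fun j => (v j).toNat)) (h4 : ∀ r, S.out r = 0)
    (h5 : ∀ i < b * b, Holds B R (i * (R + B)) (s i) S ∧
      Grid.Stage m (block M m b i) (blockVec v m b i) 0 (w i) ∧
      Serves B A (Grid.graph (2 * (m + 1)) (m + 1)) (w i) (s i)
        (Grid.ops m (blockVec v m b i) ++ l i) (t i)) :
    ∃ (S' : State) (T : ℕ) (s' : ℕ → State)
      (w' : ℕ → Sym2 (Fin (2 * (m + 1) * (m + 1))) → ℕ) (t' : ℕ → ℕ), Run C (algorithm R c K A).answer S T S' ∧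
      T + slow R c K * ∑ i ∈ Finset.range (b * b), t' i ≤
        slow R c K * ∑ i ∈ Finset.range (b * b), t i +
          b * b * (3 * m) * (12 * slow R c K) + 3 * slow R c K ∧
      Setup N m b (R + B) S' ∧ S'.Small X ∧
      (∀ i < b * b, Holds B R (i * (R + B)) (s' i) S' ∧
        Grid.Stage m (block M m b i) (blockVec v m b i) 0 (w' i) ∧
        Serves B A (Grid.graph (2 * (m + 1)) (m + 1)) (w' i) (s' i) (l i) (t' i)) ∧
      ∀ r, S'.out r = if ∃ z < b * b * (3 * m), Hit M v m b z r then 1 else 0 := by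
  have hslow : 20 ≤ slow R c K := Nat.le_add_left _ _
  have hX2 := hP.two_le
  have r0 := hP.assign h2 rZ (e := 0) (by simp [exprs])
  rw [eval_ofNat] at r0
  obtain ⟨S', T, τ', g1, ⟨w', s', t', g2, g3, g4, g5, g6⟩, g7⟩ :=
    run_loop_count (C := C) (r := rTest) (p := RAM.assign rTest moreOpsExpr) (p' := opProg R A)
    (by decide) (b * b * (3 * m))
    (fun z S' τ => ∃ (w : ℕ → Sym2 (Fin (2 * (m + 1) * (m + 1))) → ℕ) (s : ℕ → State) (t : ℕ → ℕ),
      Setup N m b (R + B) S' ∧ S'.Small X ∧ S'.reg rZ = z ∧ S'.inp = S.inp ∧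
      (∀ i < b * b, Holds B R (i * (R + B)) (s i) S' ∧
        Grid.Stage m (block M m b i) (blockVec v m b i) (progress m z i) (w i) ∧
        Serves B A (Grid.graph (2 * (m + 1)) (m + 1)) (w i) (s i)
          ((Grid.ops m (blockVec v m b i)).drop (progress m z i) ++ l i) (t i)) ∧
      (∀ r, S'.out r = if ∃ z' < z, Hit M v m b z' r then 1 else 0) ∧
      slow R c K * ∑ i ∈ Finset.range (b * b), t i +
        (b * b * (3 * m) - z) * (12 * slow R c K) + 2 * slow R c K ≤ τ)
    (fun S' τ => ∃ (w : ℕ → Sym2 (Fin (2 * (m + 1) * (m + 1))) → ℕ) (s : ℕ → State) (t : ℕ → ℕ),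
      Setup N m b (R + B) S' ∧ S'.Small X ∧
      (∀ i < b * b, Holds B R (i * (R + B)) (s i) S' ∧
        Grid.Stage m (block M m b i) (blockVec v m b i) (3 * m) (w i) ∧
        Serves B A (Grid.graph (2 * (m + 1)) (m + 1)) (w i) (s i) (l i) (t i)) ∧
      (∀ r, S'.out r = if ∃ z' < b * b * (3 * m), Hit M v m b z' r then 1 else 0) ∧
      slow R c K * ∑ i ∈ Finset.range (b * b), t i ≤ τ)
    (by
      rintro z S1 τ hz ⟨w, s, t, i1, i2, i3, i4, i5, i6, i7⟩
      have hm : 0 < 3 * m := by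
        rcases Nat.eq_zero_or_pos (3 * m) with h | h
        · rw [h, Nat.mul_zero] at hz; omega
        · exact h
      have hid : z / (3 * m) < b * b := Nat.div_lt_of_lt_mul (by rwa [Nat.mul_comm])
      have e1 : moreOpsExpr.eval S1 = 1 := by
        simp only [moreOpsExpr, eval_lt_expr, eval_mul, eval_reg, eval_ofNat, i3, i1.side, i1.m]
        exact if_pos hz
      have r1 := hP.assign i2 rTest (e := moreOpsExpr) (by simp [exprs])
      rw [e1] at r1
      have j1 := i1.setReg (r := rTest) (by decide) 1
      have j2 := i2.setReg rTest (x := 1) (by omega)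
      obtain ⟨k1, k2, k3⟩ := i5 _ hid
      rw [progress_self hm] at k2 k3
      rw [Grid.ops_drop _ (Nat.mod_lt _ hm), List.cons_append] at k3
      obtain ⟨S2, s', t₁, t₂, q1, q2, q3, q4, q5, q6, q7, q8, q9, q10⟩ :=
        hP.op_run hA hA' hB hz j1 j2
        (by rw [State.setReg_reg, if_neg (by decide), i3]) (i4.trans h3)
        (Holds.congr k1 fun _ _ _ => rfl) k2 k3
      -- Only the block in turn spends time: its remaining total `t` drops by `t₁`, which pays for
      -- this iteration.
      have hsum : ∑ i ∈ Finset.range (b * b), t i =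
          t₁ + ∑ i ∈ Finset.range (b * b), Function.update t (z / (3 * m)) t₂ i := by
        rw [Finset.sum_update_of_mem (Finset.mem_range.2 hid),
          Finset.sum_eq_add_sum_sdiff_singleton_of_mem (Finset.mem_range.2 hid), q1]
        omega
      refine ⟨_, _, _, _, slow R c K *
        ∑ i ∈ Finset.range (b * b), Function.update t (z / (3 * m)) t₂ i +
        (b * b * (3 * m) - (z + 1)) * (12 * slow R c K) + 2 * slow R c K, r1,
        by simp [State.setReg_reg], q2, ⟨Function.update w (z / (3 * m))
        (Grid.applyOp (w (z / (3 * m))) (Grid.opAt m (blockVec v m b (z / (3 * m))) (z % (3 * m)))),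
        Function.update s (z / (3 * m)) s', _, q3, q4, q5, q6.trans i4, ?_, ?_, le_rfl⟩, ?_⟩
      · intro i hi
        by_cases h : i = z / (3 * m)
        · subst h
          rw [Function.update_self, Function.update_self, Function.update_self,
            progress_succ_self hm]
          exact ⟨q7, k2.applyOp (Nat.mod_lt _ hm), q8⟩
        · rw [Function.update_of_ne h, Function.update_of_ne h, Function.update_of_ne h,
            progress_succ hm h]
          obtain ⟨n1, n2⟩ := i5 i hi
          refine ⟨Holds.congr n1 fun a h6 h7 => ?_, n2⟩
          refine (q9 a ?_).trans rfl
          rcases Nat.lt_or_gt_of_ne h with h8 | h8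
          · have := Nat.mul_le_mul_right (R + B) (Nat.succ_le_of_lt h8)
            rw [Nat.succ_mul] at this
            omega
          · have := Nat.mul_le_mul_right (R + B) (Nat.succ_le_of_lt h8)
            rw [Nat.succ_mul] at this
            omega
      · intro r
        rw [q10 r]
        change (if _ then 1 else S1.out r) = _
        rw [i6 r]
        by_cases h : Hit M v m b z r
        · rw [if_pos h, if_pos ⟨z, Nat.lt_succ_self z, h⟩]
        · rw [if_neg h]
          refine if_congr ⟨fun ⟨z', h6, h7⟩ => ⟨z', by omega, h7⟩, fun ⟨z', h6, h7⟩ => ?_⟩ rfl rfl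
          rcases Nat.lt_succ_iff_lt_or_eq.1 h6 with h6 | rfl
          · exact ⟨z', h6, h7⟩
          · exact absurd h7 h
      · have h8 : b * b * (3 * m) - z = b * b * (3 * m) - (z + 1) + 1 := by omega
        rw [hsum, h8, Nat.mul_add, Nat.add_mul] at i7
        omega)
    (by
      rintro S1 τ ⟨w, s, t, i1, i2, i3, i4, i5, i6, i7⟩
      have e1 : moreOpsExpr.eval S1 = 0 := by
        simp only [moreOpsExpr, eval_lt_expr, eval_mul, eval_reg, eval_ofNat, i3, i1.side, i1.m]
        exact if_neg (Nat.lt_irrefl _)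
      have r1 := hP.assign i2 rTest (e := moreOpsExpr) (by simp [exprs])
      rw [e1] at r1
      refine ⟨_, _, slow R c K * ∑ i ∈ Finset.range (b * b), t i, r1, by simp [State.setReg_reg],
        ⟨w, s, t, i1.setReg (by decide) 0, i2.setReg rTest (x := 0) (by omega), fun i hi => ?_, i6,
        le_rfl⟩, by omega⟩
      obtain ⟨n1, n2, n3⟩ := i5 i hi
      rw [progress_total hi] at n2 n3
      rw [List.drop_of_length_le (by simp [Grid.ops]), List.nil_append] at n3
      exact ⟨Holds.congr n1 fun _ _ _ => rfl, n2, n3⟩)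
    (b * b * (3 * m)) 0 (S.setReg rZ 0) (slow R c K * ∑ i ∈ Finset.range (b * b), t i +
        b * b * (3 * m) * (12 * slow R c K) + 2 * slow R c K) (Nat.zero_add _)
    ⟨w, s, t, h1.setReg (by decide) 0, h2.setReg rZ (by omega), by simp [State.setReg_reg], rfl,
      fun i hi => by
        obtain ⟨n1, n2, n3⟩ := h5 i hi
        have : progress m 0 i = 0 := by unfold progress; omega
        rw [this, List.drop_zero]
        exact ⟨Holds.congr n1 fun _ _ _ => rfl, n2, n3⟩,
      fun r => by
        rw [if_neg (by rintro ⟨z', h, -⟩; omega)]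
        exact h4 r,
      by rw [Nat.sub_zero]⟩
  refine ⟨S', _, s', w', t', r0.seq g1, by omega, g2, g3, fun i hi => ?_, g5⟩
  obtain ⟨n1, n2, n3⟩ := g4 i hi
  exact ⟨n1, n2.restart (Or.inr le_rfl) (Or.inl rfl) _, n3⟩

end

/-- Padding with `false` creates no hits, and each pair (i, j) inside the matrix is met by one query
of one block. -/
theorem exists_hit_iff {N m b : ℕ} (hm : 0 < m) (hb : b = N / m + 1) (M : Fin N → Fin N → Bool)
    (v : Fin N → Bool) (i : Fin N) : (∃ z < b * b * (3 * m), Hit M v m b z i) ↔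
      ∃ j, M i j = true ∧ v j = true := by
  have hdiv : ∀ j : Fin N, (j : ℕ) / m < b := fun j => by
    have := Nat.div_le_div_right (c := m) j.2.le
    omega
  constructor
  · rintro ⟨z, -, h1, h2, h3, j, hj, h4, h5⟩
    unfold block pad at h4
    unfold blockVec padVec at h5
    -- A padded entry that is true lies inside the original matrix.
    split_ifs at h4 with h6
    rw [dif_pos h6.2] at h5
    refine ⟨_, ?_, h5⟩
    convert h4 using 2
    exact Fin.ext h3.symm
  · rintro ⟨j, h1, h2⟩
    -- The witness is the block in block row `i / m` and block column `j / m`, and in it query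
    -- number `i % m`, which comes after the `m` updates.
    have hz : ((i : ℕ) / m * b + j / m) * (3 * m) + (m + i % m) < b * b * (3 * m) := by
      have h3 : (i : ℕ) / m * b + j / m < b * b := by
        have h4 := Nat.mul_le_mul_right b (Nat.succ_le_of_lt (hdiv i))
        rw [Nat.succ_mul] at h4
        have := hdiv j
        omega
      have h4 := Nat.mul_le_mul_right (3 * m) (Nat.succ_le_of_lt h3)
      rw [Nat.succ_mul] at h4
      have := Nat.mod_lt i hm
      omega
    have hmod := Nat.mod_lt (i : ℕ) hm
    have e1 : (((i : ℕ) / m * b + j / m) * (3 * m) + (m + i % m)) % (3 * m) = m + i % m := by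
      rw [Nat.mul_add_mod_self_right, Nat.mod_eq_of_lt (by omega)]
    have e2 : (((i : ℕ) / m * b + j / m) * (3 * m) + (m + i % m)) / (3 * m) = i / m * b + j / m := by
      rw [Nat.add_comm, Nat.add_mul_div_right _ _ (by omega), Nat.div_eq_of_lt (by omega),
        Nat.zero_add]
    have e3 : ((i : ℕ) / m * b + j / m) / b = i / m := by
      rw [Nat.add_comm, Nat.add_mul_div_right _ _ (hb ▸ Nat.succ_pos _), Nat.div_eq_of_lt (hdiv j),
        Nat.zero_add]
    have e4 : ((i : ℕ) / m * b + j / m) % b = j / m := by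
      rw [Nat.mul_add_mod_self_right, Nat.mod_eq_of_lt (hdiv j)]
    refine ⟨_, hz, ?_⟩
    unfold Hit
    rw [e1, e2, e3, Nat.add_sub_cancel_left]
    refine ⟨by omega, by omega, Nat.div_add_mod' _ _, j % m, Nat.mod_lt _ hm, ?_, ?_⟩
    · unfold block pad
      rw [e3, e4, Nat.div_add_mod', Nat.div_add_mod', dif_pos ⟨i.2, j.2⟩]
      exact h1
    · unfold blockVec padVec
      rw [e4, Nat.div_add_mod', dif_pos j.2]
      exact h2

end OMv

/-! ### Numbers of queries and updates -/

namespace PathCount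

variable {n : ℕ}

theorem numQueries_append (l l' : List (Operation n)) :
    numQueries (l ++ l') = numQueries l + numQueries l' := by
  induction l with
  | nil => simp [numQueries]
  | cons o l ih => cases o <;> simp only [List.cons_append, numQueries, ih]; omega

theorem numUpdates_append (l l' : List (Operation n)) :
    numUpdates (l ++ l') = numUpdates l + numUpdates l' := by
  induction l with
  | nil => simp [numUpdates]
  | cons o l ih => cases o <;> simp only [List.cons_append, numUpdates, ih]; omega

/-- An oracle for arbitrary updates handles unit updates in particular, so it is enough to refute
the latter kind. -/
theorem Legal.arbitrary {k : UpdateKind} {U : ℕ} {G : SimpleGraph (Fin n)}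
    {l : List (Operation n)} : ∀ {w}, Legal k U G w l → Legal .arbitrary U G w l := by
  induction l with
  | nil => exact fun h => h
  | cons o l ih =>
    intro w h
    cases o with
    | query a b => exact ih (w := w) h
    | update a b x => exact ⟨h.1, h.2.1, trivial, ih h.2.2.2⟩

end PathCount

namespace Grid

open PathCount

variable {m : ℕ}

/-- Stated for prefixes to allow induction; the queries are the operations from `m` to `2 * m - 1`.
-/
theorem numQueries_range (v : ℕ → Bool) (k : ℕ) :
    numQueries ((List.range k).map (opAt m v)) = min k (2 * m) - m := by
  induction k with
  | zero => simp [numQueries]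
  | succ k ih =>
    rw [List.range_succ, List.map_append, numQueries_append, ih]
    unfold opAt
    rw [List.map_singleton]
    split_ifs <;> simp only [numQueries] <;> omega

theorem numUpdates_range (v : ℕ → Bool) (k : ℕ) :
    numUpdates ((List.range k).map (opAt m v)) = k - (min k (2 * m) - m) := by
  induction k with
  | zero => simp [numUpdates]
  | succ k ih =>
    rw [List.range_succ, List.map_append, numUpdates_append, ih]
    unfold opAt
    rw [List.map_singleton]
    split_ifs <;> simp only [numUpdates] <;> omega

theorem numQueries_flatMap (l : List (ℕ → Bool)) :
    numQueries (l.flatMap (ops m)) = l.length * m := by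
  induction l with
  | nil => simp [numQueries]
  | cons v l ih =>
    rw [List.flatMap_cons, numQueries_append, ih, ops, numQueries_range, List.length_cons,
      Nat.add_one_mul l.length]
    omega

theorem numUpdates_flatMap (l : List (ℕ → Bool)) :
    numUpdates (l.flatMap (ops m)) = l.length * (2 * m) := by
  induction l with
  | nil => simp [numUpdates]
  | cons v l ih =>
    rw [List.flatMap_cons, numUpdates_append, ih, ops, numUpdates_range, List.length_cons,
      Nat.add_one_mul l.length]
    omega

end Grid

namespace RAM

theorem State.Agree.feed {k : ℕ} {s s' : State} (h : s.Agree k s') (x : ℕ → ℕ) :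
    (s.feed x).Agree k (s'.feed x) :=
  ⟨h.reg, h.mem, rfl, rfl⟩

end RAM

/-! ### The whole stream of vectors -/

namespace OMv

open RAM RAM.Expr PathCount

section

variable {R c K N m b X C : ℕ}

open Classical in
theorem Params.answers (hP : Params R c K N m b X C) {A : Oracle} (hA : A.answer.UsesBelow R)
    (hA' : A.change.UsesBelow R) {M : Fin N → Fin N → Bool} {B : ℕ}
    (hB : B = wordBound c (2 * (m + 1) * (m + 1))) (l : List (Fin N → Bool)) :
    ∀ {S S₁ : State} {s : ℕ → State} {w : ℕ → Sym2 (Fin (2 * (m + 1) * (m + 1))) → ℕ} {t : ℕ → ℕ},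
    Setup N m b (R + B) S → S.Small X → S.Agree tmp S₁ →
    (∀ i < b * b, Holds B R (i * (R + B)) (s i) S ∧
      Grid.Stage m (block M m b i) (fun _ => false) 0 (w i) ∧
      Serves B A (Grid.graph (2 * (m + 1)) (m + 1)) (w i) (s i)
        (l.flatMap fun v => Grid.ops m (blockVec v m b i)) (t i)) →
    ∃ T, Answers C (algorithm R c K A).answer M S₁ l T ∧
      T ≤ slow R c K * ∑ i ∈ Finset.range (b * b), t i +
          l.length * (b * b * (3 * m) * (12 * slow R c K) + 3 * slow R c K) := by
  induction l with
  | nil => exact fun _ _ _ _ => ⟨0, .nil _, Nat.zero_le _⟩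
  | cons v l ih =>
    intro S S₁ s w t h1 h2 h3 h4
    have hX2 := hP.two_le
    have hsmall : (S.feed (listInput (List.ofFn fun j => (v j).toNat))).Small X :=
      ⟨h2.reg, h2.mem, fun a => by
        change listInput _ a < X
        rw [listInput_ofFn]
        have := Bool.toNat_le (padVec v a)
        omega⟩
    obtain ⟨S', T, s', w', t', g1, g2, g3, g4, g5, g6⟩ :=
      hP.answer_run (S := S.feed (listInput (List.ofFn fun j => (v j).toNat))) hA hA' hB
      ⟨h1.size, h1.m, h1.side, h1.stride⟩ hsmall rfl (fun _ => rfl)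
      (fun i hi => ⟨Holds.congr (h4 i hi).1 fun _ _ _ => rfl,
        (h4 i hi).2.1.restart (Or.inl rfl) (Or.inl rfl) (blockVec v m b i), (h4 i hi).2.2⟩)
    obtain ⟨T₁, S₁', e1, e2, e3⟩ := g1 _ (h3.feed _)
    obtain ⟨T₂, f1, f2⟩ := ih g3 g4 e3 (fun i hi => ⟨(g5 i hi).1,
      (g5 i hi).2.1.restart (Or.inl rfl) (Or.inl rfl) _, (g5 i hi).2.2⟩)
    refine ⟨_, .cons e1 (fun i => ?_) f1, ?_⟩
    -- The output has an entry `i`, so `N` is positive and hence so is its root `m`.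
    · have hm : 0 < m := by
        rcases Nat.eq_zero_or_pos m with rfl | h
        · have h5 := hP.lt_pow
          have := i.2
          rw [Nat.zero_add, one_pow] at h5
          omega
        · exact h
      rw [e3.out, g6, product]
      exact if_congr (exists_hit_iff hm hP.side M v i) rfl rfl
    · rw [List.length_cons, Nat.succ_mul]
      omega

end

/-- The exponents are generous: `b ^ 2` is at most the square of `N + 2`, a block graph has `n + 2 ≤
(N + 2) ^ 3`, whence `3 * c` for its words, and the constant `R` is below `2 ^ R`. The degrees of
the expressions are summed to bound each of them. -/
theorem params_of_root {R c K N m : ℕ} (hK : 0 < K) (h1 : m ^ K ≤ N) (h2 : N < (m + 1) ^ K) :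
    Params R c K N m (N / m + 1) ((N + 2) ^ (R + 3 * c + 6))
      (wordBound ((R + 3 * c + 6) * ((exprs R c K).map deg).sum) N) := by
  have hmN : m ≤ N := (Nat.le_self_pow hK.ne' m).trans h1
  have hpow : ∀ k, 0 < (N + 2) ^ k := fun k => Nat.pow_pos (by omega)
  have hmono : ∀ {j k}, j ≤ k → (N + 2) ^ j ≤ (N + 2) ^ k := fun h =>
    Nat.pow_le_pow_right (by omega) h
  have hN : N + 2 ≤ (N + 2) ^ (R + 3 * c + 6) := Nat.le_self_pow (by omega) _
  have hb : (N / m + 1) * (N / m + 1) ≤ (N + 2) ^ 2 := by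
    have := Nat.div_le_self N m
    rw [sq]
    exact Nat.mul_le_mul (by omega) (by omega)
  have hB : wordBound c (2 * (m + 1) * (m + 1)) ≤ (N + 2) ^ (3 * c) := by
    rw [wordBound, pow_mul]
    refine Nat.pow_le_pow_left ?_ _
    have : 2 * (m + 1) * (m + 1) ≤ 2 * (N + 1) * (N + 1) :=
      Nat.mul_le_mul (by omega) (by omega)
    nlinarith
  have hseg : R + wordBound c (2 * (m + 1) * (m + 1)) < (N + 2) ^ (R + 3 * c + 1) := by
    have e1 : R < (N + 2) ^ (R + 3 * c) :=
      calc R < 2 ^ R := Nat.lt_two_pow_self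
        _ ≤ (N + 2) ^ R := Nat.pow_le_pow_left (by omega) _
        _ ≤ _ := hmono (by omega)
    have e2 : (N + 2) ^ (3 * c) ≤ (N + 2) ^ (R + 3 * c) := hmono (by omega)
    rw [pow_succ]
    nlinarith [hpow (R + 3 * c)]
  refine ⟨h1, h2, hK, rfl, by omega, by omega, hseg.trans_le (hmono (by omega)), ?_, ?_, ?_⟩
  · calc _ ≤ (N + 2) ^ 2 * (R + wordBound c (2 * (m + 1) * (m + 1))) := Nat.mul_le_mul_right _ hb
      _ < (N + 2) ^ 2 * (N + 2) ^ (R + 3 * c + 1) := Nat.mul_lt_mul_of_pos_left hseg (hpow 2)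
      _ ≤ _ := by rw [← pow_add]; exact hmono (by omega)
  · have h3 : 3 * m < (N + 2) ^ 3 := by nlinarith
    calc _ ≤ (N + 2) ^ 2 * (3 * m) := Nat.mul_le_mul_right _ hb
      _ < (N + 2) ^ 2 * (N + 2) ^ 3 := Nat.mul_lt_mul_of_pos_left h3 (hpow 2)
      _ ≤ _ := by rw [← pow_add]; exact hmono (by omega)
  · intro e he
    have := List.single_le_sum (l := (exprs R c K).map deg) (by simp) _ (List.mem_map_of_mem he)
    rw [← pow_mul]
    exact hmono (Nat.mul_le_mul_left _ this)

/-- A dynamic oracle for path counting yields an online algorithm for matrix-vector multiplication,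
for blocks of any size `m`, a root of `N`. -/
theorem exists_solvesInTime {A : Oracle} {q u : ℕ → ℝ≥0} {c : ℕ}
    (hc : ∀ (n : ℕ) (G : SimpleGraph (Fin n)), IsPlanar G →
      ∀ (w : Sym2 (Fin n) → ℕ) (l : List (Operation n)), Legal .unit (n ^ 4) G w l →
        ∃ (t₀ : ℕ) (s₀ : State) (t : ℕ),
          Exec (wordBound c n) A.prepare (State.initial (graphInput G w)) t₀ s₀ ∧
          Serves (wordBound c n) A G w s₀ l t ∧
          ((t₀ + t : ℕ) : ℝ) ≤ ((n : ℝ) + 2) ^ c + numQueries l * q n + numUpdates l * u n)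
    {K : ℕ} (hK : 0 < K) {m : ℕ → ℕ} (h1 : ∀ N, m N ^ K ≤ N) (h2 : ∀ N, N < (m N + 1) ^ K) :
    ∃ (A' : Algorithm) (D : ℕ), A'.SolvesInTime fun N =>
      D * (((N / m N + 1 : ℕ) : ℝ) ^ 2 * ((((2 * (m N + 1) * (m N + 1) : ℕ) : ℝ) + 2) ^ c +
        N * m N * (q (2 * (m N + 1) * (m N + 1)) + 2 * u (2 * (m N + 1) * (m N + 1)))) +
        (36 * N * m N + 5) * ((N / m N + 1 : ℕ) : ℝ) ^ 2 + 3 * m N + 3 * N + 8) := by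
  obtain ⟨R₁, hR₁⟩ := A.prepare.exists_usesBelow
  obtain ⟨R₂, hR₂⟩ := A.answer.exists_usesBelow
  obtain ⟨R₃, hR₃⟩ := A.change.exists_usesBelow
  obtain ⟨R, h3, h4, h5⟩ : ∃ R, R₁ ≤ R ∧ R₂ ≤ R ∧ R₃ ≤ R :=
    ⟨R₁ + R₂ + R₃, by omega, by omega, by omega⟩
  refine ⟨algorithm R c K A, slow R c K, (R + 3 * c + 6) * ((exprs R c K).map deg).sum,
    fun N M v => ?_⟩
  have hP := params_of_root (R := R) (c := c) hK (h1 N) (h2 N)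
  beta_reduce
  generalize m N = m at *
  generalize hb : N / m + 1 = b at *
  -- The operations are independent of the answers, so each oracle is applied to its entire sequence
  -- for all `N` vectors; only the total running time over that sequence is controlled.
  have hO := fun i => hc _ _ (Grid.isPlanar (2 * (m + 1)) (m + 1))
    (Grid.start m (block M m b i)) (((List.ofFn v).map fun v => blockVec v m b i).flatMap
      (Grid.ops m)) (Grid.Stage.legal _ (Grid.stage_start _ fun _ => false))
  choose t₀ s₀ t hE hS hT using hO
  obtain ⟨S, T₀, p1, p2, p3, p4, p5⟩ := hP.prepare_run (hR₁.mono h3) (fun i _ => hE i)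
  obtain ⟨T₀', S', q1, q2, q3⟩ := p1 _ (.refl _ _)
  obtain ⟨T, r1, r2⟩ := hP.answers (hR₂.mono h4) (hR₃.mono h5) rfl (List.ofFn v) p3 p4 q3
    (fun i hi => ⟨p5 i hi, Grid.stage_start _ _, by
      have := hS i
      rwa [List.flatMap_map] at this⟩)
  refine ⟨T₀', S', T, q1, r1, ?_⟩
  rw [List.length_ofFn] at r2
  have hle : T₀' + T ≤ slow R c K * ((∑ i ∈ Finset.range (b * b), (t₀ i + t i)) +
      ((36 * N * m + 5) * b ^ 2 + 3 * m + 3 * N + 8)) := by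
    rw [Finset.sum_add_distrib]
    calc T₀' + T ≤ _ := Nat.add_le_add (q2.trans p2) r2
      _ = _ := by ring
  have hsum : ((∑ i ∈ Finset.range (b * b), (t₀ i + t i) : ℕ) : ℝ) ≤
      (b : ℝ) ^ 2 * ((((2 * (m + 1) * (m + 1) : ℕ) : ℝ) + 2) ^ c +
        N * m * (q (2 * (m + 1) * (m + 1)) + 2 * u (2 * (m + 1) * (m + 1)))) := by
    rw [Nat.cast_sum]
    calc _ ≤ ∑ i ∈ Finset.range (b * b), ((((2 * (m + 1) * (m + 1) : ℕ) : ℝ) + 2) ^ c +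
        N * m * (q (2 * (m + 1) * (m + 1)) + 2 * u (2 * (m + 1) * (m + 1)) : ℝ)) := by
          refine Finset.sum_le_sum fun i _ => (hT i).trans (le_of_eq ?_)
          rw [Grid.numQueries_flatMap, Grid.numUpdates_flatMap, List.length_map, List.length_ofFn]
          push_cast
          ring
      _ = _ := by
          rw [Finset.sum_const, Finset.card_range, nsmul_eq_mul]
          push_cast
          ring
  have hle' : ((T₀' + T : ℕ) : ℝ) ≤ slow R c K * (((∑ i ∈ Finset.range (b * b), (t₀ i + t i) : ℕ) : ℝ) +
      ((36 * N * m + 5) * (b : ℝ) ^ 2 + 3 * m + 3 * N + 8)) := by exact_mod_cast hle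
  refine hle'.trans (mul_le_mul_of_nonneg_left ?_ (Nat.cast_nonneg _))
  linarith

end OMv

/-! ### The running time and the contradiction -/

namespace OMv

open RAM PathCount

theorem exists_integer_root {K : ℕ} (hK : 0 < K) (N : ℕ) : ∃ m : ℕ, m ^ K ≤ N ∧ N < (m + 1) ^ K := by
  refine ⟨Nat.findGreatest (fun m => m ^ K ≤ N) N,
    Nat.findGreatest_spec (P := fun m => m ^ K ≤ N) (m := 0) (Nat.zero_le N)
      (by rw [zero_pow hK.ne']; exact Nat.zero_le N), not_le.1 fun h => ?_⟩
  exact Nat.findGreatest_is_greatest (P := fun m => m ^ K ≤ N) (Nat.lt_succ_self _)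
    ((Nat.le_self_pow hK.ne' _).trans h) h

/-- The running time for blocks of size `x`, if `Q` is the time for an operation. -/
theorem time_le {N x b n Q E a : ℝ} {c : ℕ} (hx : 1 ≤ x) (hxN : x ≤ N) (hb : 0 ≤ b)
    (hbx : b * x ≤ 2 * N) (hE : 1 ≤ E) (hEx : E ≤ x) (hc : x ^ (2 * c) * E ≤ N)
    (hn : 0 ≤ n) (hn' : n + 2 ≤ 10 * x ^ 2) (hQ : Q * E ≤ a * x) (ha : 0 ≤ a) :
    (b ^ 2 * ((n + 2) ^ c + N * x * Q) + (36 * N * x + 5) * b ^ 2 + 3 * x + 3 * N + 8) * E ≤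
      (4 * 10 ^ c + 4 * a + 178) * N ^ 3 := by
  have hN : 1 ≤ N := hx.trans hxN
  have hbx0 : 0 ≤ b * x := by positivity
  have hbx2 : (b * x) ^ 2 ≤ 4 * N ^ 2 := by nlinarith
  have hbN : b ≤ 2 * N := by nlinarith
  have hb2 : b ^ 2 ≤ 4 * N ^ 2 := by nlinarith
  -- Preprocessing: since `x ^ (2 * c) * E ≤ N`, a block costs at most `10 ^ c * N`, even after
  -- multiplication by the saving `E`.
  have t1 : b ^ 2 * (n + 2) ^ c * E ≤ 4 * 10 ^ c * N ^ 3 := by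
    have h1 : (n + 2) ^ c ≤ 10 ^ c * x ^ (2 * c) := by
      rw [pow_mul, ← mul_pow]
      exact pow_le_pow_left₀ (by linarith) hn' c
    have h2 : (n + 2) ^ c * E ≤ 10 ^ c * N := by
      calc (n + 2) ^ c * E ≤ 10 ^ c * x ^ (2 * c) * E :=
            mul_le_mul_of_nonneg_right h1 (by linarith)
        _ = 10 ^ c * (x ^ (2 * c) * E) := by ring
        _ ≤ 10 ^ c * N := mul_le_mul_of_nonneg_left hc (by positivity)
    calc b ^ 2 * (n + 2) ^ c * E = b ^ 2 * ((n + 2) ^ c * E) := by ring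
      _ ≤ 4 * N ^ 2 * (10 ^ c * N) := mul_le_mul hb2 h2 (by positivity) (by positivity)
      _ = _ := by ring
  -- The main term: an operation takes time about `x / E`, and `b * x` is about `N`.
  have t2 : b ^ 2 * (N * x * Q) * E ≤ 4 * a * N ^ 3 := by
    calc b ^ 2 * (N * x * Q) * E = b ^ 2 * N * x * (Q * E) := by ring
      _ ≤ b ^ 2 * N * x * (a * x) := mul_le_mul_of_nonneg_left hQ (by positivity)
      _ = a * N * (b * x) ^ 2 := by ring
      _ ≤ a * N * (4 * N ^ 2) := mul_le_mul_of_nonneg_left hbx2 (by positivity)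
      _ = _ := by ring
  have t3 : 36 * N * x * b ^ 2 * E ≤ 144 * N ^ 3 := by
    calc 36 * N * x * b ^ 2 * E ≤ 36 * N * x * b ^ 2 * x :=
          mul_le_mul_of_nonneg_left hEx (by positivity)
      _ = 36 * N * (b * x) ^ 2 := by ring
      _ ≤ 36 * N * (4 * N ^ 2) := mul_le_mul_of_nonneg_left hbx2 (by positivity)
      _ = _ := by ring
  have hN2 : N ^ 2 ≤ N ^ 3 := pow_le_pow_right₀ hN (by norm_num)
  have t4 : 5 * b ^ 2 * E ≤ 20 * N ^ 3 := by
    calc 5 * b ^ 2 * E ≤ 5 * b ^ 2 * x := mul_le_mul_of_nonneg_left hEx (by positivity)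
      _ = 5 * (b * (b * x)) := by ring
      _ ≤ 5 * (2 * N * (2 * N)) := by
          have := mul_le_mul hbN hbx hbx0 (by positivity : (0 : ℝ) ≤ 2 * N)
          linarith
      _ ≤ _ := by nlinarith
  have t5 : (3 * x + 3 * N + 8) * E ≤ 14 * N ^ 3 := by
    calc (3 * x + 3 * N + 8) * E ≤ 14 * N * N :=
          mul_le_mul (by linarith) (by linarith) (by linarith) (by positivity)
      _ ≤ _ := by nlinarith
  linarith

/-- There is no fast dynamic oracle, even for updates that change a weight by one. -/
theorem Conjecture.not_counts_unit (hOMv : Conjecture) {ε : ℝ} (hε : 0 < ε) (hε' : ε ≤ 1 / 4)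
    {q u : ℕ → ℝ≥0}
    (hO : (fun n : ℕ => (q n : ℝ) + (u n : ℝ)) =O[atTop] fun n : ℕ => (n : ℝ) ^ (1 / 2 - ε))
    (A : Oracle) : ¬ A.Counts .unit 4 q u := by
  rintro ⟨c, hc⟩
  -- With `k ^ K ≤ N`, the preprocessing of a block of size `k`, of order `k ^ (2 * c)`, stays below
  -- `N` with a factor `k` to spare for the saving.
  obtain ⟨K, hK⟩ : ∃ K, K = 2 * c + 1 := ⟨_, rfl⟩
  have hK0 : 0 < K := by omega
  choose m hm hm' using exists_integer_root hK0
  obtain ⟨A', D, hA'⟩ := exists_solvesInTime hc hK0 hm hm'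
  -- An operation on about `2 * k ^ 2` vertices takes order `k ^ (1 - 2 * ε)`; the saving `k ^ (2 *
  -- ε)` is comparable to `N ^ (2 * ε / K)`.
  refine hOMv (2 * ε / K) (by positivity) ⟨A', _, hA', ?_⟩
  obtain ⟨a, ha, ha'⟩ := hO.exists_pos
  obtain ⟨n₀, hn₀⟩ := eventually_atTop.1 ha'.bound
  refine IsBigO.of_bound (D * (2 * (4 * 10 ^ c + 4 * (16 * a) + 178))) ?_
  filter_upwards [eventually_ge_atTop (n₀ ^ K), eventually_ge_atTop 1] with N hN hN1
  have h1 := hm N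
  have h2 := hm' N
  generalize m N = k at *
  -- The asymptotic bound speaks about large graphs, so the block size must exceed the threshold as
  -- well.
  have hk : n₀ < k + 1 := lt_of_pow_lt_pow_left₀ K (Nat.zero_le _) (hN.trans_lt h2)
  have hk1 : 1 ≤ k := by
    by_contra h
    have h : k = 0 := by omega
    rw [h, Nat.zero_add, one_pow] at h2
    omega
  have hkN : k ≤ N := (Nat.le_self_pow hK0.ne' k).trans h1
  have hx : (1 : ℝ) ≤ k := by exact_mod_cast hk1
  have hN1' : (1 : ℝ) ≤ N := by exact_mod_cast hN1
  have hQ := hn₀ (2 * (k + 1) * (k + 1)) (by nlinarith)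
  have hn : ((2 * (k + 1) * (k + 1) : ℕ) : ℝ) ≤ 8 * (k : ℝ) ^ 2 := by
    push_cast
    nlinarith
  have hn' : ((2 * (k + 1) * (k + 1) : ℕ) : ℝ) + 2 ≤ 10 * (k : ℝ) ^ 2 := by nlinarith
  generalize 2 * (k + 1) * (k + 1) = n at *
  rw [Real.norm_of_nonneg (by positivity), Real.norm_of_nonneg (by positivity)] at hQ
  rw [Real.norm_of_nonneg (by positivity), Real.norm_of_nonneg (by positivity)]
  have hE : (1 : ℝ) ≤ (k : ℝ) ^ (2 * ε) := Real.one_le_rpow hx (by linarith)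
  have hEx : (k : ℝ) ^ (2 * ε) ≤ k := by
    calc (k : ℝ) ^ (2 * ε) ≤ (k : ℝ) ^ (1 : ℝ) := Real.rpow_le_rpow_of_exponent_le hx (by linarith)
      _ = k := Real.rpow_one _
  have hQE : ((q n : ℝ) + 2 * u n) * (k : ℝ) ^ (2 * ε) ≤ 16 * a * k := by
    have e1 : (n : ℝ) ^ (1 / 2 - ε) ≤ 8 * (k : ℝ) ^ (1 - 2 * ε) := by
      calc (n : ℝ) ^ (1 / 2 - ε) ≤ (8 * (k : ℝ) ^ 2) ^ (1 / 2 - ε) :=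
            Real.rpow_le_rpow (Nat.cast_nonneg n) hn (by linarith)
        _ = 8 ^ (1 / 2 - ε) * (k : ℝ) ^ (1 - 2 * ε) := by
            rw [Real.mul_rpow (by norm_num) (by positivity), ← Real.rpow_natCast,
              ← Real.rpow_mul (by positivity)]
            congr 2
            push_cast
            ring
        _ ≤ 8 ^ (1 : ℝ) * (k : ℝ) ^ (1 - 2 * ε) := by
            gcongr
            · norm_num
            · linarith
        _ = _ := by rw [Real.rpow_one]
    have e2 : (k : ℝ) ^ (1 - 2 * ε) * (k : ℝ) ^ (2 * ε) = k := by
      rw [← Real.rpow_add (by linarith), sub_add_cancel, Real.rpow_one]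
    calc ((q n : ℝ) + 2 * u n) * (k : ℝ) ^ (2 * ε)
        ≤ (2 * (a * (8 * (k : ℝ) ^ (1 - 2 * ε)))) * (k : ℝ) ^ (2 * ε) := by
          refine mul_le_mul_of_nonneg_right ?_ (by positivity)
          have e3 := mul_le_mul_of_nonneg_left e1 ha.le
          have e4 : (0 : ℝ) ≤ q n := (q n).2
          linarith
      _ = 16 * a * ((k : ℝ) ^ (1 - 2 * ε) * (k : ℝ) ^ (2 * ε)) := by ring
      _ = _ := by rw [e2]
  have hcE : (k : ℝ) ^ (2 * c) * (k : ℝ) ^ (2 * ε) ≤ N := by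
    calc (k : ℝ) ^ (2 * c) * (k : ℝ) ^ (2 * ε) ≤ (k : ℝ) ^ (2 * c) * k :=
          mul_le_mul_of_nonneg_left hEx (by positivity)
      _ = ((k ^ K : ℕ) : ℝ) := by rw [hK, pow_succ]; push_cast; ring
      _ ≤ N := by exact_mod_cast h1
  have hb : ((N / k + 1 : ℕ) : ℝ) * k ≤ 2 * N := by
    have h3 : (N / k + 1) * k ≤ 2 * N := by
      have := Nat.div_mul_le_self N k
      rw [Nat.add_one_mul]
      omega
    exact_mod_cast h3
  -- The root is exact up to rounding: `N < (k + 1) ^ K ≤ (2 * k) ^ K`.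
  have hNE : (N : ℝ) ^ (2 * ε / K) ≤ 2 * (k : ℝ) ^ (2 * ε) := by
    have h3 : (N : ℝ) ≤ (2 * (k : ℝ)) ^ K := by
      calc (N : ℝ) ≤ ((k : ℝ) + 1) ^ K := by exact_mod_cast h2.le
        _ ≤ _ := pow_le_pow_left₀ (by positivity) (by linarith) K
    calc (N : ℝ) ^ (2 * ε / K) ≤ ((2 * (k : ℝ)) ^ K) ^ (2 * ε / K) :=
          Real.rpow_le_rpow (by positivity) h3 (by positivity)
      _ = (2 * (k : ℝ)) ^ (2 * ε) := by
          rw [← Real.rpow_natCast, ← Real.rpow_mul (by positivity), mul_div_cancel₀]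
          exact_mod_cast hK0.ne'
      _ = 2 ^ (2 * ε) * (k : ℝ) ^ (2 * ε) := Real.mul_rpow (by norm_num) (by positivity)
      _ ≤ 2 ^ (1 : ℝ) * (k : ℝ) ^ (2 * ε) := by
          gcongr
          · norm_num
          · linarith
      _ = _ := by rw [Real.rpow_one]
  have hT := time_le hx (by exact_mod_cast hkN) (Nat.cast_nonneg _) hb hE hEx hcE
    (Nat.cast_nonneg n) hn' hQE (by positivity)
  rw [mul_assoc (D : ℝ)]
  refine mul_le_mul_of_nonneg_left ?_ (Nat.cast_nonneg (α := ℝ) D)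
  rw [Real.rpow_sub (by linarith), ← mul_div_assoc, le_div_iff₀ (by positivity)]
  have e : (N : ℝ) ^ (3 : ℝ) = (N : ℝ) ^ 3 := by norm_cast
  refine (mul_le_mul_of_nonneg_left hNE (by positivity)).trans ?_
  rw [e, mul_left_comm, mul_assoc 2]
  exact mul_le_mul_of_nonneg_left hT (by norm_num)

end OMv

theorem theorem6p1 (hOMv : OMv.Conjecture) :
    ∃ d : ℕ, ∀ ε : ℝ, 0 < ε → ∀ q u : ℕ → ℝ≥0,
      ((fun n : ℕ => (q n : ℝ) + (u n : ℝ)) =O[atTop] fun n : ℕ => (n : ℝ) ^ (1 / 2 - ε)) →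
      (¬ ∃ A : PathCount.Oracle, A.Counts .arbitrary d q u) ∧
      (¬ ∃ A : PathCount.Oracle, A.Counts .unit d q u) := by
  refine ⟨4, fun ε hε q u hO => ?_⟩
  -- A larger saving implies a smaller one; with `ε ≤ 1 / 4` the exponent `1 / 2 - ε` is nonnegative
  -- and `2 * ε ≤ 1`.
  have hO' : (fun n : ℕ => (q n : ℝ) + (u n : ℝ)) =O[atTop]
      fun n : ℕ => (n : ℝ) ^ (1 / 2 - min ε (1 / 4)) := by
    refine hO.trans (IsBigO.of_bound 1 ?_)
    filter_upwards [eventually_ge_atTop 1] with n hn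
    rw [Real.norm_of_nonneg (by positivity), Real.norm_of_nonneg (by positivity), one_mul]
    exact Real.rpow_le_rpow_of_exponent_le (by exact_mod_cast hn)
      (sub_le_sub_left (min_le_left _ _) _)
  have hunit := hOMv.not_counts_unit (lt_min hε (by norm_num)) (min_le_right _ _) hO'
  refine ⟨?_, fun ⟨A, hA⟩ => hunit A hA⟩
  rintro ⟨A, c, hA⟩
  exact hunit A ⟨c, fun n G hG w l hl => hA n G hG w l hl.arbitrary⟩
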